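/- Let $k$ be a field and let $(H,\xi_H)$ be a monoidal Hom-Hopf algebra over $k$ with bijective antipode $S$: that is, $\xi_H$ is a linear automorphism of $H$, and there are linear maps $m,\Delta,\varepsilon,S$ and an element $1_H$, all compatible with $\xi_H$, such that $\xi_H(a)(bc)=(ab)\xi_H(c)$, $a1_H=1_Ha=\xi_H(a)$, $\xi_H^{-1}(h_1)\otimes\Delta(h_2)=\Delta(h_1)\otimes\xi_H^{-1}(h_2)$, $h_1\varepsilon(h_2)=\xi_H^{-1}(h)=\varepsilon(h_1)h_2$, $\Delta$ and $\varepsilon$ are multiplicative and unital, and $S(h_1)h_2=\varepsilon(h)1_H=h_1S(h_2)$. Let $\mathrm{Aut}_{mHH}(H)$ be the group of automorphisms of this structure and let $G=\mathrm{Aut}_{mHH}(H)\times\mathrm{Aut}_{mHH}(H)$ with multiplication $(\alpha,\beta)(\gamma,\delta)=(\alpha\gamma,\ \delta\gamma^{-1}\beta\gamma)$, so that $(\alpha,\beta)^{-1}=(\alpha^{-1},\alpha\beta^{-1}\alpha^{-1})$. For $(\alpha,\beta)\in G$, an $(\alpha,\beta)$-Yetter–Drinfeld Hom-module is a $k$-space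 $M$ with a linear automorphism $\xi_M$, a left action of $H$ and a right coaction $\rho(m)=m_0\otimes m_1\in M\otimes H$ such that $\xi_H(a)\cdot(b\cdot m)=(ab)\cdot\xi_M(m)$, $\xi_M(a\cdot m)=\xi_H(a)\cdot\xi_M(m)$, $1_H\cdot m=\xi_M(m)$, $\xi_M^{-1}(m_0)\otimes\Delta(m_1)=m_{00}\otimes m_{01}\otimes\xi_H^{-1}(m_1)$, $\rho(\xi_M(m))=\xi_M(m_0)\otimes\xi_H(m_1)$, $m_0\varepsilon(m_1)=\xi_M^{-1}(m)$ and $$\rho(h\cdot m)=\xi_H(h_{21})\cdot m_0\otimes(\beta(h_{22})\xi_H^{-1}(m_1))\,\alpha(S^{-1}(h_1)).$$ Morphisms are the $H$-linear and $H$-colinear maps that commute with the automorphisms $\xi$. Let $\mathcal{MHYD}(H)$ be the disjoint union over $(\alpha,\beta)\in G$ of the categories of $(\alpha,\beta)$-Yetter–Drinfeld Hom-modules (with no morphisms between different components), and let $\mathcal{MHYD}(H)_{fd}$ be its full subcategory of finite-dimensional objects. The following structures are considered on it, for $M$ in the component $(\alpha,\beta)$ and $N$ in the component $(\gamma,\delta)$.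 * Tensor product: $(M\otimes N,\xi_M\otimes\xi_N)$ with $h\cdot(m\otimes n)=\gamma(h_1)\cdot m\otimes\gamma^{-1}\beta\gamma(h_2)\cdot n$ and $\rho(m\otimes n)=(m_0\otimes n_0)\otimes n_1m_1$, in the component $(\alpha,\beta)(\gamma,\delta)$. Unit: $k$ with $\xi_k=\mathrm{id}$, $h\cdot 1=\varepsilon(h)$, $\rho(1)=1\otimes 1_H$, in the component of the identity. Constraints: $(m\otimes n)\otimes p\mapsto\xi_M(m)\otimes(n\otimes\xi_P^{-1}(p))$, $x\otimes m\mapsto x\,\xi_M(m)$, $m\otimes x\mapsto x\,\xi_M(m)$. * Conjugation by $g=(\alpha,\beta)\in G$: ${}^{g}N=(N,\xi_N)$ with action $h\triangleright n=\gamma^{-1}\beta\gamma\alpha^{-1}(h)\cdot n$ and coaction $n\mapsto n_0\otimes\alpha\beta^{-1}(n_1)$, in the component $g(\gamma,\delta)g^{-1}$; the identity on morphisms. * Braiding: $c_{M,N}:M\otimes N\to{}^{(\alpha,\beta)}N\otimes M$, $c_{M,N}(m\otimes n)=\xi_N(n_0)\otimes\beta^{-1}(n_1)\cdot\xi_M^{-1}(m)$.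 * Duals: $M^*$ and ${}^*M$ are the dual space $\mathrm{Hom}(M,k)$ with automorphism $p\mapsto p\circ\xi_M^{-1}$, in the component $(\alpha,\beta)^{-1}$. On $M^*$: $(h\cdot p)(m)=p(\beta^{-1}\alpha^{-1}S\xi_H^{-1}(h)\cdot\xi_M^{-2}(m))$ and $p_0(m)\otimes p_1=p(\xi_M^2(m_0))\otimes S^{-1}\xi_H(m_1)$. On ${}^*M$: $(h\cdot p)(m)=p(\beta^{-1}\alpha^{-1}S^{-1}\xi_H^{-1}(h)\cdot\xi_M^{-2}(m))$ and $p_0(m)\otimes p_1=p(\xi_M^2(m_0))\otimes S\xi_H(m_1)$. With dual bases $(c_i)$, $(c^i)$ put $b_M:k\to M\otimes M^*$, $1\mapsto\sum_ic_i\otimes c^i$; $d_M:M^*\otimes M\to k$, $p\otimes m\mapsto p(m)$; $b'_M:k\to{}^*M\otimes M$, $1\mapsto\sum_ic^i\otimes c_i$; $d'_M:M\otimes{}^*M\to k$, $m\otimes p\mapsto p(m)$. **Corollary 3.3.** These formulas define objects and morphisms of $\mathcal{MHYD}(H)_{fd}$, and with them $\mathcal{MHYD}(H)_{fd}$ is a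 braided $T$-category over $G$ with left and right dualities. Explicitly: 1. It is a monoidal category, and a crossed category over $G$: it is the disjoint union of its components $\mathcal C_g$ ($g\in G$), $\mathcal C_g\otimes\mathcal C_h\subseteq\mathcal C_{gh}$, and $g\mapsto{}^g(\cdot)$ is a group homomorphism from $G$ to the group of invertible strict tensor functors, with ${}^g\mathcal C_h\subseteq\mathcal C_{ghg^{-1}}$. 2. The $c_{U,V}:U\otimes V\to{}^UV\otimes U$ (where ${}^U(\cdot)$ is conjugation by the degree of $U$) are isomorphisms, natural in the sense that $({}^{U}g\otimes f)\circ c_{U,V}=c_{U',V'}\circ(f\otimes g)$ for all $f:U\to U'$, $g:V\to V'$; they satisfy $$c_{U\otimes V,W}=a_{{}^{U\otimes V}W,U,V}\,(c_{U,{}^VW}\otimes\mathrm{id}_V)\,a^{-1}_{U,{}^VW,V}\,(\mathrm{id}_U\otimes c_{V,W})\,a_{U,V,W},$$ $$c_{U,V\otimes W}=a^{-1}_{{}^UV,{}^UW,U}\,(\mathrm{id}_{{}^UV}\otimes c_{U,W})\,a_{{}^UV,U,W}\,(c_{U,V}\otimes\mathrm{id}_W)\,a^{-1}_{U,V,W},$$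 and ${}^g(c_{U,V})=c_{{}^gU,{}^gV}$ for all $g\in G$. 3. For every object $M$, $M^*$ with $b_M,d_M$ is a left dual of $M$ and ${}^*M$ with $b'_M,d'_M$ is a right dual of $M$: both triangle identities hold in each case, and both duals lie in the component inverse to that of $M$. -/

import Mathlib

open CategoryTheory MonoidalCategory TensorProduct

universe u v v₁ u₁

/-! ### Crossed categories, braidings -/

section TCategories

/-- A `MonoidalCategoryStruct` (tensor functor, unit object, constraints) is *monoidal* if it
satisfies all the laws of a monoidal category (functoriality of `⊗`, naturality of the constraints,
pentagon, triangle). -/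
def IsMonoidalStruct {C : Type u₁} [Category.{v₁} C] (S : MonoidalCategoryStruct C) : Prop :=
  ∃ m : MonoidalCategory C, m.toMonoidalCategoryStruct = S

/-- The monoidal category with prescribed structure `S`, once `S` satisfies the laws. -/
@[reducible]
def monoidalOfStruct {C : Type u₁} [Category.{v₁} C] (S : MonoidalCategoryStruct C)
    (h : IsMonoidalStruct S) : MonoidalCategory C where
  toMonoidalCategoryStruct := S
  tensorHom_def := by obtain ⟨m, rfl⟩ := h; exact m.tensorHom_def
  id_tensorHom_id := by obtain ⟨m, rfl⟩ := h; exact m.id_tensorHom_id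
  tensorHom_comp_tensorHom := by obtain ⟨m, rfl⟩ := h; exact m.tensorHom_comp_tensorHom
  whiskerLeft_id := by obtain ⟨m, rfl⟩ := h; exact m.whiskerLeft_id
  id_whiskerRight := by obtain ⟨m, rfl⟩ := h; exact m.id_whiskerRight
  associator_naturality := by obtain ⟨m, rfl⟩ := h; exact m.associator_naturality
  leftUnitor_naturality := by obtain ⟨m, rfl⟩ := h; exact m.leftUnitor_naturality
  rightUnitor_naturality := by obtain ⟨m, rfl⟩ := h; exact m.rightUnitor_naturality
  pentagon := by obtain ⟨m, rfl⟩ := h; exact m.pentagon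
  triangle := by obtain ⟨m, rfl⟩ := h; exact m.triangle

/-- The data of a braided `T`-category over the group `G` on a monoidal category `C`: the component
`deg U` in which an object `U` lies, the conjugation functors, and the braiding
`c_{U,V} : U ⊗ V ⟶ ᵁV ⊗ U`, where `ᵁV` is the conjugate of `V` by the degree of `U`. -/
structure TCategoryData (G : Type*) [Group G] (C : Type u₁) [Category.{v₁} C]
    [MonoidalCategory C] where
  deg : C → G
  conj : G → C ⥤ C
  braid : ∀ U V : C, U ⊗ V ⟶ (conj (deg U)).obj V ⊗ U

namespace TCategoryData

variable {G : Type*} [Group G] {C : Type u₁} [Category.{v₁} C] [MonoidalCategory C]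

/-- Crossed category over `G`: `C` is the disjoint union of its components `C_α = deg⁻¹(α)`
(there are no morphisms between different components), `C_α ⊗ C_β ⊆ C_{αβ}`, and conjugation is a
group homomorphism from `G` to the strict tensor automorphisms of `C`, with
`φ_β(C_α) ⊆ C_{βαβ⁻¹}`. Equalities between morphisms whose (co)domains are equal objects are
written with `eqToHom`. -/
structure IsCrossed (T : TCategoryData G C) : Prop where
  deg_eq_of_hom : ∀ {U V : C}, (U ⟶ V) → T.deg U = T.deg V
  deg_tensor : ∀ U V : C, T.deg (U ⊗ V) = T.deg U * T.deg V
  conj_one : T.conj 1 = 𝟭 C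
  conj_mul : ∀ g h : G, T.conj (g * h) = T.conj h ⋙ T.conj g
  deg_conj : ∀ (g : G) (U : C), T.deg ((T.conj g).obj U) = g * T.deg U * g⁻¹
  conj_tensorUnit : ∀ g : G, (T.conj g).obj (𝟙_ C) = 𝟙_ C
  conj_tensorObj : ∀ (g : G) (U V : C),
    (T.conj g).obj (U ⊗ V) = (T.conj g).obj U ⊗ (T.conj g).obj V
  conj_tensorHom : ∀ (g : G) {U V X Y : C} (f : U ⟶ V) (f₂ : X ⟶ Y),
    (T.conj g).map (f ⊗ₘ f₂) =
      eqToHom (conj_tensorObj g U X) ≫ ((T.conj g).map f ⊗ₘ (T.conj g).map f₂) ≫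
        eqToHom (conj_tensorObj g V Y).symm
  conj_associator : ∀ (g : G) (U V W : C),
    (T.conj g).map (α_ U V W).hom =
      eqToHom (by rw [conj_tensorObj, conj_tensorObj]) ≫
        (α_ ((T.conj g).obj U) ((T.conj g).obj V) ((T.conj g).obj W)).hom ≫
          eqToHom (by rw [conj_tensorObj, conj_tensorObj])
  conj_leftUnitor : ∀ (g : G) (U : C),
    (T.conj g).map (λ_ U).hom =
      eqToHom (by rw [conj_tensorObj, conj_tensorUnit]) ≫ (λ_ ((T.conj g).obj U)).hom
  conj_rightUnitor : ∀ (g : G) (U : C),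
    (T.conj g).map (ρ_ U).hom =
      eqToHom (by rw [conj_tensorObj, conj_tensorUnit]) ≫ (ρ_ ((T.conj g).obj U)).hom

/-- Braided `T`-category over `G`: a crossed category with a braiding. -/
structure IsBraidedTCategory (T : TCategoryData G C) : Prop extends IsCrossed T where
  braid_isIso : ∀ U V : C, IsIso (T.braid U V)
  braid_natural : ∀ {U X V Y : C} (f : U ⟶ X) (g : V ⟶ Y),
    T.braid U V ≫ ((T.conj (T.deg U)).map g ⊗ₘ f) ≫
        eqToHom (by rw [deg_eq_of_hom f]) =
      (f ⊗ₘ g) ≫ T.braid X Y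
  braid_tensor_left : ∀ U V W : C,
    T.braid (U ⊗ V) W =
      (α_ U V W).hom ≫ U ◁ T.braid V W ≫ (α_ U ((T.conj (T.deg V)).obj W) V).inv ≫
        T.braid U ((T.conj (T.deg V)).obj W) ▷ V ≫
          (α_ ((T.conj (T.deg U)).obj ((T.conj (T.deg V)).obj W)) U V).hom ≫
            eqToHom (by rw [deg_tensor, conj_mul, Functor.comp_obj])
  braid_tensor_right : ∀ U V W : C,
    T.braid U (V ⊗ W) =
      (α_ U V W).inv ≫ T.braid U V ▷ W ≫ (α_ ((T.conj (T.deg U)).obj V) U W).hom ≫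
        (T.conj (T.deg U)).obj V ◁ T.braid U W ≫
          (α_ ((T.conj (T.deg U)).obj V) ((T.conj (T.deg U)).obj W) U).inv ≫
            eqToHom (by rw [conj_tensorObj])
  conj_braid : ∀ (g : G) (U V : C),
    (T.conj g).map (T.braid U V) =
      eqToHom (conj_tensorObj g U V) ≫ T.braid ((T.conj g).obj U) ((T.conj g).obj V) ≫
        eqToHom (by
          rw [conj_tensorObj, deg_conj, ← Functor.comp_obj, ← conj_mul, ← Functor.comp_obj,
            ← conj_mul, inv_mul_cancel_right])

end TCategoryData

end TCategories

noncomputable section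

/-! ### Monoidal Hom-Hopf algebras with bijective antipode -/

/-- A monoidal Hom-Hopf algebra `(H, ξ)` over the field `k`, with bijective antipode `S`. -/
structure MonoidalHomHopf (k : Type u) (H : Type v) [Field k] [AddCommGroup H] [Module k H] where
  ξ : H ≃ₗ[k] H
  mul : H →ₗ[k] H →ₗ[k] H
  one : H
  comul : H →ₗ[k] H ⊗[k] H
  counit : H →ₗ[k] k
  S : H ≃ₗ[k] H
  -- monoidal Hom-algebra
  ξ_mul : ∀ a b, ξ (mul a b) = mul (ξ a) (ξ b)
  ξ_one : ξ one = one
  mul_assoc : ∀ a b c, mul (ξ a) (mul b c) = mul (mul a b) (ξ c)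
  mul_one : ∀ a, mul a one = ξ a
  one_mul : ∀ a, mul one a = ξ a
  -- monoidal Hom-coalgebra
  comul_ξ : ∀ c, comul (ξ c) = TensorProduct.map ξ.toLinearMap ξ.toLinearMap (comul c)
  counit_ξ : ∀ c, counit (ξ c) = counit c
  comul_coassoc : ∀ c,
    TensorProduct.map ξ.symm.toLinearMap comul (comul c) =
      TensorProduct.assoc k H H H (TensorProduct.map comul ξ.symm.toLinearMap (comul c))
  comul_counit : ∀ c, TensorProduct.rid k H (counit.lTensor H (comul c)) = ξ.symm c
  counit_comul : ∀ c, TensorProduct.lid k H (counit.rTensor H (comul c)) = ξ.symm c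
  -- `comul` and `counit` are morphisms of algebras
  comul_mul : ∀ a b, comul (mul a b) = TensorProduct.map₂ mul mul (comul a) (comul b)
  comul_one : comul one = one ⊗ₜ[k] one
  counit_mul : ∀ a b, counit (mul a b) = counit a * counit b
  counit_one : counit one = 1
  -- the antipode: a morphism of the Hom-category, convolution inverse to the identity
  S_ξ : ∀ a, S (ξ a) = ξ (S a)
  S_mul_id : ∀ a, TensorProduct.lift mul (S.toLinearMap.rTensor H (comul a)) = counit a • one
  id_mul_S : ∀ a, TensorProduct.lift mul (S.toLinearMap.lTensor H (comul a)) = counit a • one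

namespace MonoidalHomHopf

variable {k : Type u} {H : Type v} [Field k] [AddCommGroup H] [Module k H]

/-- The group `Aut_{mHH}(H)` of automorphisms of the monoidal Hom-Hopf algebra `H`, with
composition `(α * γ)(h) = α (γ h)` as multiplication. -/
def Aut (A : MonoidalHomHopf k H) : Subgroup (H ≃ₗ[k] H) where
  carrier := {f | (∀ a, f (A.ξ a) = A.ξ (f a)) ∧ (∀ a b, f (A.mul a b) = A.mul (f a) (f b)) ∧
    f A.one = A.one ∧
    (∀ a, A.comul (f a) = TensorProduct.map f.toLinearMap f.toLinearMap (A.comul a)) ∧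
    (∀ a, A.counit (f a) = A.counit a) ∧ (∀ a, f (A.S a) = A.S (f a))}
  one_mem' := by simp
  mul_mem' := by
    rintro f g ⟨f1, f2, f3, f4, f5, f6⟩ ⟨g1, g2, g3, g4, g5, g6⟩
    refine ⟨by simp [f1, g1], by simp [f2, g2], by simp [f3, g3], fun a => ?_, by simp [f5, g5],
      by simp [f6, g6]⟩
    rw [LinearEquiv.mul_apply, f4, g4, ← LinearMap.comp_apply, ← TensorProduct.map_comp]
    rfl
  inv_mem' := by
    rintro f ⟨f1, f2, f3, f4, f5, f6⟩
    have hf : ∀ a, f (f⁻¹ a) = a := fun a => f.apply_symm_apply a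
    have hf2 : ∀ a, f⁻¹ (f a) = a := fun a => f.symm_apply_apply a
    refine ⟨fun a => f.injective ?_, fun a b => f.injective ?_, f.injective ?_, fun a => ?_,
      fun a => ?_, fun a => f.injective ?_⟩
    · rw [hf, f1, hf]
    · rw [hf, f2, hf, hf]
    · rw [hf, f3]
    · conv_rhs => rw [← hf a]
      rw [f4, ← LinearMap.comp_apply, ← TensorProduct.map_comp]
      have : (f⁻¹).toLinearMap ∘ₗ f.toLinearMap = LinearMap.id := LinearMap.ext hf2
      rw [this, TensorProduct.map_id, LinearMap.id_apply]
    · conv_rhs => rw [← hf a]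
      rw [f5]
    · rw [hf, f6, hf]

/-- An automorphism of `H` as a linear map. -/
def autLin {A : MonoidalHomHopf k H} (f : A.Aut) : H →ₗ[k] H := f.1.toLinearMap

/-- The group `G = Aut_{mHH}(H) × Aut_{mHH}(H)` with the multiplication
`(α, β) * (γ, δ) = (αγ, δγ⁻¹βγ)`. -/
@[ext]
structure G (A : MonoidalHomHopf k H) where
  fst : A.Aut
  snd : A.Aut

instance (A : MonoidalHomHopf k H) : Mul A.G :=
  ⟨fun p q => ⟨p.fst * q.fst, q.snd * q.fst⁻¹ * p.snd * q.fst⟩⟩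

instance (A : MonoidalHomHopf k H) : One A.G := ⟨⟨1, 1⟩⟩

instance (A : MonoidalHomHopf k H) : Inv A.G :=
  ⟨fun p => ⟨p.fst⁻¹, p.fst * p.snd⁻¹ * p.fst⁻¹⟩⟩

@[simp] theorem G.mul_fst {A : MonoidalHomHopf k H} (p q : A.G) : (p * q).fst = p.fst * q.fst := rfl

@[simp] theorem G.mul_snd {A : MonoidalHomHopf k H} (p q : A.G) :
    (p * q).snd = q.snd * q.fst⁻¹ * p.snd * q.fst := rfl

@[simp] theorem G.one_fst {A : MonoidalHomHopf k H} : (1 : A.G).fst = 1 := rfl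

@[simp] theorem G.one_snd {A : MonoidalHomHopf k H} : (1 : A.G).snd = 1 := rfl

@[simp] theorem G.inv_fst {A : MonoidalHomHopf k H} (p : A.G) : (p⁻¹).fst = p.fst⁻¹ := rfl

@[simp] theorem G.inv_snd {A : MonoidalHomHopf k H} (p : A.G) :
    (p⁻¹).snd = p.fst * p.snd⁻¹ * p.fst⁻¹ := rfl

instance (A : MonoidalHomHopf k H) : Group A.G :=
  Group.ofLeftAxioms
    (fun p q r => by ext1 <;> simp [_root_.mul_assoc])
    (fun p => by ext1 <;> simp)
    (fun p => by ext1 <;> simp [_root_.mul_assoc])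

/-! ### Yetter-Drinfeld Hom-modules -/

/-- The data underlying an `(α, β)`-Yetter-Drinfeld Hom-module, where `(α, β) = deg`: a vector space
with an automorphism `ξ`, an action `h · m = act h m` and a coaction `coact`; no axioms. -/
structure YDData (A : MonoidalHomHopf k H) where
  carrier : Type u
  [addCommGroup : AddCommGroup carrier]
  [module : Module k carrier]
  deg : A.G
  ξ : carrier ≃ₗ[k] carrier
  act : H →ₗ[k] carrier →ₗ[k] carrier
  coact : carrier →ₗ[k] carrier ⊗[k] H

attribute [instance] YDData.addCommGroup YDData.module

namespace YDData

variable {A : MonoidalHomHopf k H}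

/-- The element `ξ_H(h₂₁) · m₀ ⊗ (β(h₂₂) ξ_H⁻¹(m₁)) α(S⁻¹(h₁))` of `M ⊗ H`, for
`(α, β) = M.deg`. -/
def compatRHS (M : YDData A) (h : H) (m : M.carrier) : M.carrier ⊗[k] H :=
  TensorProduct.lift
    (LinearMap.mk₂ k
      (fun x y : H =>
        (A.mul.flip (autLin M.deg.fst (A.S.symm x))).lTensor M.carrier
          (TensorProduct.map₂ (M.act ∘ₗ A.ξ.toLinearMap)
            (A.mul.compl₂ A.ξ.symm.toLinearMap ∘ₗ autLin M.deg.snd) (A.comul y) (M.coact m)))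
      (fun x x₂ y => by simp)
      (fun c x y => by simp)
      (fun x y y₂ => by simp)
      (fun c x y => by simp))
    (A.comul h)

/-- `M` is a left-right `(α, β)`-Yetter-Drinfeld Hom-module over `H`, where `(α, β) = M.deg`. -/
structure IsYD (M : YDData A) : Prop where
  -- left Hom-module
  act_assoc : ∀ (a b : H) (m : M.carrier), M.act (A.ξ a) (M.act b m) = M.act (A.mul a b) (M.ξ m)
  ξ_act : ∀ (a : H) (m : M.carrier), M.ξ (M.act a m) = M.act (A.ξ a) (M.ξ m)
  one_act : ∀ m : M.carrier, M.act A.one m = M.ξ m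
  -- right Hom-comodule
  coact_coassoc : ∀ m : M.carrier,
    TensorProduct.map M.ξ.symm.toLinearMap A.comul (M.coact m) =
      TensorProduct.assoc k M.carrier H H
        (TensorProduct.map M.coact A.ξ.symm.toLinearMap (M.coact m))
  coact_ξ : ∀ m : M.carrier,
    M.coact (M.ξ m) = TensorProduct.map M.ξ.toLinearMap A.ξ.toLinearMap (M.coact m)
  coact_counit : ∀ m : M.carrier,
    TensorProduct.rid k M.carrier (A.counit.lTensor M.carrier (M.coact m)) = M.ξ.symm m
  -- compatibility
  compat : ∀ (h : H) (m : M.carrier), M.coact (M.act h m) = M.compatRHS h m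

/-- Morphisms: linear maps between objects of the same component that commute with the
automorphisms and are `H`-linear and `H`-colinear. -/
structure IsHom (M N : YDData A) (f : M.carrier →ₗ[k] N.carrier) : Prop where
  deg_eq : M.deg = N.deg
  map_ξ : ∀ m, f (M.ξ m) = N.ξ (f m)
  map_act : ∀ h m, f (M.act h m) = N.act h (f m)
  map_coact : ∀ m, N.coact (f m) = f.rTensor H (M.coact m)

theorem IsHom.id (M : YDData A) : IsHom M M LinearMap.id := ⟨rfl, by simp, by simp, by simp⟩

theorem IsHom.comp {M N P : YDData A} {f : M.carrier →ₗ[k] N.carrier}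
    {g : N.carrier →ₗ[k] P.carrier} (hg : IsHom N P g) (hf : IsHom M N f) :
    IsHom M P (g ∘ₗ f) :=
  ⟨hf.deg_eq.trans hg.deg_eq, by simp [hf.map_ξ, hg.map_ξ], by simp [hf.map_act, hg.map_act],
    by simp [hf.map_coact, hg.map_coact, LinearMap.rTensor_comp]⟩

theorem IsHom.symm {M N : YDData A} {e : M.carrier ≃ₗ[k] N.carrier}
    (he : IsHom M N e.toLinearMap) : IsHom N M e.symm.toLinearMap := by
  have h1 := he.map_ξ
  have h2 := he.map_act
  have h3 := he.map_coact
  simp only [LinearEquiv.coe_coe] at h1 h2 h3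
  refine ⟨he.deg_eq.symm, fun m => e.injective ?_, fun h m => e.injective ?_, fun m => ?_⟩
  · simp [h1]
  · simp [h2]
  · obtain ⟨n, rfl⟩ := e.surjective m
    have h4 : e.symm.toLinearMap ∘ₗ e.toLinearMap = LinearMap.id :=
      LinearMap.ext e.symm_apply_apply
    rw [h3, ← LinearMap.comp_apply (LinearMap.rTensor H _), ← LinearMap.rTensor_comp, h4]
    simp

/-- The unit object: `k` with `h · 1 = ε(h)` and `1 ↦ 1 ⊗ 1_H`, in the component of `1`. -/
@[reducible]
def unit (A : MonoidalHomHopf k H) : YDData A where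
  carrier := k
  deg := 1
  ξ := LinearEquiv.refl k k
  act := LinearMap.lsmul k k ∘ₗ A.counit
  coact := (TensorProduct.mk k k H).flip A.one

/-- For `M` of degree `(α, β)` and `N` of degree `(γ, δ)`, the action
`h · (m ⊗ n) = γ(h₁) · m ⊗ γ⁻¹βγ(h₂) · n`. -/
def tensorAct (M N : YDData A) : H →ₗ[k] M.carrier ⊗[k] N.carrier →ₗ[k] M.carrier ⊗[k] N.carrier :=
  TensorProduct.map₂ (M.act ∘ₗ autLin N.deg.fst)
    (N.act ∘ₗ autLin (N.deg.fst⁻¹ * M.deg.snd * N.deg.fst)) ∘ₗ A.comul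

/-- The coaction `m ⊗ n ↦ (m₀ ⊗ n₀) ⊗ n₁m₁`. -/
def tensorCoact (M N : YDData A) :
    M.carrier ⊗[k] N.carrier →ₗ[k] (M.carrier ⊗[k] N.carrier) ⊗[k] H :=
  (TensorProduct.lift A.mul.flip).lTensor (M.carrier ⊗[k] N.carrier) ∘ₗ
    (TensorProduct.tensorTensorTensorComm k M.carrier H N.carrier H).toLinearMap ∘ₗ
      TensorProduct.map M.coact N.coact

/-- The tensor product of `M` and `N`. -/
@[reducible]
def tensor (M N : YDData A) : YDData A where
  carrier := M.carrier ⊗[k] N.carrier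
  deg := M.deg * N.deg
  ξ := TensorProduct.congr M.ξ N.ξ
  act := M.tensorAct N
  coact := M.tensorCoact N

/-- The conjugate of `N` of degree `(γ, δ)` by `g = (α, β)`: the same space and automorphism, the
action of `h` is that of `γ⁻¹βγα⁻¹(h)`, and `n ↦ n₀ ⊗ αβ⁻¹(n₁)`. -/
@[reducible]
def conj (g : A.G) (N : YDData A) : YDData A where
  carrier := N.carrier
  deg := g * N.deg * g⁻¹
  ξ := N.ξ
  act := N.act ∘ₗ autLin (N.deg.fst⁻¹ * g.snd * N.deg.fst * g.fst⁻¹)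
  coact := (autLin (g.fst * g.snd⁻¹)).lTensor N.carrier ∘ₗ N.coact

/-- Associativity constraint `(m ⊗ n) ⊗ p ↦ ξ(m) ⊗ (n ⊗ ξ⁻¹(p))`. -/
def assoc (M N P : YDData A) :
    ((M.tensor N).tensor P).carrier ≃ₗ[k] (M.tensor (N.tensor P)).carrier :=
  (TensorProduct.congr (TensorProduct.congr M.ξ (LinearEquiv.refl k N.carrier)) P.ξ.symm).trans
    (TensorProduct.assoc k M.carrier N.carrier P.carrier)

/-- Left unit constraint `x ⊗ m ↦ x ξ(m)`. -/
def leftUnitor (M : YDData A) : ((unit A).tensor M).carrier ≃ₗ[k] M.carrier :=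
  (TensorProduct.lid k M.carrier).trans M.ξ

/-- Right unit constraint `m ⊗ x ↦ x ξ(m)`. -/
def rightUnitor (M : YDData A) : (M.tensor (unit A)).carrier ≃ₗ[k] M.carrier :=
  (TensorProduct.rid k M.carrier).trans M.ξ

/-- The linear map `m ⊗ n ↦ ξ_N(n₀) ⊗ β⁻¹(n₁) · ξ_M⁻¹(m)`, for `(α, β) = M.deg`. -/
def braidLin (M N : YDData A) :
    M.carrier ⊗[k] N.carrier →ₗ[k] N.carrier ⊗[k] M.carrier :=
  TensorProduct.lift
    (LinearMap.mk₂ k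
      (fun (m : M.carrier) (n : N.carrier) =>
        TensorProduct.map N.ξ.toLinearMap
          (M.act.flip (M.ξ.symm m) ∘ₗ autLin (M.deg.snd⁻¹)) (N.coact n))
      (fun m m₂ n => by simp [LinearMap.add_comp, TensorProduct.map_add_right])
      (fun c m n => by simp [LinearMap.smul_comp, TensorProduct.map_smul_right])
      (fun m n n₂ => by simp)
      (fun c m n => by simp))

/-- The braiding `M ⊗ N → ᴹN ⊗ M`, `m ⊗ n ↦ ξ_N(n₀) ⊗ β⁻¹(n₁) · ξ_M⁻¹(m)`. -/
def braid (M N : YDData A) :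
    (M.tensor N).carrier →ₗ[k] ((N.conj M.deg).tensor M).carrier :=
  braidLin M N

/-- For a linear map `T : H → H`, the coaction `p ↦ p₀ ⊗ p₁` on the dual of a finite-dimensional `M`
that is determined by `p₀(m) p₁ = p(ξ²(m₀)) T(m₁)` for all `m`. -/
def dualCoact (M : YDData A) [FiniteDimensional k M.carrier] (T : H →ₗ[k] H) :
    Module.Dual k M.carrier →ₗ[k] Module.Dual k M.carrier ⊗[k] H :=
  (dualTensorHomEquiv k M.carrier H).symm.toLinearMap ∘ₗ
    LinearMap.mk₂ k
      (fun (p : Module.Dual k M.carrier) (m : M.carrier) =>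
        TensorProduct.lid k H
          (TensorProduct.map (p ∘ₗ M.ξ.toLinearMap ∘ₗ M.ξ.toLinearMap) T (M.coact m)))
      (fun p p₂ m => by simp [LinearMap.add_comp, TensorProduct.map_add_left])
      (fun c p m => by simp [LinearMap.smul_comp, TensorProduct.map_smul_left])
      (fun p m m₂ => by simp)
      (fun c p m => by simp)

/-- For a linear map `T : H → H`, the action `(h · p)(m) = p(T(h) · ξ⁻²(m))` on the dual of `M`. -/
def dualAct (M : YDData A) (T : H →ₗ[k] H) :
    H →ₗ[k] Module.Dual k M.carrier →ₗ[k] Module.Dual k M.carrier :=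
  Module.Dual.transpose ∘ₗ
    M.act.compl₂ (M.ξ.symm.toLinearMap ∘ₗ M.ξ.symm.toLinearMap) ∘ₗ T

/-- The dual `M*`: the dual space with automorphism `p ↦ p ∘ ξ⁻¹`,
`(h · p)(m) = p(β⁻¹α⁻¹Sξ⁻¹(h) · ξ⁻²(m))` and `p₀(m) ⊗ p₁ = p(ξ²(m₀)) ⊗ S⁻¹ξ(m₁)`, in the component
of `(α, β)⁻¹ = (α⁻¹, αβ⁻¹α⁻¹)`. -/
@[reducible]
def leftDual (M : YDData A) [FiniteDimensional k M.carrier] : YDData A where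
  carrier := Module.Dual k M.carrier
  deg := M.deg⁻¹
  ξ := M.ξ.symm.dualMap
  act := M.dualAct
    (autLin (M.deg.snd⁻¹ * M.deg.fst⁻¹) ∘ₗ A.S.toLinearMap ∘ₗ A.ξ.symm.toLinearMap)
  coact := M.dualCoact (A.S.symm.toLinearMap ∘ₗ A.ξ.toLinearMap)

/-- The dual `*M`: as `M*`, but with `S` and `S⁻¹` exchanged. -/
@[reducible]
def rightDual (M : YDData A) [FiniteDimensional k M.carrier] : YDData A where
  carrier := Module.Dual k M.carrier
  deg := M.deg⁻¹
  ξ := M.ξ.symm.dualMap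
  act := M.dualAct
    (autLin (M.deg.snd⁻¹ * M.deg.fst⁻¹) ∘ₗ A.S.symm.toLinearMap ∘ₗ A.ξ.symm.toLinearMap)
  coact := M.dualCoact (A.S.toLinearMap ∘ₗ A.ξ.toLinearMap)

section Duality

variable (M : YDData A) [FiniteDimensional k M.carrier]

/-- `1 ↦ ∑ cᵢ ⊗ cⁱ`, from `k` to `M ⊗ M*`. -/
def leftCoev : (unit A).carrier →ₗ[k] (M.tensor M.leftDual).carrier :=
  coevaluation k M.carrier

/-- `p ⊗ m ↦ p(m)`, from `M* ⊗ M` to `k`. -/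
def leftEv : (M.leftDual.tensor M).carrier →ₗ[k] (unit A).carrier :=
  contractLeft k M.carrier

/-- `1 ↦ ∑ cⁱ ⊗ cᵢ`, from `k` to `*M ⊗ M`. -/
def rightCoev : (unit A).carrier →ₗ[k] (M.rightDual.tensor M).carrier :=
  (TensorProduct.comm k M.carrier (Module.Dual k M.carrier)).toLinearMap ∘ₗ
    coevaluation k M.carrier

/-- `m ⊗ p ↦ p(m)`, from `M ⊗ *M` to `k`. -/
def rightEv : (M.tensor M.rightDual).carrier →ₗ[k] (unit A).carrier :=
  contractRight k M.carrier

end Duality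

end YDData

/-- The category `MHYD(H)`: the disjoint union over `(α, β) ∈ G` of the categories of
`(α, β)`-Yetter-Drinfeld Hom-modules. -/
structure MHYD (A : MonoidalHomHopf k H) where
  toData : YDData A
  isYD : toData.IsYD

/-- Morphisms of Yetter-Drinfeld Hom-modules. -/
@[ext]
structure MHYD.Hom {A : MonoidalHomHopf k H} (M N : MHYD A) where
  lin : M.toData.carrier →ₗ[k] N.toData.carrier
  isHom : YDData.IsHom M.toData N.toData lin

instance (A : MonoidalHomHopf k H) : Category (MHYD A) where
  Hom := MHYD.Hom
  id M := ⟨LinearMap.id, YDData.IsHom.id _⟩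
  comp f g := ⟨g.lin ∘ₗ f.lin, g.isHom.comp f.isHom⟩

/-- The full subcategory `MHYD(H)_fd` of finite-dimensional objects. -/
structure MHYDfd (A : MonoidalHomHopf k H) where
  obj : MHYD A
  [finite : FiniteDimensional k obj.toData.carrier]

attribute [instance] MHYDfd.finite

instance (A : MonoidalHomHopf k H) : Category (MHYDfd A) where
  Hom M N := M.obj ⟶ N.obj
  id M := 𝟙 M.obj
  comp f g := f ≫ g

/-- The underlying data of an object of `MHYD(H)_fd`. -/
abbrev MHYDfd.dat {A : MonoidalHomHopf k H} (M : MHYDfd A) : YDData A := M.obj.toData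

/-- The assertion that the formulas above define objects and morphisms of `MHYD(H)_fd`. -/
structure WellDefined (A : MonoidalHomHopf k H) : Prop where
  unit_isYD : (YDData.unit A).IsYD
  tensor_isYD : ∀ M N : MHYDfd A, (M.dat.tensor N.dat).IsYD
  conj_isYD : ∀ (g : A.G) (M : MHYDfd A), (M.dat.conj g).IsYD
  leftDual_isYD : ∀ M : MHYDfd A, M.dat.leftDual.IsYD
  rightDual_isYD : ∀ M : MHYDfd A, M.dat.rightDual.IsYD
  map_isHom : ∀ {M M₂ N N₂ : MHYDfd A} (f : M ⟶ M₂) (g : N ⟶ N₂),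
    YDData.IsHom (M.dat.tensor N.dat) (M₂.dat.tensor N₂.dat) (TensorProduct.map f.lin g.lin)
  conj_isHom : ∀ (g : A.G) {M N : MHYDfd A} (f : M ⟶ N),
    YDData.IsHom (M.dat.conj g) (N.dat.conj g) f.lin
  assoc_isHom : ∀ M N P : MHYDfd A,
    YDData.IsHom ((M.dat.tensor N.dat).tensor P.dat) (M.dat.tensor (N.dat.tensor P.dat))
      (YDData.assoc M.dat N.dat P.dat).toLinearMap
  leftUnitor_isHom : ∀ M : MHYDfd A,
    YDData.IsHom ((YDData.unit A).tensor M.dat) M.dat (YDData.leftUnitor M.dat).toLinearMap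
  rightUnitor_isHom : ∀ M : MHYDfd A,
    YDData.IsHom (M.dat.tensor (YDData.unit A)) M.dat (YDData.rightUnitor M.dat).toLinearMap
  braid_isHom : ∀ M N : MHYDfd A,
    YDData.IsHom (M.dat.tensor N.dat) ((N.dat.conj M.dat.deg).tensor M.dat)
      (YDData.braid M.dat N.dat)
  leftCoev_isHom : ∀ M : MHYDfd A,
    YDData.IsHom (YDData.unit A) (M.dat.tensor M.dat.leftDual) M.dat.leftCoev
  leftEv_isHom : ∀ M : MHYDfd A,
    YDData.IsHom (M.dat.leftDual.tensor M.dat) (YDData.unit A) M.dat.leftEv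
  rightCoev_isHom : ∀ M : MHYDfd A,
    YDData.IsHom (YDData.unit A) (M.dat.rightDual.tensor M.dat) M.dat.rightCoev
  rightEv_isHom : ∀ M : MHYDfd A,
    YDData.IsHom (M.dat.tensor M.dat.rightDual) (YDData.unit A) M.dat.rightEv

namespace WellDefined

variable {A : MonoidalHomHopf k H} (W : WellDefined A)

/-- The unit object of `MHYD(H)_fd`. -/
@[reducible]
def unitObj : MHYDfd A :=
  haveI : FiniteDimensional k (YDData.unit A).carrier := inferInstanceAs (FiniteDimensional k k)
  ⟨⟨YDData.unit A, W.unit_isYD⟩⟩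

/-- The tensor product of `MHYD(H)_fd` on objects. -/
@[reducible]
def tensorObj (M N : MHYDfd A) : MHYDfd A :=
  haveI : FiniteDimensional k (M.dat.tensor N.dat).carrier :=
    inferInstanceAs (FiniteDimensional k (M.dat.carrier ⊗[k] N.dat.carrier))
  ⟨⟨M.dat.tensor N.dat, W.tensor_isYD M N⟩⟩

/-- The conjugate of an object of `MHYD(H)_fd`. -/
@[reducible]
def conjObj (g : A.G) (M : MHYDfd A) : MHYDfd A :=
  haveI : FiniteDimensional k (M.dat.conj g).carrier :=
    inferInstanceAs (FiniteDimensional k M.dat.carrier)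
  ⟨⟨M.dat.conj g, W.conj_isYD g M⟩⟩

/-- The object `M*`. -/
@[reducible]
def leftDual (M : MHYDfd A) : MHYDfd A :=
  haveI : FiniteDimensional k M.dat.leftDual.carrier :=
    inferInstanceAs (FiniteDimensional k (Module.Dual k M.dat.carrier))
  ⟨⟨M.dat.leftDual, W.leftDual_isYD M⟩⟩

/-- The object `*M`. -/
@[reducible]
def rightDual (M : MHYDfd A) : MHYDfd A :=
  haveI : FiniteDimensional k M.dat.rightDual.carrier :=
    inferInstanceAs (FiniteDimensional k (Module.Dual k M.dat.carrier))
  ⟨⟨M.dat.rightDual, W.rightDual_isYD M⟩⟩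

end WellDefined

/-- The isomorphism of `MHYD(H)_fd` given by a bijective morphism. -/
def MHYDfd.isoOfEquiv {A : MonoidalHomHopf k H} {M N : MHYDfd A}
    (e : M.dat.carrier ≃ₗ[k] N.dat.carrier) (he : YDData.IsHom M.dat N.dat e.toLinearMap) :
    M ≅ N where
  hom := ⟨e.toLinearMap, he⟩
  inv := ⟨e.symm.toLinearMap, he.symm⟩
  hom_inv_id := MHYD.Hom.ext (LinearMap.ext fun m => e.symm_apply_apply m)
  inv_hom_id := MHYD.Hom.ext (LinearMap.ext fun m => e.apply_symm_apply m)

namespace WellDefined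

variable {A : MonoidalHomHopf k H}

/-- Tensor product, unit object and constraints on `MHYD(H)_fd`. -/
@[reducible]
def monoidalStruct (W : WellDefined A) : MonoidalCategoryStruct (MHYDfd A) where
  tensorObj := W.tensorObj
  tensorHom f g := ⟨TensorProduct.map f.lin g.lin, W.map_isHom f g⟩
  whiskerLeft M _ _ g :=
    ⟨TensorProduct.map (MHYD.Hom.lin (𝟙 M : M ⟶ M)) g.lin, W.map_isHom (𝟙 M) g⟩
  whiskerRight f N :=
    ⟨TensorProduct.map f.lin (MHYD.Hom.lin (𝟙 N : N ⟶ N)), W.map_isHom f (𝟙 N)⟩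
  tensorUnit := W.unitObj
  associator M N P := MHYDfd.isoOfEquiv (YDData.assoc M.dat N.dat P.dat) (W.assoc_isHom M N P)
  leftUnitor M := MHYDfd.isoOfEquiv (YDData.leftUnitor M.dat) (W.leftUnitor_isHom M)
  rightUnitor M := MHYDfd.isoOfEquiv (YDData.rightUnitor M.dat) (W.rightUnitor_isHom M)

/-- The conjugation functors of `MHYD(H)_fd`; they are the identity on underlying linear maps. -/
def conjFunctor (W : WellDefined A) (g : A.G) : MHYDfd A ⥤ MHYDfd A where
  obj := W.conjObj g
  map f := ⟨f.lin, W.conj_isHom g f⟩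

/-- Degrees, conjugation and braiding on `MHYD(H)_fd`. -/
def tCategoryData (W : WellDefined A) (hW : IsMonoidalStruct W.monoidalStruct) :
    letI := monoidalOfStruct W.monoidalStruct hW
    TCategoryData A.G (MHYDfd A) :=
  letI := monoidalOfStruct W.monoidalStruct hW
  { deg := fun M => M.dat.deg
    conj := W.conjFunctor
    braid := fun M N => ⟨YDData.braid M.dat N.dat, W.braid_isHom M N⟩ }

/-- `k → M ⊗ M*` as a morphism. -/
def coevLeft (W : WellDefined A) (M : MHYDfd A) : W.unitObj ⟶ W.tensorObj M (W.leftDual M) :=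
  ⟨M.dat.leftCoev, W.leftCoev_isHom M⟩

/-- `M* ⊗ M → k` as a morphism. -/
def evLeft (W : WellDefined A) (M : MHYDfd A) : W.tensorObj (W.leftDual M) M ⟶ W.unitObj :=
  ⟨M.dat.leftEv, W.leftEv_isHom M⟩

/-- `k → *M ⊗ M` as a morphism. -/
def coevRight (W : WellDefined A) (M : MHYDfd A) : W.unitObj ⟶ W.tensorObj (W.rightDual M) M :=
  ⟨M.dat.rightCoev, W.rightCoev_isHom M⟩

/-- `M ⊗ *M → k` as a morphism. -/
def evRight (W : WellDefined A) (M : MHYDfd A) : W.tensorObj M (W.rightDual M) ⟶ W.unitObj :=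
  ⟨M.dat.rightEv, W.rightEv_isHom M⟩

end WellDefined

end MonoidalHomHopf

end

/-! A monoidal Hom-Hopf algebra is an ordinary Hopf algebra in disguise. The product `ξ⁻¹(ab)` and
the coproduct `Δ(ξ(c))`, with the same unit, counit and antipode, satisfy the usual axioms, and `A`
is recovered by twisting with `ξ` (`untwistedHopfAlgebra`, `isTwistOf_untwisted`). Likewise `h ↦
ξ_M⁻¹(h · -)` and `m ↦ ρ(ξ_M(m))` turn a Yetter-Drinfeld Hom-module into an ordinary Yetter-Drinfeld
module with a compatible automorphism, and back (`IsYD.untwist`, `IsUntwistedYD.isYD`).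

For finite-dimensional `M` the coaction is an element `T` of `End(M) ⊗ H`, so that all axioms become
identities in algebras. Being a comodule means `(id ⊗ Δ)T = T₁₂T₁₃`; equivalently, `f ↦ (id ⊗ f)T`
carries convolution products to products (`IsCorep.lTensor_conv`). The compatibility, freed of `S⁻¹`
by `compat_iff`, reads `T (π(h₂) ⊗ α(h₁)) = (π(h₁) ⊗ β(h₂)) T`, an identity in the convolution
algebra `Hom(H, End(M) ⊗ H)`. Algebra maps on the `End` leg and automorphisms on either side
preserve it, two such identities compose to that of a tensor product, and antimorphisms reverse it,
which gives the duals (`IsYDElt.map`, `IsYDElt.twist`, `IsYDElt.tensor`, `IsYDElt.dual`).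

The braiding is the flip followed by `R = (id ⊗ πβ⁻¹)T`. It is linear because of the compatibility
of `N`, colinear because of that of `M` (`IsYDElt.braid_act`, `IsYDElt.braid_coact`), and bijective
because `(id ⊗ πβ⁻¹S)T` inverts `R`. Evaluations and coevaluations are morphisms by the four
cancellation rules for `S` and `S⁻¹`.

The remaining points need no untwisting. The associator is linear by coassociativity and colinear by
associativity in `H`. The hexagons are coassociativity of the coaction on `W` and associativity of
the action on `U`. Conjugation leaves spaces, automorphisms and linear maps unchanged, so strictness
amounts to identities in `G`. The triangle identities hold because the coevaluation corresponds to
the identity in `End(M)`. -/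

namespace YetterDrinfeld

/-! ### Convolution of linear maps from a Hopf algebra to an algebra. -/

section Convolution

variable {k H B B' : Type*} [CommRing k] [Ring H] [HopfAlgebra k H] [Ring B] [Algebra k B]
  [Ring B'] [Algebra k B']

/-- The convolution product of linear maps from a Hopf algebra to an algebra. -/
noncomputable def conv (f g : H →ₗ[k] B) : H →ₗ[k] B :=
  LinearMap.mul' k B ∘ₗ TensorProduct.map f g ∘ₗ Coalgebra.comul

local infixl:70 " ⋆ " => conv

/-- The constant `b`, as the linear map `h ↦ ε(h) b`. -/
noncomputable def const (b : B) : H →ₗ[k] B := (Coalgebra.counit (R := k) (A := H)).smulRight b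

@[simp] theorem const_apply (b : B) (h : H) :
    const (k := k) b h = Coalgebra.counit (R := k) h • b := rfl

theorem conv_apply (f g : H →ₗ[k] B) (h : H) :
    (f ⋆ g) h = LinearMap.mul' k B (TensorProduct.map f g (Coalgebra.comul h)) := rfl

theorem conv_repr (f g : H →ₗ[k] B) {ι : Type*} (h : H) (r : Coalgebra.Repr k h ι) :
    (f ⋆ g) h = ∑ i ∈ r.index, f (r.left i) * g (r.right i) := by
  rw [conv_apply, ← r.eq]; simp

theorem conv_assoc (f g e : H →ₗ[k] B) : f ⋆ g ⋆ e = f ⋆ (g ⋆ e) :=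
  congrArg WithConv.ofConv (mul_assoc (WithConv.toConv f) (WithConv.toConv g) (WithConv.toConv e))

theorem const_one_conv (f : H →ₗ[k] B) : const 1 ⋆ f = f := by
  have := congrArg WithConv.ofConv (one_mul (WithConv.toConv f))
  refine Eq.trans (congrArg (fun z => z ⋆ f) ?_) this
  ext h
  simp [LinearMap.convOne_def, Algebra.algebraMap_eq_smul_one]

theorem conv_const_one (f : H →ₗ[k] B) : f ⋆ const 1 = f := by
  have := congrArg WithConv.ofConv (mul_one (WithConv.toConv f))
  refine Eq.trans (congrArg (fun z => f ⋆ z) ?_) this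
  ext h
  simp [LinearMap.convOne_def, Algebra.algebraMap_eq_smul_one]

theorem const_conv (b : B) (f : H →ₗ[k] B) : const b ⋆ f = LinearMap.mulLeft k b ∘ₗ f := by
  conv_rhs => rw [← const_one_conv f]
  ext h
  simp [conv_repr _ _ _ (Coalgebra.Repr.arbitrary k h)]

theorem conv_const (b : B) (f : H →ₗ[k] B) : f ⋆ const b = LinearMap.mulRight k b ∘ₗ f := by
  conv_rhs => rw [← conv_const_one f]
  ext h
  simp [conv_repr _ _ _ (Coalgebra.Repr.arbitrary k h)]

theorem const_conv_const (b c : B) : const b ⋆ const c = const (k := k) (H := H) (b * c) := by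
  rw [const_conv]; ext h; simp

theorem const_conv_comm {b : B} {f : H →ₗ[k] B} (hb : ∀ h, b * f h = f h * b) :
    const b ⋆ f = f ⋆ const b := by
  rw [const_conv, conv_const]; ext h; simp [hb]

theorem algHom_comp_conv (j : B →ₐ[k] B') (f g : H →ₗ[k] B) :
    j.toLinearMap ∘ₗ (f ⋆ g) = (j.toLinearMap ∘ₗ f) ⋆ (j.toLinearMap ∘ₗ g) := by
  ext h
  simp [conv_repr _ _ _ (Coalgebra.Repr.arbitrary k h)]

theorem algHom_comp_const (j : B →ₐ[k] B') (b : B) :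
    j.toLinearMap ∘ₗ const b = const (k := k) (H := H) (j b) := by
  ext h; simp

/-- A linear endomorphism of `H` is a morphism of bialgebras. -/
structure IsBialgEnd (φ : H →ₗ[k] H) : Prop where
  map_one : φ 1 = 1
  map_mul : ∀ a b, φ (a * b) = φ a * φ b
  counit_comp : Coalgebra.counit ∘ₗ φ = Coalgebra.counit (R := k)
  comul_comp : Coalgebra.comul ∘ₗ φ = TensorProduct.map φ φ ∘ₗ Coalgebra.comul

/-- A bialgebra endomorphism as a morphism of algebras. -/
def IsBialgEnd.algHom {φ : H →ₗ[k] H} (hφ : IsBialgEnd φ) : H →ₐ[k] H :=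
  AlgHom.ofLinearMap φ hφ.map_one hφ.map_mul

theorem conv_comp {φ : H →ₗ[k] H} (hφ : IsBialgEnd φ) (f g : H →ₗ[k] B) :
    (f ⋆ g) ∘ₗ φ = (f ∘ₗ φ) ⋆ (g ∘ₗ φ) := by
  rw [conv, conv, TensorProduct.map_comp, LinearMap.comp_assoc, LinearMap.comp_assoc,
    hφ.comul_comp, LinearMap.comp_assoc]

theorem const_comp {φ : H →ₗ[k] H} (hφ : IsBialgEnd φ) (b : B) :
    const (k := k) b ∘ₗ φ = const b := by
  ext h
  simpa using congrArg (fun z => z • b) (LinearMap.congr_fun hφ.counit_comp h)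

/-- An algebra map transports the antipode axiom of `H` to its target; this and its mirror image are
the source of all inverses below that involve `S`. -/
theorem conv_antipode {f : H →ₐ[k] B} :
    f.toLinearMap ⋆ (f.toLinearMap ∘ₗ HopfAlgebra.antipode k) = const 1 := by
  ext h
  simp only [conv_repr _ _ _ (Coalgebra.Repr.arbitrary k h), AlgHom.toLinearMap_apply,
    LinearMap.comp_apply, ← map_mul, ← map_sum,
    HopfAlgebra.sum_mul_antipode_eq_algebraMap_counit]
  simp [Algebra.algebraMap_eq_smul_one]

theorem antipode_conv {f : H →ₐ[k] B} :
    (f.toLinearMap ∘ₗ HopfAlgebra.antipode k) ⋆ f.toLinearMap = const 1 := by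
  ext h
  simp only [conv_repr _ _ _ (Coalgebra.Repr.arbitrary k h), AlgHom.toLinearMap_apply,
    LinearMap.comp_apply, ← map_mul, ← map_sum,
    HopfAlgebra.sum_antipode_mul_eq_algebraMap_counit]
  simp [Algebra.algebraMap_eq_smul_one]

end Convolution

/-! ### Corepresentations as elements of `E ⊗ H`. -/

section Legs

variable {k H E B : Type*} [CommRing k] [Ring H] [HopfAlgebra k H] [Ring E] [Algebra k E]
  [Ring B] [Algebra k B]

local infixl:70 " ⋆ " => conv

/-- The inclusion of the first tensor factor. -/
abbrev inl (k E B : Type*) [CommRing k] [Ring E] [Algebra k E] [Ring B] [Algebra k B] :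
    E →ₐ[k] E ⊗[k] B := Algebra.TensorProduct.includeLeft

/-- The inclusion of the second tensor factor. -/
abbrev inr (k E B : Type*) [CommRing k] [Ring E] [Algebra k E] [Ring B] [Algebra k B] :
    B →ₐ[k] E ⊗[k] B := Algebra.TensorProduct.includeRight

theorem map_comp_comul (f : H →ₗ[k] E) (g : H →ₗ[k] B) :
    TensorProduct.map f g ∘ₗ Coalgebra.comul =
      ((inl k E B).toLinearMap ∘ₗ f) ⋆ ((inr k E B).toLinearMap ∘ₗ g) := by
  rw [conv, ← LinearMap.comp_assoc]
  congr 1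
  ext a b
  simp

theorem comul_eq_conv :
    Coalgebra.comul (R := k) (A := H) = (inl k H H).toLinearMap ⋆ (inr k H H).toLinearMap := by
  simpa using map_comp_comul (LinearMap.id : H →ₗ[k] H) (LinearMap.id : H →ₗ[k] H)

/-- In the convolution algebra `Hom(H, H ⊗ H)`, the map `h ↦ S(h₂) ⊗ S(h₁)` is a left inverse of `Δ`
and `Δ ∘ S` is a right inverse, hence they coincide. -/
theorem comul_antipode (h : H) :
    Coalgebra.comul (R := k) (HopfAlgebra.antipode k h) =
      TensorProduct.comm k H H (TensorProduct.map (HopfAlgebra.antipode k)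
        (HopfAlgebra.antipode k) (Coalgebra.comul h)) := by
  set S := HopfAlgebra.antipode k (A := H)
  set i := inl k H H
  set j := inr k H H
  have h1 : (j.toLinearMap ∘ₗ S) ⋆ (i.toLinearMap ∘ₗ S) ⋆ Coalgebra.comul = const 1 := by
    rw [comul_eq_conv, ← conv_assoc, conv_assoc (j.toLinearMap ∘ₗ S), antipode_conv,
      conv_const_one, antipode_conv]
  have h2 : Coalgebra.comul (R := k) (A := H) ⋆ (Coalgebra.comul ∘ₗ S) = const 1 :=
    conv_antipode (f := Bialgebra.comulAlgHom k H)
  have h3 : Coalgebra.comul ∘ₗ S = (j.toLinearMap ∘ₗ S) ⋆ (i.toLinearMap ∘ₗ S) := by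
    rw [← const_one_conv (Coalgebra.comul ∘ₗ S), ← h1, conv_assoc, h2, conv_const_one]
  have h4 := LinearMap.congr_fun h3 h
  rw [LinearMap.comp_apply] at h4
  rw [h4, conv_apply]
  generalize Coalgebra.comul (R := k) h = t
  induction t with
  | zero => simp
  | add x y hx hy => simp only [map_add, hx, hy]
  | tmul x y => simp [i, j]

/-- An element `T = ∑ T⁰ ⊗ T¹` of `E ⊗ H` is a *corepresentation* of `H` in the algebra `E`. -/
structure IsCorep (T : E ⊗[k] H) : Prop where
  comul : (Coalgebra.comul (R := k)).lTensor E T =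
    (inl k H H).toLinearMap.lTensor E T * (inr k H H).toLinearMap.lTensor E T
  counit : (const (k := k) (1 : H)).lTensor E T = 1

theorem lTensor_mul' (f g : H →ₗ[k] B) (T T' : E ⊗[k] H) :
    (LinearMap.mul' k B ∘ₗ TensorProduct.map f g).lTensor E
      ((inl k H H).toLinearMap.lTensor E T * (inr k H H).toLinearMap.lTensor E T') =
      f.lTensor E T * g.lTensor E T' := by
  induction T with
  | zero => simp
  | add x y hx hy => simp only [map_add, add_mul, hx, hy]
  | tmul x y =>
    induction T' with
    | zero => simp
    | add x y hx hy => simp only [map_add, mul_add, hx, hy]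
    | tmul x y => simp

/-- Apply `f` and `g` to the two `H`-legs of `T₁₂T₁₃ = (id ⊗ Δ)T` and multiply. This turns
identities between convolution products into identities in `E ⊗ B`. -/
theorem IsCorep.lTensor_conv {T : E ⊗[k] H} (hT : IsCorep T) (f g : H →ₗ[k] B) :
    (f ⋆ g).lTensor E T = f.lTensor E T * g.lTensor E T := by
  rw [conv, ← LinearMap.comp_assoc, LinearMap.lTensor_comp, LinearMap.comp_apply, hT.comul,
    lTensor_mul']

theorem IsCorep.lTensor_const_one {T : E ⊗[k] H} (hT : IsCorep T) :
    (const (k := k) (1 : B)).lTensor E T = 1 := by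
  have := congrArg ((Algebra.linearMap k B ∘ₗ Coalgebra.counit).lTensor E) hT.counit
  rw [← LinearMap.comp_apply, ← LinearMap.lTensor_comp] at this
  convert this using 3
  · ext h; simp [Algebra.algebraMap_eq_smul_one]
  · simp [Algebra.TensorProduct.one_def]

end Legs

end YetterDrinfeld

namespace YetterDrinfeld

/-! ### Yetter-Drinfeld structures in an algebra: change of algebra, twisting, tensor products. -/

section Elements

variable {k H E E' B : Type*} [CommRing k] [Ring H] [HopfAlgebra k H] [Ring E] [Algebra k E]
  [Ring E'] [Algebra k E'] [Ring B] [Algebra k B]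

local infixl:70 " ⋆ " => conv

/-- An `(α, β)`-Yetter-Drinfeld structure in an algebra `E`: a representation `π` and a
corepresentation `T` of `H` in `E` with `T (π(h₂) ⊗ α(h₁)) = (π(h₁) ⊗ β(h₂)) T`. -/
structure IsYDElt (α β : H →ₗ[k] H) (π : H →ₗ[k] E) (T : E ⊗[k] H) : Prop where
  map_one : π 1 = 1
  map_mul : ∀ a b, π (a * b) = π a * π b
  corep : IsCorep T
  compat : const T ⋆ (((inr k E H).toLinearMap ∘ₗ α) ⋆ ((inl k E H).toLinearMap ∘ₗ π)) =
    ((inl k E H).toLinearMap ∘ₗ π) ⋆ ((inr k E H).toLinearMap ∘ₗ β) ⋆ const T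

/-- The representation as a morphism of algebras. -/
def IsYDElt.algHom {α β : H →ₗ[k] H} {π : H →ₗ[k] E} {T : E ⊗[k] H} (h : IsYDElt α β π T) :
    H →ₐ[k] E := AlgHom.ofLinearMap π h.map_one h.map_mul

theorem rTensor_mul_algHom (j : E →ₐ[k] E') (T T' : E ⊗[k] B) :
    j.toLinearMap.rTensor B (T * T') = j.toLinearMap.rTensor B T * j.toLinearMap.rTensor B T' :=
  map_mul (Algebra.TensorProduct.map j (AlgHom.id k B)) T T'

theorem rTensor_one_algHom (j : E →ₐ[k] E') : j.toLinearMap.rTensor B 1 = 1 :=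
  map_one (Algebra.TensorProduct.map j (AlgHom.id k B))

theorem lTensor_mul_algHom (j : B →ₐ[k] E') (T T' : E ⊗[k] B) :
    j.toLinearMap.lTensor E (T * T') = j.toLinearMap.lTensor E T * j.toLinearMap.lTensor E T' :=
  map_mul (Algebra.TensorProduct.map (AlgHom.id k E) j) T T'

theorem lTensor_rTensor {V W X Y : Type*} [AddCommGroup V] [Module k V] [AddCommGroup W]
    [Module k W] [AddCommGroup X] [Module k X] [AddCommGroup Y] [Module k Y] (f : V →ₗ[k] W)
    (g : X →ₗ[k] Y) (t : V ⊗[k] X) :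
    g.lTensor W (f.rTensor X t) = f.rTensor Y (g.lTensor V t) := by
  rw [← LinearMap.comp_apply, ← LinearMap.comp_apply, LinearMap.lTensor_comp_rTensor,
    LinearMap.rTensor_comp_lTensor]

theorem lTensor_lTensor {V X Y Z : Type*} [AddCommGroup V] [Module k V]
    [AddCommGroup X] [Module k X] [AddCommGroup Y] [Module k Y] [AddCommGroup Z] [Module k Z]
    (f : X →ₗ[k] Y) (g : Y →ₗ[k] Z) (t : V ⊗[k] X) :
    g.lTensor V (f.lTensor V t) = (g ∘ₗ f).lTensor V t := by
  rw [LinearMap.lTensor_comp, LinearMap.comp_apply]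

theorem IsCorep.map {T : E ⊗[k] H} (hT : IsCorep T) (j : E →ₐ[k] E') :
    IsCorep (j.toLinearMap.rTensor H T) := by
  constructor
  · rw [lTensor_rTensor, hT.comul, rTensor_mul_algHom, lTensor_rTensor, lTensor_rTensor]
  · rw [lTensor_rTensor, hT.counit, rTensor_one_algHom]

theorem IsCorep.twist {T : E ⊗[k] H} (hT : IsCorep T) {φ : H →ₗ[k] H} (hφ : IsBialgEnd φ) :
    IsCorep (φ.lTensor E T) := by
  constructor
  · rw [lTensor_lTensor, hφ.comul_comp, map_comp_comul, hT.lTensor_conv, lTensor_lTensor,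
      lTensor_lTensor]
  · rw [lTensor_lTensor, const_comp hφ, hT.counit]

theorem IsYDElt.map {α β : H →ₗ[k] H} {π : H →ₗ[k] E} {T : E ⊗[k] H} (h : IsYDElt α β π T)
    (j : E →ₐ[k] E') : IsYDElt α β (j.toLinearMap ∘ₗ π) (j.toLinearMap.rTensor H T) where
  map_one := by simp [h.map_one]
  map_mul := by simp [h.map_mul]
  corep := h.corep.map j
  compat := by
    have h1 := congrArg
      (fun f => (Algebra.TensorProduct.map j (AlgHom.id k H)).toLinearMap ∘ₗ f) h.compat
    simp only [algHom_comp_conv, algHom_comp_const] at h1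
    have e1 : (Algebra.TensorProduct.map j (AlgHom.id k H)).toLinearMap ∘ₗ
        (inl k E H).toLinearMap ∘ₗ π = (inl k E' H).toLinearMap ∘ₗ j.toLinearMap ∘ₗ π := by
      ext; simp
    have e2 : ∀ φ : H →ₗ[k] H, (Algebra.TensorProduct.map j (AlgHom.id k H)).toLinearMap ∘ₗ
        (inr k E H).toLinearMap ∘ₗ φ = (inr k E' H).toLinearMap ∘ₗ φ := by
      intro φ; ext; simp
    rw [e1, e2, e2] at h1
    exact h1

/-- Composing the compatibility with `id ⊗ φ` after it and `ψ` before it replaces `α`, `β` by `φαψ`,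
`φβψ`. This serves twice: for conjugation, and for removing the stray `ξ` that the Hom tensor
product leaves behind. -/
theorem IsYDElt.twist {α β α' β' φ ψ : H →ₗ[k] H} {π : H →ₗ[k] E} {T : E ⊗[k] H}
    (h : IsYDElt α β π T) (hφ : IsBialgEnd φ) (hψ : IsBialgEnd ψ) (hα : φ ∘ₗ α ∘ₗ ψ = α')
    (hβ : φ ∘ₗ β ∘ₗ ψ = β') : IsYDElt α' β' (π ∘ₗ ψ) (φ.lTensor E T) where
  map_one := by simp [h.map_one, hψ.map_one]
  map_mul := by simp [h.map_mul, hψ.map_mul]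
  corep := h.corep.twist hφ
  compat := by
    have h1 := congrArg
      (fun f => (Algebra.TensorProduct.map (AlgHom.id k E) hφ.algHom).toLinearMap ∘ₗ f ∘ₗ ψ)
      h.compat
    simp only [algHom_comp_conv, algHom_comp_const, conv_comp hψ, const_comp hψ] at h1
    have e1 : (Algebra.TensorProduct.map (AlgHom.id k E) hφ.algHom).toLinearMap ∘ₗ
        ((inl k E H).toLinearMap ∘ₗ π) ∘ₗ ψ = (inl k E H).toLinearMap ∘ₗ π ∘ₗ ψ := by
      ext; simp [IsBialgEnd.algHom, hφ.map_one]
    have e2 : ∀ x : H →ₗ[k] H,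
        (Algebra.TensorProduct.map (AlgHom.id k E) hφ.algHom).toLinearMap ∘ₗ
        ((inr k E H).toLinearMap ∘ₗ x) ∘ₗ ψ = (inr k E H).toLinearMap ∘ₗ φ ∘ₗ x ∘ₗ ψ := by
      intro x; ext; simp [IsBialgEnd.algHom]
    rw [e1, e2, e2, hα, hβ] at h1
    exact h1

theorem commute_legs {V W : Type*} [Ring V] [Algebra k V] [Ring W] [Algebra k W]
    (T : E ⊗[k] V) (T' : E' ⊗[k] W) :
    Commute
      ((inl k V W).toLinearMap.lTensor (E ⊗[k] E') ((inl k E E').toLinearMap.rTensor V T))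
      ((inr k V W).toLinearMap.lTensor (E ⊗[k] E') ((inr k E E').toLinearMap.rTensor W T')) := by
  induction T with
  | zero => simp
  | add x y hx hy => simpa only [map_add] using hx.add_left hy
  | tmul x y =>
    induction T' with
    | zero => simp
    | add x y hx hy => simpa only [map_add] using hx.add_right hy
    | tmul x y => simp [commute_iff_eq]

theorem commute_rTensor_inl (T : E ⊗[k] H) (x : E') :
    (inl k E E').toLinearMap.rTensor H T * inl k (E ⊗[k] E') H (inr k E E' x) =
      inl k (E ⊗[k] E') H (inr k E E' x) * (inl k E E').toLinearMap.rTensor H T := by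
  induction T with
  | zero => simp
  | add x y hx hy => simp only [map_add, add_mul, mul_add, hx, hy]
  | tmul x y => simp

theorem commute_rTensor_inr (T : E' ⊗[k] H) (x : E) :
    (inr k E E').toLinearMap.rTensor H T * inl k (E ⊗[k] E') H (inl k E E' x) =
      inl k (E ⊗[k] E') H (inl k E E' x) * (inr k E E').toLinearMap.rTensor H T := by
  induction T with
  | zero => simp
  | add x y hx hy => simp only [map_add, add_mul, mul_add, hx, hy]
  | tmul x y => simp

/-- Since `Δ` is multiplicative, `T'T` is comultiplied factorwise; the two middle factors of the
result then live in different `E`-legs and different `H`-legs, so they can be exchanged. The order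
`T'T` is that of `n₁m₁` in the coaction. -/
theorem IsCorep.tensor {T : E ⊗[k] H} {T' : E' ⊗[k] H} (hT : IsCorep T) (hT' : IsCorep T') :
    IsCorep ((inr k E E').toLinearMap.rTensor H T' * (inl k E E').toLinearMap.rTensor H T) := by
  have h1 := hT.map (inl k E E')
  have h2 := hT'.map (inr k E E')
  constructor
  · have h3 := lTensor_mul_algHom (Bialgebra.comulAlgHom k H)
      ((inr k E E').toLinearMap.rTensor H T') ((inl k E E').toLinearMap.rTensor H T)
    rw [Bialgebra.toLinearMap_comulAlgHom] at h3
    rw [h3, h1.comul, h2.comul, lTensor_mul_algHom, lTensor_mul_algHom, mul_assoc, mul_assoc]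
    congr 1
    rw [← mul_assoc, ← mul_assoc, (commute_legs T T').eq]
  · have h3 := lTensor_mul_algHom ((Algebra.ofId k H).comp (Bialgebra.counitAlgHom k H))
      ((inr k E E').toLinearMap.rTensor H T') ((inl k E E').toLinearMap.rTensor H T)
    have h4 : ((Algebra.ofId k H).comp (Bialgebra.counitAlgHom k H)).toLinearMap =
        const (k := k) (1 : H) := by
      ext; simp [Algebra.ofId_apply, Algebra.algebraMap_eq_smul_one]
    rw [h4] at h3
    rw [h3, h1.counit, h2.counit, mul_one]

/-- Move `T` through the first representation, then `T'` through the second. The first move leaves a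
factor `β ∘ γ`, and `γ ∘ β' = β ∘ γ` makes it the factor that the second move consumes. Each of `T`,
`T'` commutes with the other's representation. -/
theorem IsYDElt.tensor {α β γ δ β' : H →ₗ[k] H} {π : H →ₗ[k] E} {T : E ⊗[k] H}
    {π' : H →ₗ[k] E'} {T' : E' ⊗[k] H} (h : IsYDElt α β π T) (h' : IsYDElt γ δ π' T')
    (hγ : IsBialgEnd γ) (hβ' : IsBialgEnd β') (hβ : γ ∘ₗ β' = β ∘ₗ γ) :
    IsYDElt (α ∘ₗ γ) (δ ∘ₗ β')
      (TensorProduct.map (π ∘ₗ γ) (π' ∘ₗ β') ∘ₗ Coalgebra.comul)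
      ((inr k E E').toLinearMap.rTensor H T' * (inl k E E').toLinearMap.rTensor H T) where
  map_one := _root_.map_one ((Algebra.TensorProduct.map (h.algHom.comp hγ.algHom)
    (h'.algHom.comp hβ'.algHom)).comp (Bialgebra.comulAlgHom k H))
  map_mul := _root_.map_mul ((Algebra.TensorProduct.map (h.algHom.comp hγ.algHom)
    (h'.algHom.comp hβ'.algHom)).comp (Bialgebra.comulAlgHom k H))
  corep := h.corep.tensor h'.corep
  compat := by
    have h1 := congrArg (fun f => f ∘ₗ γ) (h.map (inl k E E')).compat
    have h2 := congrArg (fun f => f ∘ₗ β') (h'.map (inr k E E')).compat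
    simp only [conv_comp hγ, const_comp hγ, LinearMap.comp_assoc] at h1
    simp only [conv_comp hβ', const_comp hβ', LinearMap.comp_assoc, hβ] at h2
    rw [map_comp_comul, algHom_comp_conv, ← const_conv_const]
    -- With `p`, `q` the two representations, the computation is `T'T(αγ)pq = T'p(βγ)Tq = pT'(γβ')qT
    -- = pq(δβ')T'T`, all products being convolutions.
    set p := (inl k (E ⊗[k] E') H).toLinearMap ∘ₗ (inl k E E').toLinearMap ∘ₗ π ∘ₗ γ with hp
    set q := (inl k (E ⊗[k] E') H).toLinearMap ∘ₗ (inr k E E').toLinearMap ∘ₗ π' ∘ₗ β' with hq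
    have c1 : const ((inl k E E').toLinearMap.rTensor H T) ⋆ q =
        q ⋆ const ((inl k E E').toLinearMap.rTensor H T) :=
      const_conv_comm fun x => commute_rTensor_inl T _
    have c2 : const ((inr k E E').toLinearMap.rTensor H T') ⋆ p =
        p ⋆ const ((inr k E E').toLinearMap.rTensor H T') :=
      const_conv_comm fun x => commute_rTensor_inr T' _
    rw [conv_assoc, ← conv_assoc _ p q, ← conv_assoc _ (_ ⋆ p) q, h1, conv_assoc _ _ q, c1,
      ← conv_assoc _ q, ← conv_assoc, conv_assoc p _ q, ← conv_assoc _ p, c2, conv_assoc p, h2]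
    simp only [conv_assoc]

end Elements

/-! ### Antimorphisms and dual Yetter-Drinfeld structures. -/

section Dual

variable {k H E E' B B' : Type*} [CommRing k] [Ring H] [HopfAlgebra k H] [Ring E] [Algebra k E]
  [Ring E'] [Algebra k E'] [Ring B] [Algebra k B] [Ring B'] [Algebra k B']

local infixl:70 " ⋆ " => conv

/-- A linear map between algebras is an antimorphism of algebras. -/
structure IsAntiHom (f : B →ₗ[k] B') : Prop where
  map_one : f 1 = 1
  map_mul : ∀ a b, f (a * b) = f b * f a

/-- A linear endomorphism of `H` is an antimorphism of algebras and of coalgebras. -/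
structure IsAntiBialgEnd (σ : H →ₗ[k] H) : Prop extends IsAntiHom σ where
  counit_comp : Coalgebra.counit ∘ₗ σ = Coalgebra.counit (R := k)
  comul_comp : Coalgebra.comul ∘ₗ σ =
    TensorProduct.map σ σ ∘ₗ (TensorProduct.comm k H H).toLinearMap ∘ₗ Coalgebra.comul

theorem IsAntiHom.map {f : E →ₗ[k] E'} {g : B →ₗ[k] B'} (hf : IsAntiHom f) (hg : IsAntiHom g) :
    IsAntiHom (TensorProduct.map f g) where
  map_one := by simp [Algebra.TensorProduct.one_def, hf.map_one, hg.map_one]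
  map_mul x y := by
    induction x with
    | zero => simp
    | add x x' hx hx' => simp only [map_add, add_mul, mul_add, hx, hx']
    | tmul a b =>
      induction y with
      | zero => simp
      | add x x' hx hx' => simp only [map_add, add_mul, mul_add, hx, hx']
      | tmul c d => simp [hf.map_mul, hg.map_mul]

theorem IsAntiHom.comp_algHom {f : B →ₗ[k] B'} (hf : IsAntiHom f) (j : E →ₐ[k] B) :
    IsAntiHom (f ∘ₗ j.toLinearMap) where
  map_one := by simp [hf.map_one]
  map_mul := by simp [hf.map_mul]

theorem antipode_isAntiBialgEnd : IsAntiBialgEnd (HopfAlgebra.antipode k (A := H)) where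
  map_one := HopfAlgebra.antipode_one
  map_mul := HopfAlgebra.antipode_mul_antidistrib
  counit_comp := HopfAlgebra.counit_comp_antipode
  comul_comp := by
    ext h
    simp [comul_antipode, TensorProduct.map_comm]

theorem IsAntiBialgEnd.symm {σ : H ≃ₗ[k] H} (hσ : IsAntiBialgEnd σ.toLinearMap) :
    IsAntiBialgEnd σ.symm.toLinearMap where
  map_one := σ.injective (by simpa using hσ.map_one.symm)
  map_mul a b := σ.injective (by
    have := hσ.map_mul (σ.symm b) (σ.symm a)
    simp only [LinearEquiv.coe_coe, LinearEquiv.apply_symm_apply] at this ⊢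
    exact this.symm)
  counit_comp := by
    conv_lhs => rw [← hσ.counit_comp]
    ext; simp
  comul_comp := by
    ext h
    obtain ⟨h, rfl⟩ := σ.surjective h
    have h1 := LinearMap.congr_fun hσ.comul_comp h
    simp only [LinearMap.comp_apply, LinearEquiv.coe_coe, LinearEquiv.symm_apply_apply] at h1 ⊢
    rw [h1]
    generalize Coalgebra.comul (R := k) h = t
    induction t with
    | zero => simp
    | add x y hx hy => simp only [map_add, ← hx, ← hy]
    | tmul x y => simp

/-- Here `f` reverses the product of the values and `σ` reverses the coproduct of the argument, so
what remains is again a convolution, with its factors exchanged. -/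
theorem antiHom_comp_conv {f : B →ₗ[k] B'} (hf : IsAntiHom f) {σ : H →ₗ[k] H}
    (hσ : IsAntiBialgEnd σ) (x y : H →ₗ[k] B) :
    f ∘ₗ (x ⋆ y) ∘ₗ σ = (f ∘ₗ y ∘ₗ σ) ⋆ (f ∘ₗ x ∘ₗ σ) := by
  ext h
  have h1 := LinearMap.congr_fun hσ.comul_comp h
  simp only [LinearMap.comp_apply, LinearEquiv.coe_coe, conv_apply] at h1 ⊢
  rw [h1]
  generalize Coalgebra.comul (R := k) h = t
  induction t with
  | zero => simp
  | add x y hx hy => simp only [map_add, hx, hy]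
  | tmul x y => simp [hf.map_mul]

theorem antiHom_comp_const (f : B →ₗ[k] B') {σ : H →ₗ[k] H}
    (hσ : IsAntiBialgEnd σ) (b : B) :
    f ∘ₗ const (k := k) b ∘ₗ σ = const (f b) := by
  ext h
  simpa using congrArg (fun z => z • f b) (LinearMap.congr_fun hσ.counit_comp h)

/-- The antimorphism on `E ⊗ H ⊗ H` reverses `T₁₂T₁₃` to `T₁₃T₁₂`, and the flip of the `H`-legs
caused by `Δ ∘ σ` restores the order. -/
theorem IsCorep.dual {T : E ⊗[k] H} (hT : IsCorep T) {θ : E →ₗ[k] E'} (hθ : IsAntiHom θ)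
    {σ : H →ₗ[k] H} (hσ : IsAntiBialgEnd σ) : IsCorep (TensorProduct.map θ σ T) := by
  constructor
  · have h1 : IsAntiHom (TensorProduct.map θ (TensorProduct.map σ σ ∘ₗ
        (Algebra.TensorProduct.comm k H H).toAlgHom.toLinearMap)) :=
      hθ.map ((hσ.toIsAntiHom.map hσ.toIsAntiHom).comp_algHom _)
    have h2 : (Coalgebra.comul (R := k)).lTensor E' (TensorProduct.map θ σ T) =
        TensorProduct.map θ (TensorProduct.map σ σ ∘ₗ
          (Algebra.TensorProduct.comm k H H).toAlgHom.toLinearMap)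
          ((Coalgebra.comul (R := k)).lTensor E T) := by
      rw [← LinearMap.comp_apply, ← LinearMap.comp_apply, LinearMap.lTensor_comp_map,
        LinearMap.map_comp_lTensor, hσ.comul_comp]
      rfl
    rw [h2, hT.comul, h1.map_mul]
    congr 1
    · generalize T = T
      induction T with
      | zero => simp
      | add x y hx hy => simp only [map_add, hx, hy]
      | tmul x y => simp [hσ.map_one]
    · generalize T = T
      induction T with
      | zero => simp
      | add x y hx hy => simp only [map_add, hx, hy]
      | tmul x y => simp [hσ.map_one]
  · have h1 : IsAntiHom (TensorProduct.map θ (AlgHom.id k k).toLinearMap) :=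
      hθ.map ⟨rfl, fun a b => mul_comm _ _⟩
    have h2 : (const (k := k) (1 : H)).lTensor E' (TensorProduct.map θ σ T) =
        TensorProduct.map θ σ ((const (k := k) (1 : H)).lTensor E T) := by
      rw [← LinearMap.comp_apply, ← LinearMap.comp_apply, LinearMap.lTensor_comp_map,
        LinearMap.map_comp_lTensor]
      congr 2
      ext h
      have h1 := LinearMap.congr_fun hσ.counit_comp h
      simp only [LinearMap.comp_apply] at h1
      simp [hσ.map_one, h1]
    rw [h2, hT.counit, (hθ.map hσ.toIsAntiHom).map_one]

/-- Sandwiching the compatibility between `θ ⊗ σ'` and `κ ∘ σ` reverses every product, so its two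
sides change places and `α`, `β` exchange roles. The hypotheses on `σ'` and `σ` say that they cancel
around the new automorphisms. -/
theorem IsYDElt.dual {α β α' β' κ σ σ' : H →ₗ[k] H} {π : H →ₗ[k] E} {T : E ⊗[k] H}
    (h : IsYDElt α β π T) {θ : E →ₗ[k] E'} (hθ : IsAntiHom θ) (hκ : IsBialgEnd κ)
    (hσ : IsAntiBialgEnd σ) (hσ' : IsAntiBialgEnd σ') (hα : β ∘ₗ κ = α') (hβ : α ∘ₗ κ = β')
    (hα' : σ' ∘ₗ α' ∘ₗ σ = α') (hβ' : σ' ∘ₗ β' ∘ₗ σ = β') :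
    IsYDElt α' β' (θ ∘ₗ π ∘ₗ κ ∘ₗ σ) (TensorProduct.map θ σ' T) where
  map_one := by simp [h.map_one, hθ.map_one, hκ.map_one, hσ.map_one]
  map_mul := by simp [h.map_mul, hθ.map_mul, hκ.map_mul, hσ.map_mul]
  corep := h.corep.dual hθ hσ'
  compat := by
    have h1 := congrArg (fun f => TensorProduct.map θ σ' ∘ₗ (f ∘ₗ κ) ∘ₗ σ) h.compat
    simp only [conv_comp hκ, antiHom_comp_conv (hθ.map hσ'.toIsAntiHom) hσ, const_comp hκ,
      antiHom_comp_const _ hσ] at h1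
    have e1 : TensorProduct.map θ σ' ∘ₗ (((inl k E H).toLinearMap ∘ₗ π) ∘ₗ κ) ∘ₗ σ =
        (inl k E' H).toLinearMap ∘ₗ θ ∘ₗ π ∘ₗ κ ∘ₗ σ := by
      ext; simp [hσ'.map_one]
    have e2 : ∀ x : H →ₗ[k] H,
        TensorProduct.map θ σ' ∘ₗ (((inr k E H).toLinearMap ∘ₗ x) ∘ₗ κ) ∘ₗ σ =
        (inr k E' H).toLinearMap ∘ₗ σ' ∘ₗ (x ∘ₗ κ) ∘ₗ σ := by
      intro x; ext; simp [hθ.map_one]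
    rw [e1, e2, e2, hα, hβ, hα', hβ'] at h1
    exact h1.symm

end Dual

/-! ### The universal element of the braiding. -/

section Braiding

variable {k H E E' : Type*} [CommRing k] [Ring H] [HopfAlgebra k H] [Ring E] [Algebra k E]
  [Ring E'] [Algebra k E']

local infixl:70 " ⋆ " => conv

theorem IsCorep.lTensor_const {B : Type*} [Ring B] [Algebra k B] {T : E ⊗[k] H} (hT : IsCorep T)
    (b : B) : (const (k := k) b).lTensor E T = inr k E B b := by
  have h1 : const (k := k) (H := H) b = LinearMap.mulLeft k b ∘ₗ const 1 := by ext; simp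
  rw [h1, ← lTensor_lTensor, hT.lTensor_const_one]
  simp [Algebra.TensorProduct.one_def]

/-- The braiding is linear: `R = ∑ T⁰ ⊗ π'(b(T¹))` intertwines the two tensor product actions. -/
theorem IsYDElt.braid_act {γ δ b ψ γ' δ' : H →ₗ[k] H} {π : H →ₗ[k] E} {T : E ⊗[k] H}
    (h : IsYDElt γ δ π T) {π' : H →ₗ[k] E'} (h1 : π' 1 = 1)
    (h2 : ∀ x y, π' (x * y) = π' x * π' y) (hb : IsBialgEnd b) (hψ : IsBialgEnd ψ)
    (hγ : b ∘ₗ γ ∘ₗ ψ = γ') (hδ : b ∘ₗ δ ∘ₗ ψ = δ') :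
    const ((π' ∘ₗ b).lTensor E T) ⋆
        (((inr k E E').toLinearMap ∘ₗ π' ∘ₗ γ') ⋆ ((inl k E E').toLinearMap ∘ₗ π ∘ₗ ψ)) =
      ((inl k E E').toLinearMap ∘ₗ π ∘ₗ ψ) ⋆ ((inr k E E').toLinearMap ∘ₗ π' ∘ₗ δ') ⋆
        const ((π' ∘ₗ b).lTensor E T) := by
  let p : H →ₐ[k] E' := (AlgHom.ofLinearMap π' h1 h2).comp hb.algHom
  have h3 := congrArg
    (fun f => (Algebra.TensorProduct.map (AlgHom.id k E) p).toLinearMap ∘ₗ f ∘ₗ ψ) h.compat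
  simp only [algHom_comp_conv, algHom_comp_const, conv_comp hψ, const_comp hψ] at h3
  have e1 : (Algebra.TensorProduct.map (AlgHom.id k E) p).toLinearMap ∘ₗ
      ((inl k E H).toLinearMap ∘ₗ π) ∘ₗ ψ = (inl k E E').toLinearMap ∘ₗ π ∘ₗ ψ := by
    ext; simp
  have e2 : ∀ x : H →ₗ[k] H, (Algebra.TensorProduct.map (AlgHom.id k E) p).toLinearMap ∘ₗ
      ((inr k E H).toLinearMap ∘ₗ x) ∘ₗ ψ =
      (inr k E E').toLinearMap ∘ₗ π' ∘ₗ b ∘ₗ x ∘ₗ ψ := by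
    intro x; ext; simp [p, IsBialgEnd.algHom]
  rw [e1, e2, e2, hγ, hδ] at h3
  exact h3

/-- The braiding is colinear. -/
theorem IsYDElt.braid_coact {α β b : H →ₗ[k] H} {π : H →ₗ[k] E} {T : E ⊗[k] H}
    {T' : E' ⊗[k] H} (h : IsYDElt α β π T) (hT' : IsCorep T') (hb : IsBialgEnd b)
    (hβ : β ∘ₗ b = LinearMap.id) :
    ((inl k E H).toLinearMap ∘ₗ π ∘ₗ b).lTensor E' T' *
        ((inr k E H).toLinearMap.lTensor E' T' * inr k E' (E ⊗[k] H) T) =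
      inr k E' (E ⊗[k] H) T * (((inr k E H).toLinearMap ∘ₗ α ∘ₗ b).lTensor E' T' *
        ((inl k E H).toLinearMap ∘ₗ π ∘ₗ b).lTensor E' T') := by
  have h3 := congrArg (fun f => (f ∘ₗ b).lTensor E' T') h.compat
  simp only [conv_comp hb, const_comp hb, hT'.lTensor_conv, hT'.lTensor_const,
    LinearMap.comp_assoc, hβ, LinearMap.comp_id, mul_assoc] at h3
  exact h3.symm

/-- Convolution inverses become inverses in `E ⊗ B`; with `f = π ∘ β⁻¹` this inverts the braiding.
-/
theorem IsCorep.lTensor_mul_antipode {B : Type*} [Ring B] [Algebra k B] {T : E ⊗[k] H}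
    (hT : IsCorep T) (f : H →ₐ[k] B) :
    f.toLinearMap.lTensor E T * (f.toLinearMap ∘ₗ HopfAlgebra.antipode k).lTensor E T = 1 := by
  rw [← hT.lTensor_conv, conv_antipode, hT.lTensor_const_one]

theorem IsCorep.lTensor_antipode_mul {B : Type*} [Ring B] [Algebra k B] {T : E ⊗[k] H}
    (hT : IsCorep T) (f : H →ₐ[k] B) :
    (f.toLinearMap ∘ₗ HopfAlgebra.antipode k).lTensor E T * f.toLinearMap.lTensor E T = 1 := by
  rw [← hT.lTensor_conv, antipode_conv, hT.lTensor_const_one]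

end Braiding

end YetterDrinfeld

namespace YetterDrinfeld

/-! ### Co-opposite convolution and the inverse antipode. -/

section Coopposite

variable {k H B B' E : Type*} [CommRing k] [Ring H] [HopfAlgebra k H] [Ring B] [Algebra k B]
  [Ring B'] [Algebra k B'] [Ring E] [Algebra k E]

local infixl:70 " ⋆ " => conv

/-- The convolution product `h ↦ f(h₂) g(h₁)` for the co-opposite coalgebra. -/
noncomputable def coconv (f g : H →ₗ[k] B) : H →ₗ[k] B :=
  (MulOpposite.opLinearEquiv k).symm.toLinearMap ∘ₗ
    (((MulOpposite.opLinearEquiv k).toLinearMap ∘ₗ g) ⋆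
      ((MulOpposite.opLinearEquiv k).toLinearMap ∘ₗ f))

local infixl:70 " ⋄ " => coconv

theorem coconv_apply (f g : H →ₗ[k] B) (h : H) :
    (f ⋄ g) h = LinearMap.mul' k B (TensorProduct.map f g
      (TensorProduct.comm k H H (Coalgebra.comul h))) := by
  simp only [coconv, LinearMap.comp_apply, conv_apply]
  generalize Coalgebra.comul (R := k) h = t
  induction t with
  | zero => simp
  | add x y hx hy => simp only [map_add, hx, hy]
  | tmul x y => simp

theorem coconv_assoc (f g e : H →ₗ[k] B) : f ⋄ g ⋄ e = f ⋄ (g ⋄ e) := by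
  have := conv_assoc ((MulOpposite.opLinearEquiv k).toLinearMap ∘ₗ e)
    ((MulOpposite.opLinearEquiv k).toLinearMap ∘ₗ g)
    ((MulOpposite.opLinearEquiv k).toLinearMap ∘ₗ f)
  exact congrArg (fun z => (MulOpposite.opLinearEquiv k).symm.toLinearMap ∘ₗ z) this.symm

theorem coconv_const_one (f : H →ₗ[k] B) : f ⋄ const 1 = f := by
  have := const_one_conv ((MulOpposite.opLinearEquiv k).toLinearMap ∘ₗ f)
  exact congrArg (fun z => (MulOpposite.opLinearEquiv k).symm.toLinearMap ∘ₗ z) this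

/-- With nothing on the side of the argument to flip the coproduct back, reversing the values leads
to the co-opposite convolution. -/
theorem antiHom_comp_conv_eq {f : B →ₗ[k] B'} (hf : IsAntiHom f) (x y : H →ₗ[k] B) :
    f ∘ₗ (x ⋆ y) = (f ∘ₗ y) ⋄ (f ∘ₗ x) := by
  ext h
  simp only [LinearMap.comp_apply, conv_apply, coconv_apply]
  generalize Coalgebra.comul (R := k) h = t
  induction t with
  | zero => simp
  | add x y hx hy => simp only [map_add, hx, hy]
  | tmul x y => simp [hf.map_mul]

theorem algHom_comp_coconv (j : B →ₐ[k] B') (f g : H →ₗ[k] B) :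
    j.toLinearMap ∘ₗ (f ⋄ g) = (j.toLinearMap ∘ₗ f) ⋄ (j.toLinearMap ∘ₗ g) := by
  ext h
  simp only [LinearMap.comp_apply, coconv_apply]
  generalize Coalgebra.comul (R := k) h = t
  induction t with
  | zero => simp
  | add x y hx hy => simp only [map_add, hx, hy]
  | tmul x y => simp

variable {S : H ≃ₗ[k] H}

theorem antipode_symm_isAntiBialgEnd (hS : S.toLinearMap = HopfAlgebra.antipode k) : IsAntiBialgEnd S.symm.toLinearMap :=
  IsAntiBialgEnd.symm (hS ▸ antipode_isAntiBialgEnd)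

/-- Applying the antimorphism `S⁻¹` to `h₁S(h₂) = ε(h)1` gives `h₂S⁻¹(h₁) = ε(h)1`: the inverse
antipode is an antipode for the co-opposite coproduct. -/
theorem coconv_antipode_symm (hS : S.toLinearMap = HopfAlgebra.antipode k)
    (f : H →ₐ[k] B) :
    f.toLinearMap ⋄ (f.toLinearMap ∘ₗ S.symm.toLinearMap) = const 1 := by
  have h1 := antiHom_comp_conv_eq (antipode_symm_isAntiBialgEnd hS).toIsAntiHom
    (AlgHom.id k H).toLinearMap ((AlgHom.id k H).toLinearMap ∘ₗ HopfAlgebra.antipode k)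
  rw [conv_antipode, ← hS] at h1
  have h2 := congrArg (fun z => f.toLinearMap ∘ₗ z) h1
  simp only [algHom_comp_coconv] at h2
  convert h2.symm using 1
  · congr 1; ext; simp
  · have h3 : S.symm 1 = 1 := (antipode_symm_isAntiBialgEnd hS).map_one
    ext; simp [h3]

theorem antipode_symm_coconv (hS : S.toLinearMap = HopfAlgebra.antipode k)
    (f : H →ₐ[k] B) :
    (f.toLinearMap ∘ₗ S.symm.toLinearMap) ⋄ f.toLinearMap = const 1 := by
  have h1 := antiHom_comp_conv_eq (antipode_symm_isAntiBialgEnd hS).toIsAntiHom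
    ((AlgHom.id k H).toLinearMap ∘ₗ HopfAlgebra.antipode k) (AlgHom.id k H).toLinearMap
  rw [antipode_conv, ← hS] at h1
  have h2 := congrArg (fun z => f.toLinearMap ∘ₗ z) h1
  simp only [algHom_comp_coconv] at h2
  convert h2.symm using 1
  · congr 1; ext; simp
  · have h3 : S.symm 1 = 1 := (antipode_symm_isAntiBialgEnd hS).map_one
    ext; simp [h3]

/-- The compatibility condition, in the form `T π(h) = (π(h₂) ⊗ β(h₃)) T (1 ⊗ α(S⁻¹(h₁)))` and in
the form free of antipodes. -/
theorem compat_iff (hS : S.toLinearMap = HopfAlgebra.antipode k) {α β : H →ₗ[k] H}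
    (hα : IsBialgEnd α) {π : H →ₗ[k] E} {T : E ⊗[k] H} :
    const T ⋆ (((inr k E H).toLinearMap ∘ₗ α) ⋆ ((inl k E H).toLinearMap ∘ₗ π)) =
      ((inl k E H).toLinearMap ∘ₗ π) ⋆ ((inr k E H).toLinearMap ∘ₗ β) ⋆ const T ↔
    LinearMap.mulLeft k T ∘ₗ (inl k E H).toLinearMap ∘ₗ π =
      (((inl k E H).toLinearMap ∘ₗ π) ⋆ ((inr k E H).toLinearMap ∘ₗ β) ⋆ const T) ⋄
        ((inr k E H).toLinearMap ∘ₗ α ∘ₗ S.symm.toLinearMap) := by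
  have h1 : const T ⋆ (((inr k E H).toLinearMap ∘ₗ α) ⋆ ((inl k E H).toLinearMap ∘ₗ π)) =
      (LinearMap.mulLeft k T ∘ₗ (inl k E H).toLinearMap ∘ₗ π) ⋄
        ((inr k E H).toLinearMap ∘ₗ α) := by
    rw [const_conv]
    ext h
    simp only [LinearMap.comp_apply, conv_apply, coconv_apply]
    generalize Coalgebra.comul (R := k) h = t
    induction t with
    | zero => simp
    | add x y hx hy => simp only [map_add, hx, hy]
    | tmul x y => simp [mul_assoc]
  -- In the co-opposite convolution `α` and `α ∘ S⁻¹` are mutually inverse, so both implications are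
  -- cancellations on the right.
  have h2 := coconv_antipode_symm hS ((inr k E H).comp hα.algHom)
  have h3 := antipode_symm_coconv hS ((inr k E H).comp hα.algHom)
  rw [show ((inr k E H).comp hα.algHom).toLinearMap = (inr k E H).toLinearMap ∘ₗ α from rfl,
    LinearMap.comp_assoc] at h2 h3
  rw [h1]
  constructor
  · intro h
    rw [← h, coconv_assoc, h2, coconv_const_one]
  · intro h
    rw [h, coconv_assoc, h3, coconv_const_one]

end Coopposite

/-! ### Elements of `End(M) ⊗ V` as linear maps `M → M ⊗ V`. -/

section Apply

variable {k M V W : Type*} [Field k] [AddCommGroup M] [Module k M]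
  [AddCommGroup V] [Module k V] [AddCommGroup W] [Module k W]

/-- An element of `End(M) ⊗ V` as a linear map `M → M ⊗ V`. -/
noncomputable def ap : Module.End k M ⊗[k] V →ₗ[k] M →ₗ[k] M ⊗[k] V :=
  TensorProduct.rTensorHomToHomRTensor (RingHom.id k) M M V

@[simp] theorem ap_tmul (f : Module.End k M) (x : V) (m : M) :
    ap (f ⊗ₜ[k] x) m = f m ⊗ₜ[k] x := rfl

/-- Finite dimension enters here: it makes every coaction come from a unique element of `End(M) ⊗
H`. -/
theorem ap_bijective [FiniteDimensional k M] :
    Function.Bijective (ap : Module.End k M ⊗[k] V →ₗ[k] M →ₗ[k] M ⊗[k] V) := by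
  have : (ap : Module.End k M ⊗[k] V →ₗ[k] M →ₗ[k] M ⊗[k] V) =
    (rTensorHomEquivHomRTensor k M M V).toLinearMap :=
    (rTensorHomEquivHomRTensor_toLinearMap ..).symm
  rw [this]
  exact (rTensorHomEquivHomRTensor k M M V).bijective

theorem ap_injective [FiniteDimensional k M] :
    Function.Injective (ap : Module.End k M ⊗[k] V →ₗ[k] M →ₗ[k] M ⊗[k] V) := ap_bijective.1

theorem ap_lTensor (f : V →ₗ[k] W) (T : Module.End k M ⊗[k] V) (m : M) :
    ap (f.lTensor _ T) m = f.lTensor M (ap T m) := by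
  induction T with
  | zero => simp
  | add x y hx hy => simp only [map_add, LinearMap.add_apply, hx, hy]
  | tmul x y => simp

variable {H : Type*} [Ring H] [HopfAlgebra k H]

/-- The right factor acts first and occupies the last `H`-leg, as in `m₀₀ ⊗ m₀₁ ⊗ m₁`; hence
`T₁₂T₁₃` is the iterated coaction. -/
theorem ap_mul_legs (T T' : Module.End k M ⊗[k] H) (m : M) :
    ap ((inl k H H).toLinearMap.lTensor _ T * (inr k H H).toLinearMap.lTensor _ T') m =
      TensorProduct.assoc k M H H ((ap T).rTensor H (ap T' m)) := by
  induction T' with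
  | zero => simp
  | add x y hx hy => simp only [map_add, mul_add, LinearMap.add_apply, hx, hy]
  | tmul x y =>
    induction T with
    | zero => simp
    | add x y hx hy => 
      simp only [map_add, add_mul, LinearMap.add_apply, LinearMap.rTensor_add, hx, hy]
    | tmul x y => simp

theorem ap_mul_inl {B : Type*} [Ring B] [Algebra k B] (T : Module.End k M ⊗[k] B)
    (f : Module.End k M) (m : M) : ap (T * inl k _ B f) m = ap T (f m) := by
  induction T with
  | zero => simp
  | add x y hx hy => simp only [map_add, add_mul, LinearMap.add_apply, hx, hy]
  | tmul x y => simp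

theorem ap_one {B : Type*} [Ring B] [Algebra k B] (m : M) :
    ap (1 : Module.End k M ⊗[k] B) m = m ⊗ₜ 1 := rfl

end Apply

end YetterDrinfeld

/-! ### Twists of Hopf algebras and untwisted Yetter-Drinfeld modules. -/

namespace MonoidalHomHopf

open YetterDrinfeld

section Automorphisms

variable {k : Type u} {H : Type v} [Field k] [AddCommGroup H] [Module k H]
variable {A : MonoidalHomHopf k H}

@[simp] theorem autLin_mul (f g : A.Aut) : autLin (f * g) = autLin f ∘ₗ autLin g := rfl

@[simp] theorem autLin_one : autLin (1 : A.Aut) = LinearMap.id := rfl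

@[simp] theorem autLin_apply_inv (f : A.Aut) (h : H) : autLin f (autLin f⁻¹ h) = h :=
  LinearEquiv.apply_symm_apply f.1 h

@[simp] theorem autLin_ξ (f : A.Aut) (h : H) : autLin f (A.ξ h) = A.ξ (autLin f h) := f.2.1 h

@[simp] theorem autLin_ξ_symm (f : A.Aut) (h : H) :
    autLin f (A.ξ.symm h) = A.ξ.symm (autLin f h) := by
  apply A.ξ.injective
  rw [← autLin_ξ, A.ξ.apply_symm_apply, A.ξ.apply_symm_apply]

@[simp] theorem autLin_S (f : A.Aut) (h : H) : autLin f (A.S h) = A.S (autLin f h) :=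
  f.2.2.2.2.2.2 h

@[simp] theorem autLin_S_symm (f : A.Aut) (h : H) :
    autLin f (A.S.symm h) = A.S.symm (autLin f h) := by
  apply A.S.injective
  rw [← autLin_S, A.S.apply_symm_apply, A.S.apply_symm_apply]

@[simp] theorem S_ξ_symm (h : H) : A.S (A.ξ.symm h) = A.ξ.symm (A.S h) := by
  apply A.ξ.injective
  rw [← A.S_ξ, A.ξ.apply_symm_apply, A.ξ.apply_symm_apply]

@[simp] theorem S_symm_ξ (h : H) : A.S.symm (A.ξ h) = A.ξ (A.S.symm h) := by
  apply A.S.injective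
  rw [A.S_ξ, A.S.apply_symm_apply, A.S.apply_symm_apply]

@[simp] theorem S_symm_ξ_symm (h : H) : A.S.symm (A.ξ.symm h) = A.ξ.symm (A.S.symm h) := by
  apply A.S.injective
  rw [S_ξ_symm, A.S.apply_symm_apply, A.S.apply_symm_apply]

end Automorphisms

variable {k : Type u} {H : Type v} [Field k] [Ring H] [HopfAlgebra k H]

/-- The monoidal Hom-Hopf algebra `A` is obtained from the Hopf algebra `H` by twisting its
multiplication and comultiplication with the automorphism `A.ξ`. -/
structure IsTwistOf (A : MonoidalHomHopf k H) : Prop where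
  mul_eq : ∀ a b, A.mul a b = A.ξ (a * b)
  one_eq : A.one = 1
  comul_ξ_eq : ∀ a, A.comul (A.ξ a) = Coalgebra.comul a
  counit_eq : A.counit = Coalgebra.counit
  S_eq : A.S.toLinearMap = HopfAlgebra.antipode k

variable {A : MonoidalHomHopf k H}

namespace IsTwistOf

variable (hA : A.IsTwistOf)

theorem comul_eq (hA : A.IsTwistOf) (a : H) :
    A.comul a = Coalgebra.comul (A.ξ.symm a) := by
  rw [← hA.comul_ξ_eq, A.ξ.apply_symm_apply]

theorem ξ_mul (hA : A.IsTwistOf) (a b : H) : A.ξ (a * b) = A.ξ a * A.ξ b :=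
  A.ξ.injective (by rw [← hA.mul_eq, ← hA.mul_eq, ← A.ξ_mul, hA.mul_eq])

theorem isBialgEnd_ξ (hA : A.IsTwistOf) : IsBialgEnd A.ξ.toLinearMap where
  map_one := by have := A.ξ_one; rwa [hA.one_eq] at this
  map_mul := hA.ξ_mul
  counit_comp := by
    ext a
    have := A.counit_ξ a
    rwa [hA.counit_eq] at this
  comul_comp := by
    ext a
    have := A.comul_ξ (A.ξ a)
    rwa [hA.comul_ξ_eq, hA.comul_ξ_eq] at this

/-- Twisted and untwisted operations differ by `ξ`, with which automorphisms commute, so an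
automorphism of `A` respects the untwisted structure as well. -/
theorem isBialgEnd_aut (hA : A.IsTwistOf) (f : A.Aut) : IsBialgEnd (autLin f) where
  map_one := by have := f.2.2.2.1; rwa [hA.one_eq] at this
  map_mul a b := by
    have := f.2.2.1 a b
    rw [hA.mul_eq, hA.mul_eq, f.2.1] at this
    exact A.ξ.injective this
  counit_comp := by
    ext a
    have := f.2.2.2.2.2.1 a
    rwa [hA.counit_eq] at this
  comul_comp := by
    ext a
    have := f.2.2.2.2.1 (A.ξ a)
    rwa [f.2.1, hA.comul_ξ_eq, hA.comul_ξ_eq] at this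

end IsTwistOf

theorem isBialgEnd_symm {e : H ≃ₗ[k] H} (he : IsBialgEnd e.toLinearMap) :
    IsBialgEnd e.symm.toLinearMap where
  map_one := e.injective (by simpa using he.map_one.symm)
  map_mul a b := e.injective (by
    have := he.map_mul (e.symm a) (e.symm b)
    simp only [LinearEquiv.coe_coe, LinearEquiv.apply_symm_apply] at this ⊢
    exact this.symm)
  counit_comp := by
    conv_lhs => rw [← he.counit_comp]
    ext; simp
  comul_comp := by
    ext h
    obtain ⟨h, rfl⟩ := e.surjective h
    have h1 := LinearMap.congr_fun he.comul_comp h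
    simp only [LinearMap.comp_apply, LinearEquiv.coe_coe, LinearEquiv.symm_apply_apply] at h1 ⊢
    rw [h1]
    generalize Coalgebra.comul (R := k) h = t
    induction t with
    | zero => simp
    | add x y hx hy => simp only [map_add, ← hx, ← hy]
    | tmul x y => simp

theorem IsTwistOf.isBialgEnd_ξ_symm (hA : A.IsTwistOf) : IsBialgEnd A.ξ.symm.toLinearMap :=
  isBialgEnd_symm hA.isBialgEnd_ξ

namespace YDData

/-- The representation `h ↦ ξ⁻¹(h · -)` of the untwisted Hopf algebra. -/
noncomputable def rep (M : YDData A) : H →ₗ[k] Module.End k M.carrier :=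
  M.act.compr₂ M.ξ.symm.toLinearMap

theorem rep_apply (M : YDData A) (h : H) (m : M.carrier) :
    M.rep h m = M.ξ.symm (M.act h m) := rfl

theorem act_eq (M : YDData A) (h : H) (m : M.carrier) : M.act h m = M.ξ (M.rep h m) := by
  rw [rep_apply, LinearEquiv.apply_symm_apply]

/-- The corepresentation `∑ T⁰ ⊗ T¹` of the untwisted Hopf algebra, `T⁰(m) ⊗ T¹ = ρ(ξ(m))`. -/
noncomputable def corep (M : YDData A) [FiniteDimensional k M.carrier] :
    Module.End k M.carrier ⊗[k] H :=
  (LinearEquiv.ofBijective ap ap_bijective).symm (M.coact ∘ₗ M.ξ.toLinearMap)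

theorem ap_corep (M : YDData A) [FiniteDimensional k M.carrier] :
    ap M.corep = M.coact ∘ₗ M.ξ.toLinearMap :=
  (LinearEquiv.ofBijective ap ap_bijective).apply_symm_apply _

theorem ap_corep_apply (M : YDData A) [FiniteDimensional k M.carrier] (m : M.carrier) :
    ap M.corep m = M.coact (M.ξ m) := by rw [ap_corep]; rfl

theorem coact_eq (M : YDData A) [FiniteDimensional k M.carrier] (m : M.carrier) :
    M.coact m = ap M.corep (M.ξ.symm m) := by rw [ap_corep_apply, LinearEquiv.apply_symm_apply]

/-- The axioms of a Yetter-Drinfeld Hom-module in terms of the untwisted Hopf algebra. -/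
structure IsUntwistedYD (M : YDData A) [FiniteDimensional k M.carrier] : Prop where
  ξ_rep : ∀ h m, M.ξ (M.rep h m) = M.rep (A.ξ h) (M.ξ m)
  ξ_corep : ∀ m, ap M.corep (M.ξ m) =
    TensorProduct.map M.ξ.toLinearMap A.ξ.toLinearMap (ap M.corep m)
  isYDElt : IsYDElt (autLin M.deg.fst) (autLin M.deg.snd) M.rep M.corep

/-- Every power of `ξ` cancels. On the module leg, `ξ_H` meets the `ξ⁻²` of the iterated coproduct
and the shift in the action; on the algebra leg, the two twisted products supply the `ξ`'s that the
coproducts and the coaction remove. -/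
theorem compatRHS_eq (hA : A.IsTwistOf) (M : YDData A) [FiniteDimensional k M.carrier]
    (h1 : ∀ h m, M.ξ (M.rep h m) = M.rep (A.ξ h) (M.ξ m))
    (h2 : ∀ m, ap M.corep (M.ξ m) =
      TensorProduct.map M.ξ.toLinearMap A.ξ.toLinearMap (ap M.corep m))
    (h : H) (m : M.carrier) :
    M.compatRHS h m = ap (coconv (conv (conv ((inl k _ H).toLinearMap ∘ₗ M.rep)
      ((inr k _ H).toLinearMap ∘ₗ autLin M.deg.snd)) (const M.corep))
        ((inr k _ H).toLinearMap ∘ₗ autLin M.deg.fst ∘ₗ A.S.symm.toLinearMap) h) m := by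
  have e1 : A.comul h = TensorProduct.map A.ξ.symm.toLinearMap A.ξ.symm.toLinearMap
      (Coalgebra.comul h) := by
    rw [hA.comul_eq]; exact LinearMap.congr_fun hA.isBialgEnd_ξ_symm.comul_comp h
  have e2 : M.coact m = TensorProduct.map M.ξ.symm.toLinearMap A.ξ.symm.toLinearMap
      (ap M.corep m) := by
    obtain ⟨n, rfl⟩ := M.ξ.surjective m
    rw [coact_eq, M.ξ.symm_apply_apply, h2, ← LinearMap.comp_apply, ← TensorProduct.map_comp]
    simp
  rw [compatRHS, e1, coconv_apply]
  generalize Coalgebra.comul (R := k) h = t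
  induction t with
  | zero => simp
  | add x y hx hy => simp only [map_add, LinearMap.add_apply, hx, hy]
  | tmul x y =>
    have e3 : A.comul (A.ξ.symm y) = TensorProduct.map (A.ξ.symm.toLinearMap ∘ₗ
        A.ξ.symm.toLinearMap) (A.ξ.symm.toLinearMap ∘ₗ A.ξ.symm.toLinearMap)
        (Coalgebra.comul y) := by
      rw [hA.comul_eq, TensorProduct.map_comp]
      have e4 := LinearMap.congr_fun hA.isBialgEnd_ξ_symm.comul_comp
      simp only [LinearMap.comp_apply, LinearEquiv.coe_coe] at e4
      rw [e4, e4]; rfl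
    simp only [TensorProduct.map_tmul, TensorProduct.lift.tmul, LinearMap.mk₂_apply,
      LinearEquiv.coe_coe, e2, e3, TensorProduct.comm_tmul, LinearMap.mul'_apply, conv_const,
      LinearMap.comp_apply, LinearMap.mulRight_apply, conv_apply]
    generalize Coalgebra.comul (R := k) y = s
    generalize M.corep = T
    induction s with
    | zero => simp
    | add x y hx hy => 
      simp only [map_add, LinearMap.add_apply, add_mul, hx, hy]
    | tmul a b =>
      induction T with
      | zero => simp
      | add x y hx hy => 
        simp only [map_add, LinearMap.add_apply, mul_add, add_mul, hx, hy]
      | tmul e c =>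
        simp [hA.mul_eq, act_eq, h1, hA.ξ_mul]

/-- Evaluating at `ξ²(m)` makes the coaction there equal to `(ξ ⊗ ξ)` of the untwisted coaction of
`m`; these factors absorb the `ξ⁻¹`'s of Hom-coassociativity on both sides. -/
theorem coassoc_iff (hA : A.IsTwistOf) (M : YDData A) [FiniteDimensional k M.carrier]
    (h2 : ∀ m, ap M.corep (M.ξ m) =
      TensorProduct.map M.ξ.toLinearMap A.ξ.toLinearMap (ap M.corep m)) (m : M.carrier) :
    TensorProduct.map M.ξ.symm.toLinearMap A.comul (M.coact (M.ξ (M.ξ m))) =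
      TensorProduct.assoc k M.carrier H H
        (TensorProduct.map M.coact A.ξ.symm.toLinearMap (M.coact (M.ξ (M.ξ m)))) ↔
    ap ((Coalgebra.comul (R := k)).lTensor _ M.corep) m =
      ap ((inl k H H).toLinearMap.lTensor _ M.corep *
        (inr k H H).toLinearMap.lTensor _ M.corep) m := by
  rw [ap_lTensor, ap_mul_legs, ← ap_corep_apply, h2, ap_corep]
  generalize (M.coact ∘ₗ M.ξ.toLinearMap) m = t
  have e1 : TensorProduct.map M.ξ.symm.toLinearMap A.comul
      (TensorProduct.map M.ξ.toLinearMap A.ξ.toLinearMap t) =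
      (Coalgebra.comul (R := k)).lTensor _ t := by
    induction t with
    | zero => simp
    | add x y hx hy => simp only [map_add, hx, hy]
    | tmul x y => simp [hA.comul_ξ_eq]
  have e2 : TensorProduct.map M.coact A.ξ.symm.toLinearMap
      (TensorProduct.map M.ξ.toLinearMap A.ξ.toLinearMap t) =
      (M.coact ∘ₗ M.ξ.toLinearMap).rTensor H t := by
    clear e1
    induction t with
    | zero => simp
    | add x y hx hy => simp only [map_add, hx, hy]
    | tmul x y => simp
  rw [e1, e2]

/-- The gateway to the algebraic part: identities between maps on `M` become identities between
elements of `End(M) ⊗ V` by injectivity of `ap`. -/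
theorem IsYD.untwist (hA : A.IsTwistOf) {M : YDData A} [FiniteDimensional k M.carrier]
    (hM : M.IsYD) : M.IsUntwistedYD := by
  have h1 : ∀ h m, M.ξ (M.rep h m) = M.rep (A.ξ h) (M.ξ m) := by
    intro h m
    rw [rep_apply, rep_apply, ← hM.ξ_act]; simp
  have h2 : ∀ m, ap M.corep (M.ξ m) =
      TensorProduct.map M.ξ.toLinearMap A.ξ.toLinearMap (ap M.corep m) := by
    intro m
    rw [ap_corep_apply, ap_corep_apply, hM.coact_ξ]
  refine ⟨h1, h2, ?_, ?_, ⟨?_, ?_⟩, ?_⟩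
  · ext m
    rw [rep_apply, ← hA.one_eq, hM.one_act]; simp
  · intro a b
    ext m
    have := hM.act_assoc a b m
    rw [hA.mul_eq, act_eq, act_eq, act_eq, ← h1, ← h1] at this
    exact (M.ξ.injective (M.ξ.injective this)).symm
  · apply ap_injective
    ext m : 1
    exact (coassoc_iff hA M h2 m).1 (hM.coact_coassoc _)
  · apply ap_injective
    ext m : 1
    have h3 := congrArg (fun z => z ⊗ₜ[k] (1 : H)) (hM.coact_counit (M.ξ m))
    simp only [hA.counit_eq, LinearEquiv.symm_apply_apply] at h3
    rw [ap_lTensor, ap_one, ← h3, ap_corep_apply]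
    generalize M.coact (M.ξ m) = t
    induction t with
    | zero => simp
    | add x y hx hy => simp only [map_add, hx, hy, TensorProduct.add_tmul]
    | tmul x y => simp [TensorProduct.smul_tmul]
  · rw [compat_iff hA.S_eq (hA.isBialgEnd_aut _)]
    ext h : 1
    apply ap_injective
    ext m : 1
    rw [← compatRHS_eq hA M h1 h2, ← hM.compat, act_eq, ← ap_corep_apply]
    exact ap_mul_inl _ _ _

theorem IsUntwistedYD.isYD (hA : A.IsTwistOf) {M : YDData A} [FiniteDimensional k M.carrier]
    (hM : M.IsUntwistedYD) : M.IsYD where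
  act_assoc a b m := by
    rw [hA.mul_eq, act_eq, act_eq, act_eq, ← hM.ξ_rep, ← hM.ξ_rep, hM.isYDElt.map_mul]; rfl
  ξ_act a m := by rw [act_eq, act_eq, hM.ξ_rep]
  one_act m := by rw [hA.one_eq, act_eq, hM.isYDElt.map_one]; rfl
  coact_coassoc m := by
    obtain ⟨m, rfl⟩ := M.ξ.surjective m
    obtain ⟨m, rfl⟩ := M.ξ.surjective m
    rw [coassoc_iff hA M hM.ξ_corep, hM.isYDElt.corep.comul]
  coact_ξ m := by
    obtain ⟨m, rfl⟩ := M.ξ.surjective m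
    rw [← ap_corep_apply, ← ap_corep_apply, hM.ξ_corep]
  coact_counit m := by
    have h3 := congrArg (fun z => ap z (M.ξ.symm m)) hM.isYDElt.corep.counit
    simp only [ap_lTensor, ap_one] at h3
    have h4 := congrArg (fun z => TensorProduct.rid k _ (A.counit.lTensor _ z)) h3
    simp only [LinearMap.lTensor_tmul, TensorProduct.rid_tmul, hA.counit_eq,
      Bialgebra.counit_one, one_smul] at h4
    rw [← h4, ← coact_eq, hA.counit_eq]
    generalize M.coact m = t
    induction t with
    | zero => simp
    | add x y hx hy => simp only [map_add, hx, hy]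
    | tmul x y => simp
  compat h m := by
    rw [compatRHS_eq hA M hM.ξ_rep hM.ξ_corep]
    have h3 := (compat_iff hA.S_eq (hA.isBialgEnd_aut _)).1 hM.isYDElt.compat
    rw [← h3, act_eq, ← ap_corep_apply]
    exact (ap_mul_inl _ _ _).symm

end YDData

end MonoidalHomHopf

/-! ### Endomorphisms of tensor products and of dual spaces. -/

namespace YetterDrinfeld

variable {k M N : Type*} [Field k] [AddCommGroup M] [Module k M] [AddCommGroup N] [Module k N]

/-- The action of `End(M) ⊗ End(N)` on `M ⊗ N`. -/
noncomputable def endMap : Module.End k M ⊗[k] Module.End k N →ₐ[k] Module.End k (M ⊗[k] N) :=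
  Module.endTensorEndAlgHom

@[simp] theorem endMap_tmul (f : Module.End k M) (g : Module.End k N) (m : M) (n : N) :
    endMap (f ⊗ₜ[k] g) (m ⊗ₜ[k] n) = f m ⊗ₜ[k] g n := rfl

/-- The transpose of endomorphisms. -/
def transp : Module.End k M →ₗ[k] Module.End k (Module.Dual k M) := Module.Dual.transpose

@[simp] theorem transp_apply (f : Module.End k M) (p : Module.Dual k M) (m : M) :
    transp f p m = p (f m) := rfl

theorem isAntiHom_transp : IsAntiHom (k := k) (B := Module.End k M)
    (B' := Module.End k (Module.Dual k M)) transp :=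
  ⟨rfl, fun _ _ => rfl⟩

variable {H : Type*} [Ring H] [HopfAlgebra k H]

theorem ap_tensor (T : Module.End k M ⊗[k] H) (T' : Module.End k N ⊗[k] H) (m : M) (n : N) :
    ap (endMap.toLinearMap.rTensor H
      ((inr k (Module.End k M) (Module.End k N)).toLinearMap.rTensor H T' *
        (inl k (Module.End k M) (Module.End k N)).toLinearMap.rTensor H T)) (m ⊗ₜ[k] n) =
    (LinearMap.mul' k H ∘ₗ (TensorProduct.comm k H H).toLinearMap).lTensor (M ⊗[k] N)
      (TensorProduct.tensorTensorTensorComm k M H N H (ap T m ⊗ₜ[k] ap T' n)) := by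
  induction T with
  | zero => simp
  | add x y hx hy =>
    simp only [map_add, mul_add, TensorProduct.add_tmul, LinearMap.add_apply, hx, hy]
  | tmul x y =>
    induction T' with
    | zero => simp
    | add x y hx hy =>
      simp only [map_add, add_mul, TensorProduct.tmul_add, LinearMap.add_apply, hx, hy]
    | tmul x y => simp

theorem dualTensorHom_ap (f : H →ₗ[k] H) (T : Module.End k M ⊗[k] H) (p : Module.Dual k M)
    (m : M) : dualTensorHom k M H (ap (TensorProduct.map transp f T) p) m =
      TensorProduct.lid k H (TensorProduct.map p f (ap T m)) := by
  induction T with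
  | zero => simp
  | add x y hx hy => simp only [map_add, LinearMap.add_apply, hx, hy]
  | tmul x y => simp

end YetterDrinfeld

/-! ### Tensor products, conjugates, the unit and duals in untwisted form. -/

namespace MonoidalHomHopf

open YetterDrinfeld

variable {k : Type u} {H : Type v} [Field k] [Ring H] [HopfAlgebra k H]
variable {A : MonoidalHomHopf k H}

namespace YDData

section Tensor

variable (M N : YDData A)

/-- This is the ordinary tensor product representation up to one leftover `ξ⁻¹`, which stems from
the twisted coproduct; `corep_tensor` has a leftover `ξ`, from the twisted product. -/
theorem rep_tensor (hA : A.IsTwistOf) :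
    (M.tensor N).rep = (endMap.toLinearMap ∘ₗ
      (TensorProduct.map (M.rep ∘ₗ autLin N.deg.fst)
        (N.rep ∘ₗ autLin (N.deg.fst⁻¹ * M.deg.snd * N.deg.fst)) ∘ₗ Coalgebra.comul)) ∘ₗ
          A.ξ.symm.toLinearMap := by
  ext h : 1
  apply TensorProduct.ext'
  intro m n
  change TensorProduct.map M.ξ.symm.toLinearMap N.ξ.symm.toLinearMap
    (M.tensorAct N h (m ⊗ₜ[k] n)) = _
  simp only [tensorAct, LinearMap.comp_apply, LinearEquiv.coe_coe, hA.comul_eq]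
  generalize Coalgebra.comul (R := k) (A.ξ.symm h) = t
  induction t with
  | zero => simp
  | add x y hx hy => simp only [map_add, LinearMap.add_apply, hx, hy]
  | tmul x y => simp [rep_apply]

theorem rep_tensor_apply (hA : A.IsTwistOf) (h : H) (x : M.carrier ⊗[k] N.carrier) :
    (M.tensor N).rep (A.ξ h) x = endMap
      (TensorProduct.map (M.rep ∘ₗ autLin N.deg.fst)
        (N.rep ∘ₗ autLin (N.deg.fst⁻¹ * M.deg.snd * N.deg.fst)) (Coalgebra.comul h)) x := by
  rw [rep_tensor M N hA]; simp

variable [FiniteDimensional k M.carrier] [FiniteDimensional k N.carrier]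

theorem corep_tensor (hA : A.IsTwistOf) :
    (M.tensor N).corep = A.ξ.toLinearMap.lTensor _
      (endMap.toLinearMap.rTensor H
      ((inr k (Module.End k M.carrier) (Module.End k N.carrier)).toLinearMap.rTensor H N.corep *
        (inl k (Module.End k M.carrier) (Module.End k N.carrier)).toLinearMap.rTensor H
          M.corep)) := by
  apply ap_injective
  apply TensorProduct.ext'
  intro m n
  rw [ap_lTensor, ap_tensor, ap_corep_apply, ap_corep_apply, ap_corep_apply]
  simp only [tensorCoact, LinearMap.comp_apply, LinearEquiv.coe_coe, TensorProduct.congr_tmul,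
    TensorProduct.map_tmul]
  generalize TensorProduct.tensorTensorTensorComm k M.carrier H N.carrier H _ = t
  induction t with
  | zero => simp
  | add x y hx hy => simp only [map_add, hx, hy]
  | tmul x y =>
    induction y with
    | zero => simp
    | add x y hx hy => simp only [map_add, TensorProduct.tmul_add, hx, hy]
    | tmul x y => simp [hA.mul_eq]

variable {M N}

/-- The ordinary tensor product is compatible, and the leftover `ξ⁻¹` on the action and `ξ` on the
coaction form a twist that does not change the degree, since automorphisms commute with `ξ`. -/
theorem IsUntwistedYD.tensor (hA : A.IsTwistOf) (hM : M.IsUntwistedYD) (hN : N.IsUntwistedYD) :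
    (M.tensor N).IsUntwistedYD where
  ξ_rep h := by
    intro (x : M.carrier ⊗[k] N.carrier)
    obtain ⟨h, rfl⟩ := A.ξ.surjective h
    rw [rep_tensor_apply M N hA, rep_tensor_apply M N hA,
      show Coalgebra.comul (R := k) (A.ξ h) = _ from
        LinearMap.congr_fun hA.isBialgEnd_ξ.comul_comp h, LinearMap.comp_apply]
    change TensorProduct.congr M.ξ N.ξ _ = _
    generalize Coalgebra.comul (R := k) h = t
    induction x with
    | zero => simp
    | add x y hx hy => simp only [map_add, hx, hy]
    | tmul m n =>
      induction t with
      | zero => simp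
      | add x y hx hy => simp only [map_add, LinearMap.add_apply, hx, hy]
      | tmul x y => simp [hM.ξ_rep, hN.ξ_rep]
  ξ_corep := by
    intro (x : M.carrier ⊗[k] N.carrier)
    change ap _ (TensorProduct.congr M.ξ N.ξ x) =
      TensorProduct.map (TensorProduct.congr M.ξ N.ξ).toLinearMap _ _
    induction x with
    | zero => simp
    | add x y hx hy => simp only [map_add, hx, hy]
    | tmul m n =>
      rw [corep_tensor M N hA, ap_lTensor, ap_lTensor, ap_tensor, TensorProduct.congr_tmul,
        ap_tensor, hM.ξ_corep, hN.ξ_corep]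
      generalize ap M.corep m = t
      generalize ap N.corep n = s
      induction t with
      | zero => simp
      | add x y hx hy => simp only [map_add, TensorProduct.add_tmul, hx, hy]
      | tmul x y =>
        induction s with
        | zero => simp
        | add x y hx hy => simp only [map_add, TensorProduct.tmul_add, hx, hy]
        | tmul x y => simp [hA.ξ_mul]
  isYDElt := by
    rw [rep_tensor M N hA, corep_tensor M N hA]
    refine ((hM.isYDElt.tensor hN.isYDElt (hA.isBialgEnd_aut _) (hA.isBialgEnd_aut _) ?_).map
      _).twist hA.isBialgEnd_ξ hA.isBialgEnd_ξ_symm ?_ ?_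
    -- With `β' = γ⁻¹βγ` the relation `γβ' = βγ` holds in the group.
    · rw [← autLin_mul, ← autLin_mul]; congr 1; group
    · ext h; simp
    · ext h; simp

end Tensor

section Conj

variable (g : A.G) (M : YDData A)

theorem rep_conj : (M.conj g).rep =
    M.rep ∘ₗ autLin (M.deg.fst⁻¹ * g.snd * M.deg.fst * g.fst⁻¹) := rfl

variable [FiniteDimensional k M.carrier]

theorem corep_conj : (M.conj g).corep = (autLin (g.fst * g.snd⁻¹)).lTensor _ M.corep := by
  apply ap_injective
  ext m : 1
  exact (ap_corep_apply (M.conj g) m).trans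
    ((ap_lTensor _ M.corep m).trans (congrArg _ (ap_corep_apply M m))).symm

variable {M}

/-- A twist with `φ = αβ⁻¹` and `ψ = γ⁻¹βγα⁻¹`: the products `φγψ = αγα⁻¹` and `φδψ` are the
components of the conjugated degree. -/
theorem IsUntwistedYD.conj (hA : A.IsTwistOf) (hM : M.IsUntwistedYD) :
    (M.conj g).IsUntwistedYD where
  ξ_rep h m := by
    rw [rep_conj, LinearMap.comp_apply, LinearMap.comp_apply, autLin_ξ]
    exact hM.ξ_rep _ _
  ξ_corep m := by
    rw [corep_conj]
    refine (ap_lTensor _ M.corep (M.ξ m)).trans (Eq.trans ?_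
      (congrArg _ (ap_lTensor _ M.corep m).symm))
    rw [hM.ξ_corep]
    change _ = TensorProduct.map M.ξ.toLinearMap _ _
    generalize ap M.corep m = t
    induction t with
    | zero => simp
    | add x y hx hy => simp only [map_add, hx, hy]
    | tmul x y => simp
  isYDElt := by
    rw [rep_conj, corep_conj]
    refine hM.isYDElt.twist (hA.isBialgEnd_aut _) (hA.isBialgEnd_aut _) ?_ ?_
    · rw [← autLin_mul, ← autLin_mul]; congr 1; simp only [G.mul_fst, G.inv_fst]; group
    · rw [← autLin_mul, ← autLin_mul]; congr 1
      simp only [G.mul_snd, G.inv_snd, G.inv_fst]; group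

end Conj

section Unit

theorem corep_unit [FiniteDimensional k (unit A).carrier] (hA : A.IsTwistOf) :
    (unit A).corep = 1 := by
  apply ap_injective
  ext
  rw [ap_corep_apply, ap_one]
  simp [hA.one_eq]

theorem rep_unit (hA : A.IsTwistOf) : (unit A).rep = const 1 := by
  ext h : 1
  apply LinearMap.ext
  intro x
  rw [rep_apply]
  simp [hA.counit_eq]

theorem isUntwistedYD_unit [FiniteDimensional k (unit A).carrier] (hA : A.IsTwistOf) :
    (unit A).IsUntwistedYD where
  ξ_rep h m := by
    have := LinearMap.congr_fun hA.isBialgEnd_ξ.counit_comp h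
    simp only [LinearMap.comp_apply, LinearEquiv.coe_coe] at this
    rw [rep_unit hA]
    simp [this]
  ξ_corep m := by
    have := hA.isBialgEnd_ξ.map_one
    simp only [LinearEquiv.coe_coe] at this
    rw [corep_unit hA, ap_one, ap_one]
    simp [this]
  isYDElt := by
    rw [rep_unit hA, corep_unit hA]
    refine ⟨by simp, fun a b => by simp [smul_smul, mul_comm], ⟨?_, ?_⟩, ?_⟩
    · simp [Algebra.TensorProduct.one_def]
    · simp [Algebra.TensorProduct.one_def]
    · rw [algHom_comp_const, _root_.map_one, const_one_conv, conv_const_one, conv_const_one,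
        const_one_conv]
      rfl

end Unit

section Dual

variable (M : YDData A)

variable [FiniteDimensional k M.carrier]

/-- The dual of `M`, where `σ` is the antipode (for `M*`) or its inverse (for `*M`). -/
@[reducible]
noncomputable def dualOf (σ : H ≃ₗ[k] H) : YDData A where
  carrier := Module.Dual k M.carrier
  deg := M.deg⁻¹
  ξ := M.ξ.symm.dualMap
  act := M.dualAct
    (autLin (M.deg.snd⁻¹ * M.deg.fst⁻¹) ∘ₗ σ.toLinearMap ∘ₗ A.ξ.symm.toLinearMap)
  coact := M.dualCoact (σ.symm.toLinearMap ∘ₗ A.ξ.toLinearMap)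

variable {M} {σ : H ≃ₗ[k] H}

/-- The `ξ⁻²` and `ξ_H⁻¹` in the formula for the dual action are exactly what makes the untwisted
action a plain transpose. -/
theorem rep_dualOf (hM : M.IsUntwistedYD) (hσ : ∀ h, σ (A.ξ h) = A.ξ (σ h)) :
    (M.dualOf σ).rep = transp ∘ₗ M.rep ∘ₗ
      autLin (M.deg.snd⁻¹ * M.deg.fst⁻¹) ∘ₗ σ.toLinearMap := by
  ext h p m
  obtain ⟨h, rfl⟩ := A.ξ.surjective h
  obtain ⟨m, rfl⟩ := M.ξ.surjective m
  change p (M.act (autLin (M.deg.snd⁻¹ * M.deg.fst⁻¹) (σ (A.ξ.symm (A.ξ h))))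
    (M.ξ.symm (M.ξ.symm (M.ξ (M.ξ m))))) =
      p (M.rep (autLin (M.deg.snd⁻¹ * M.deg.fst⁻¹) (σ (A.ξ h))) (M.ξ m))
  rw [hσ, autLin_ξ, ← hM.ξ_rep, act_eq]
  simp only [LinearEquiv.symm_apply_apply]

theorem corep_dualOf (hM : M.IsUntwistedYD) : (M.dualOf σ).corep = TensorProduct.map (transp)
    σ.symm.toLinearMap M.corep := by
  apply ap_injective
  ext p : 1
  refine (ap_corep_apply (M.dualOf σ) p).trans ?_
  apply (dualTensorHomEquiv k M.carrier H).injective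
  refine ((dualTensorHomEquiv k M.carrier H).apply_symm_apply _).trans ?_
  ext m
  obtain ⟨m, rfl⟩ := M.ξ.surjective m
  refine Eq.trans ?_ (dualTensorHom_ap _ M.corep p (M.ξ m)).symm
  change TensorProduct.lid k H (TensorProduct.map
    ((p ∘ₗ M.ξ.symm.toLinearMap) ∘ₗ M.ξ.toLinearMap ∘ₗ M.ξ.toLinearMap)
      (σ.symm.toLinearMap ∘ₗ A.ξ.toLinearMap) (M.coact (M.ξ m))) = _
  rw [hM.ξ_corep, ← ap_corep_apply]
  generalize ap M.corep m = t
  induction t with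
  | zero => simp
  | add x y hx hy => simp only [map_add, hx, hy]
  | tmul x y => simp

/-- With `κ = β⁻¹α⁻¹` one gets `βκ = α⁻¹` and `ακ = αβ⁻¹α⁻¹`, the components of the inverse degree.
The action uses `σ` and the coaction `σ⁻¹`, which cancel around automorphisms; so one proof serves
both duals. -/
theorem IsUntwistedYD.dualOf (hA : A.IsTwistOf) (hM : M.IsUntwistedYD)
    (hσ : ∀ h, σ (A.ξ h) = A.ξ (σ h)) (hσ' : ∀ (f : A.Aut) h, autLin f (σ h) = σ (autLin f h))
    (hσ'' : IsAntiBialgEnd σ.toLinearMap) : (M.dualOf σ).IsUntwistedYD where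
  ξ_rep h p := by
    rw [rep_dualOf hM hσ]
    ext m
    obtain ⟨m, rfl⟩ := M.ξ.surjective m
    simp [hσ, ← hM.ξ_rep]
  ξ_corep p := by
    have hσ2 : ∀ h, σ.symm (A.ξ h) = A.ξ (σ.symm h) := fun h => σ.injective (by simp [hσ])
    rw [corep_dualOf hM]
    apply (dualTensorHomEquiv k M.carrier H).injective
    ext m
    change dualTensorHom k M.carrier H (ap (TensorProduct.map transp σ.symm.toLinearMap M.corep)
      (p ∘ₗ M.ξ.symm.toLinearMap)) m = dualTensorHom k M.carrier H
        (TensorProduct.map M.ξ.symm.dualMap.toLinearMap A.ξ.toLinearMap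
          (ap (TensorProduct.map transp σ.symm.toLinearMap M.corep) p)) m
    obtain ⟨m, rfl⟩ := M.ξ.surjective m
    have h2 : ∀ t, dualTensorHom k M.carrier H (TensorProduct.map M.ξ.symm.dualMap.toLinearMap
        A.ξ.toLinearMap t) (M.ξ m) = A.ξ (dualTensorHom k M.carrier H t m) := by
      intro t
      induction t with
      | zero => simp
      | add x y hx hy => simp only [map_add, LinearMap.add_apply, hx, hy]
      | tmul x y => simp
    rw [h2, dualTensorHom_ap, dualTensorHom_ap, hM.ξ_corep]
    generalize ap M.corep m = t
    induction t with
    | zero => simp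
    | add x y hx hy => simp only [map_add, hx, hy]
    | tmul x y => simp [hσ2]
  isYDElt := by
    rw [rep_dualOf hM hσ, corep_dualOf hM]
    refine hM.isYDElt.dual (isAntiHom_transp) (hA.isBialgEnd_aut _) hσ'' hσ''.symm ?_ ?_ ?_ ?_
    · rw [← autLin_mul]; congr 1; simp
    · rw [← autLin_mul]; congr 1
    · ext h; simp [hσ']
    · ext h; simp only [LinearMap.comp_apply, LinearEquiv.coe_coe, hσ', σ.symm_apply_apply]

end Dual

end YDData

end MonoidalHomHopf

/-! ### Functoriality and constraints as morphisms, directly from the Hom-axioms. -/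

namespace MonoidalHomHopf

open YetterDrinfeld

section Constraints

variable {k : Type u} {H : Type v} [Field k] [AddCommGroup H] [Module k H]
variable {A : MonoidalHomHopf k H}

namespace YDData

theorem tensorAct_tmul (M N : YDData A) (h : H) (m : M.carrier) (n : N.carrier) :
    M.tensorAct N h (m ⊗ₜ[k] n) = TensorProduct.map (M.act.flip m ∘ₗ autLin N.deg.fst)
      (N.act.flip n ∘ₗ autLin (N.deg.fst⁻¹ * M.deg.snd * N.deg.fst)) (A.comul h) := by
  rw [tensorAct, LinearMap.comp_apply]
  generalize A.comul h = t
  induction t with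
  | zero => simp
  | add x y hx hy => simp only [map_add, LinearMap.add_apply, hx, hy]
  | tmul x y => simp

/-- `(m ⊗ a) ⊗ (n ⊗ b) ↦ (m ⊗ n) ⊗ ba`. -/
def mulComm (A : MonoidalHomHopf k H) (V W : Type*) [AddCommGroup V] [Module k V]
    [AddCommGroup W] [Module k W] : (V ⊗[k] H) ⊗[k] (W ⊗[k] H) →ₗ[k] (V ⊗[k] W) ⊗[k] H :=
  (TensorProduct.lift A.mul.flip).lTensor (V ⊗[k] W) ∘ₗ
    (TensorProduct.tensorTensorTensorComm k V H W H).toLinearMap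

@[simp] theorem mulComm_tmul {V W : Type*} [AddCommGroup V] [Module k V]
    [AddCommGroup W] [Module k W] (v : V) (a : H) (w : W) (b : H) :
    mulComm A V W ((v ⊗ₜ[k] a) ⊗ₜ[k] (w ⊗ₜ[k] b)) = (v ⊗ₜ[k] w) ⊗ₜ[k] A.mul b a := rfl

theorem tensorCoact_tmul (M N : YDData A) (m : M.carrier) (n : N.carrier) :
    M.tensorCoact N (m ⊗ₜ[k] n) = mulComm A _ _ (M.coact m ⊗ₜ[k] N.coact n) := rfl

theorem comul_autLin (f : A.Aut) (h : H) :
    A.comul (autLin f h) = TensorProduct.map (autLin f) (autLin f) (A.comul h) := f.2.2.2.2.1 h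

theorem counit_autLin (f : A.Aut) (h : H) : A.counit (autLin f h) = A.counit h :=
  f.2.2.2.2.2.1 h

theorem IsHom.tensor {M M₂ N N₂ : YDData A} {f : M.carrier →ₗ[k] M₂.carrier}
    {g : N.carrier →ₗ[k] N₂.carrier} (hf : IsHom M M₂ f) (hg : IsHom N N₂ g) :
    IsHom (M.tensor N) (M₂.tensor N₂) (TensorProduct.map f g) where
  deg_eq := by
    change M.deg * N.deg = M₂.deg * N₂.deg
    rw [hf.deg_eq, hg.deg_eq]
  map_ξ := by
    intro (x : M.carrier ⊗[k] N.carrier)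
    change TensorProduct.map f g (TensorProduct.congr M.ξ N.ξ x) =
      TensorProduct.congr M₂.ξ N₂.ξ (TensorProduct.map f g x)
    induction x with
    | zero => simp
    | add x y hx hy => simp only [map_add, hx, hy]
    | tmul m n => simp [hf.map_ξ, hg.map_ξ]
  map_act := by
    intro h (x : M.carrier ⊗[k] N.carrier)
    change TensorProduct.map f g (M.tensorAct N h x) =
      M₂.tensorAct N₂ h (TensorProduct.map f g x)
    induction x with
    | zero => simp
    | add x y hx hy => simp only [map_add, hx, hy]
    | tmul m n =>
      rw [tensorAct_tmul, TensorProduct.map_tmul, tensorAct_tmul, hf.deg_eq, hg.deg_eq]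
      generalize A.comul h = t
      induction t with
      | zero => simp
      | add x y hx hy => simp only [map_add, hx, hy]
      | tmul x y => simp [hf.map_act, hg.map_act]
  map_coact := by
    intro (x : M.carrier ⊗[k] N.carrier)
    change M₂.tensorCoact N₂ (TensorProduct.map f g x) =
      (TensorProduct.map f g).rTensor H (M.tensorCoact N x)
    induction x with
    | zero => simp
    | add x y hx hy => simp only [map_add, hx, hy]
    | tmul m n =>
      rw [TensorProduct.map_tmul, tensorCoact_tmul, tensorCoact_tmul, hf.map_coact, hg.map_coact]
      generalize M.coact m = t
      generalize N.coact n = s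
      induction t with
      | zero => simp
      | add x y hx hy => simp only [map_add, TensorProduct.add_tmul, hx, hy]
      | tmul x y =>
        induction s with
        | zero => simp
        | add x y hx hy => simp only [map_add, TensorProduct.tmul_add, hx, hy]
        | tmul x y => simp

theorem IsHom.conj (g : A.G) {M N : YDData A} {f : M.carrier →ₗ[k] N.carrier}
    (hf : IsHom M N f) : IsHom (M.conj g) (N.conj g) f where
  deg_eq := by
    change g * M.deg * g⁻¹ = g * N.deg * g⁻¹
    rw [hf.deg_eq]
  map_ξ := hf.map_ξ
  map_act h m := by
    change f (M.act _ m) = N.act _ (f m)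
    rw [hf.map_act, hf.deg_eq]
  map_coact m := by
    change (autLin _).lTensor _ (N.coact (f m)) = f.rTensor H ((autLin _).lTensor _ (M.coact m))
    rw [hf.map_coact, lTensor_rTensor]

theorem IsYD.leftUnitor {M : YDData A} (hM : M.IsYD) :
    IsHom ((unit A).tensor M) M (YDData.leftUnitor M).toLinearMap where
  deg_eq := _root_.one_mul _
  map_ξ := by
    intro (x : k ⊗[k] M.carrier)
    change M.ξ (TensorProduct.lid k _ (TensorProduct.congr (LinearEquiv.refl k k) M.ξ x)) =
      M.ξ (M.ξ (TensorProduct.lid k _ x))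
    induction x with
    | zero => simp
    | add x y hx hy => simp only [map_add, hx, hy]
    | tmul m n => simp
  map_act := by
    intro h (x : k ⊗[k] M.carrier)
    change M.ξ (TensorProduct.lid k _ ((unit A).tensorAct M h x)) =
      M.act h (M.ξ (TensorProduct.lid k _ x))
    induction x with
    | zero => simp
    | add x y hx hy => simp only [map_add, hx, hy]
    | tmul x m =>
      have h1 : TensorProduct.lid k _ ((unit A).tensorAct M h (x ⊗ₜ[k] m)) =
          x • M.act (TensorProduct.lid k H (A.counit.rTensor H (A.comul h))) m := by
        refine (congrArg _ (tensorAct_tmul _ _ _ _ _)).trans ?_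
        generalize A.comul h = t
        induction t with
        | zero => simp
        | add x y hx hy => simp only [map_add, LinearMap.add_apply, smul_add, hx, hy]
        | tmul a b => simp [counit_autLin, smul_smul, mul_comm]
      rw [h1, A.counit_comul, map_smul, hM.ξ_act]
      simp
  map_coact := by
    intro (x : k ⊗[k] M.carrier)
    change M.coact (M.ξ (TensorProduct.lid k _ x)) =
      (M.ξ.toLinearMap ∘ₗ (TensorProduct.lid k M.carrier).toLinearMap).rTensor H
        ((unit A).tensorCoact M x)
    induction x with
    | zero => simp
    | add x y hx hy => simp only [map_add, hx, hy]
    | tmul x m =>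
      rw [tensorCoact_tmul, hM.coact_ξ, TensorProduct.lid_tmul, map_smul, map_smul]
      change _ = (M.ξ.toLinearMap ∘ₗ (TensorProduct.lid k M.carrier).toLinearMap).rTensor H
        (mulComm A k _ ((x ⊗ₜ[k] A.one) ⊗ₜ[k] M.coact m))
      generalize M.coact m = t
      induction t with
      | zero => simp
      | add x y hx hy => simp only [map_add, smul_add, TensorProduct.tmul_add, hx, hy]
      | tmul a b => simp [A.mul_one, TensorProduct.smul_tmul']

theorem IsYD.rightUnitor {M : YDData A} (hM : M.IsYD) :
    IsHom (M.tensor (unit A)) M (YDData.rightUnitor M).toLinearMap where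
  deg_eq := _root_.mul_one _
  map_ξ := by
    intro (x : M.carrier ⊗[k] k)
    change M.ξ (TensorProduct.rid k _ (TensorProduct.congr M.ξ (LinearEquiv.refl k k) x)) =
      M.ξ (M.ξ (TensorProduct.rid k _ x))
    induction x with
    | zero => simp
    | add x y hx hy => simp only [map_add, hx, hy]
    | tmul m n => simp
  map_act := by
    intro h (x : M.carrier ⊗[k] k)
    change M.ξ (TensorProduct.rid k _ (M.tensorAct (unit A) h x)) =
      M.act h (M.ξ (TensorProduct.rid k _ x))
    induction x with
    | zero => simp
    | add x y hx hy => simp only [map_add, hx, hy]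
    | tmul m x =>
      have h1 : TensorProduct.rid k _ (M.tensorAct (unit A) h (m ⊗ₜ[k] x)) =
          x • M.act (TensorProduct.rid k H (A.counit.lTensor H (A.comul h))) m := by
        refine (congrArg _ (tensorAct_tmul _ _ _ _ _)).trans ?_
        generalize A.comul h = t
        induction t with
        | zero => simp
        | add x y hx hy => simp only [map_add, LinearMap.add_apply, smul_add, hx, hy]
        | tmul a b => simp [counit_autLin, smul_smul, mul_comm]
      rw [h1, A.comul_counit, map_smul, hM.ξ_act]
      simp
  map_coact := by
    intro (x : M.carrier ⊗[k] k)
    change M.coact (M.ξ (TensorProduct.rid k _ x)) =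
      (M.ξ.toLinearMap ∘ₗ (TensorProduct.rid k M.carrier).toLinearMap).rTensor H
        (M.tensorCoact (unit A) x)
    induction x with
    | zero => simp
    | add x y hx hy => simp only [map_add, hx, hy]
    | tmul m x =>
      rw [tensorCoact_tmul, hM.coact_ξ, TensorProduct.rid_tmul, map_smul, map_smul]
      change _ = (M.ξ.toLinearMap ∘ₗ (TensorProduct.rid k M.carrier).toLinearMap).rTensor H
        (mulComm A _ k (M.coact m ⊗ₜ[k] (x ⊗ₜ[k] A.one)))
      generalize M.coact m = t
      induction t with
      | zero => simp
      | add x y hx hy => simp only [map_add, smul_add, TensorProduct.add_tmul, hx, hy]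
      | tmul a b => simp [A.one_mul, TensorProduct.smul_tmul']

theorem IsYD.ξ_symm_act {M : YDData A} (hM : M.IsYD) (h : H) (m : M.carrier) :
    M.ξ.symm (M.act h m) = M.act (A.ξ.symm h) (M.ξ.symm m) :=
  M.ξ.injective (by rw [hM.ξ_act]; simp)

theorem IsYD.coact_ξ_symm {M : YDData A} (hM : M.IsYD) (m : M.carrier) :
    M.coact (M.ξ.symm m) =
      TensorProduct.map M.ξ.symm.toLinearMap A.ξ.symm.toLinearMap (M.coact m) := by
  obtain ⟨m, rfl⟩ := M.ξ.surjective m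
  rw [hM.coact_ξ, M.ξ.symm_apply_apply, ← LinearMap.comp_apply (TensorProduct.map _ _),
    ← TensorProduct.map_comp]
  simp

/-- The `ξ_M` and `ξ_P⁻¹` of the constraint compensate the `ξ`'s in the Hom-axioms of `H`:
coassociativity gives linearity, associativity gives colinearity. -/
theorem isHom_assoc {M N P : YDData A} (hM : M.IsYD) (hP : P.IsYD) :
    IsHom ((M.tensor N).tensor P) (M.tensor (N.tensor P)) (YDData.assoc M N P).toLinearMap where
  deg_eq := _root_.mul_assoc _ _ _
  map_ξ := by
    intro (x : (M.carrier ⊗[k] N.carrier) ⊗[k] P.carrier)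
    change YDData.assoc M N P (TensorProduct.congr (TensorProduct.congr M.ξ N.ξ) P.ξ x) =
      TensorProduct.congr M.ξ (TensorProduct.congr N.ξ P.ξ) (YDData.assoc M N P x)
    induction x with
    | zero => simp
    | add x y hx hy => simp only [map_add, hx, hy]
    | tmul x p =>
      induction x with
      | zero => simp
      | add x y hx hy => simp only [map_add, TensorProduct.add_tmul, hx, hy]
      | tmul m n => simp [YDData.assoc]
  map_act := by
    intro h (x : (M.carrier ⊗[k] N.carrier) ⊗[k] P.carrier)
    change YDData.assoc M N P ((M.tensor N).tensorAct P h x) =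
      M.tensorAct (N.tensor P) h (YDData.assoc M N P x)
    induction x with
    | zero => simp
    | add x y hx hy => simp only [map_add, hx, hy]
    | tmul x p =>
      induction x with
      | zero => simp
      | add x y hx hy => simp only [map_add, TensorProduct.add_tmul, hx, hy]
      | tmul m n =>
        -- Both sides are values of the same `F` on the two iterated coproducts of `h`;
        -- `A.comul_coassoc` then identifies the arguments.
        let F : H ⊗[k] (H ⊗[k] H) →ₗ[k] M.carrier ⊗[k] (N.carrier ⊗[k] P.carrier) :=
          TensorProduct.map (M.act.flip (M.ξ m) ∘ₗ autLin (N.deg.fst * P.deg.fst))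
            (TensorProduct.map
              (N.act.flip n ∘ₗ autLin (N.deg.fst⁻¹ * M.deg.snd * N.deg.fst * P.deg.fst))
              (P.act.flip (P.ξ.symm p) ∘ₗ autLin (P.deg.fst⁻¹ *
                (N.deg.snd * N.deg.fst⁻¹ * M.deg.snd * N.deg.fst) * P.deg.fst)))
        have h1 : ∀ t : H ⊗[k] H, YDData.assoc M N P
            (TensorProduct.map ((M.tensor N).act.flip (m ⊗ₜ[k] n) ∘ₗ autLin P.deg.fst)
              (P.act.flip p ∘ₗ autLin (P.deg.fst⁻¹ * (M.tensor N).deg.snd * P.deg.fst)) t) =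
            F (A.ξ.toLinearMap.rTensor _ (TensorProduct.assoc k H H H
              (TensorProduct.map A.comul A.ξ.symm.toLinearMap t))) := by
          intro t
          induction t with
          | zero => simp
          | add x y hx hy => simp only [map_add, hx, hy]
          | tmul x y =>
            simp only [TensorProduct.map_tmul, LinearMap.comp_apply, LinearMap.flip_apply]
            rw [show (M.tensor N).act (autLin P.deg.fst x) (m ⊗ₜ[k] n) = _ from
              tensorAct_tmul _ _ _ _ _, comul_autLin]
            generalize A.comul x = s
            induction s with
            | zero => simp
            | add x y hx hy => simp only [map_add, TensorProduct.add_tmul, hx, hy]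
            | tmul a b => simp [F, YDData.assoc, hM.ξ_act, hP.ξ_symm_act]
        have h2 : ∀ t : H ⊗[k] H,
            TensorProduct.map (M.act.flip (M.ξ m) ∘ₗ autLin (N.tensor P).deg.fst)
              ((N.tensor P).act.flip (n ⊗ₜ[k] P.ξ.symm p) ∘ₗ autLin ((N.tensor P).deg.fst⁻¹ *
                M.deg.snd * (N.tensor P).deg.fst)) t =
            F (A.comul.lTensor _ t) := by
          intro t
          induction t with
          | zero => simp
          | add x y hx hy => simp only [map_add, hx, hy]
          | tmul x y =>
            simp only [TensorProduct.map_tmul, LinearMap.comp_apply, LinearMap.flip_apply,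
              LinearMap.lTensor_tmul]
            rw [show (N.tensor P).act _ (n ⊗ₜ[k] P.ξ.symm p) = _ from
              tensorAct_tmul _ _ _ _ _, comul_autLin]
            generalize A.comul y = s
            induction s with
            | zero => simp
            | add x y hx hy => simp only [map_add, TensorProduct.tmul_add, hx, hy]
            | tmul a b => simp [F]
        refine (congrArg _ (tensorAct_tmul _ _ _ _ _)).trans ((h1 _).trans ?_)
        refine Eq.trans ?_ ((tensorAct_tmul M (N.tensor P) h (M.ξ m) (n ⊗ₜ P.ξ.symm p)).trans
          (h2 _)).symm
        rw [← A.comul_coassoc]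
        congr 1
        generalize A.comul h = t
        induction t with
        | zero => simp
        | add x y hx hy => simp only [map_add, hx, hy]
        | tmul a b => simp
  map_coact := by
    intro (x : (M.carrier ⊗[k] N.carrier) ⊗[k] P.carrier)
    change M.tensorCoact (N.tensor P) (YDData.assoc M N P x) =
      (YDData.assoc M N P).toLinearMap.rTensor H ((M.tensor N).tensorCoact P x)
    induction x with
    | zero => simp
    | add x y hx hy => simp only [map_add, hx, hy]
    | tmul x p =>
      induction x with
      | zero => simp
      | add x y hx hy => simp only [map_add, TensorProduct.add_tmul, hx, hy]
      | tmul m n =>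
        refine (tensorCoact_tmul M (N.tensor P) (M.ξ m) (n ⊗ₜ P.ξ.symm p)).trans ?_
        refine Eq.trans ?_ (congrArg _ (tensorCoact_tmul (M.tensor N) P (m ⊗ₜ n) p)).symm
        change mulComm A _ _ (M.coact (M.ξ m) ⊗ₜ mulComm A _ _
          (N.coact n ⊗ₜ P.coact (P.ξ.symm p))) = (YDData.assoc M N P).toLinearMap.rTensor H
            (mulComm A (M.carrier ⊗[k] N.carrier) _
              (mulComm A _ _ (M.coact m ⊗ₜ N.coact n) ⊗ₜ P.coact p))
        rw [hM.coact_ξ, hP.coact_ξ_symm]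
        generalize M.coact m = s
        generalize N.coact n = t
        generalize P.coact p = r
        induction s with
        | zero => simp
        | add x y hx hy => simp only [map_add, TensorProduct.add_tmul, hx, hy]
        | tmul a b =>
          induction t with
          | zero => simp
          | add x y hx hy =>
            simp only [map_add, TensorProduct.add_tmul, TensorProduct.tmul_add, hx, hy]
          | tmul c d =>
            induction r with
            | zero => simp
            | add x y hx hy => simp only [map_add, TensorProduct.tmul_add, hx, hy]
            | tmul e f =>
              simp only [TensorProduct.map_tmul, LinearEquiv.coe_coe, mulComm_tmul,
                LinearMap.rTensor_tmul]
              rw [← A.mul_assoc, A.ξ.apply_symm_apply]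
              rfl

end YDData

end Constraints

end MonoidalHomHopf

/-! ### The flip of tensor factors, and the braiding as a morphism. -/

namespace YetterDrinfeld

section

variable {k H E E' M N : Type*} [Field k] [Ring H] [HopfAlgebra k H] [Ring E] [Algebra k E]
  [Ring E'] [Algebra k E'] [AddCommGroup M] [Module k M] [AddCommGroup N] [Module k N]

theorem ap_inl_mul {B : Type*} [Ring B] [Algebra k B] (T : Module.End k M ⊗[k] B)
    (f : Module.End k M) (m : M) : ap (inl k _ B f * T) m = f.rTensor B (ap T m) := by
  induction T with
  | zero => simp
  | add x y hx hy => simp only [map_add, mul_add, LinearMap.add_apply, hx, hy]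
  | tmul x y => simp

theorem endMap_comm (X : Module.End k M ⊗[k] Module.End k N) (x : M ⊗[k] N) :
    TensorProduct.comm k M N (endMap X x) =
      endMap (TensorProduct.comm k _ _ X) (TensorProduct.comm k M N x) := by
  induction X with
  | zero => simp
  | add x y hx hy => simp only [map_add, LinearMap.add_apply, hx, hy]
  | tmul f g =>
    induction x with
    | zero => simp
    | add x y hx hy => simp only [map_add, hx, hy]
    | tmul m n => simp

theorem endMap_endMap (X Y : Module.End k M ⊗[k] Module.End k N) (x : M ⊗[k] N) :
    endMap X (endMap Y x) = endMap (X * Y) x := by rw [_root_.map_mul]; rfl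

theorem ap_endMap_inl_mul (X : Module.End k M ⊗[k] Module.End k N)
    (T : (Module.End k M ⊗[k] Module.End k N) ⊗[k] H) (x : M ⊗[k] N) :
    ap (endMap.toLinearMap.rTensor H (inl k _ H X * T)) x =
      (endMap X).rTensor H (ap (endMap.toLinearMap.rTensor H T) x) :=
  (congrArg (fun z => ap z x)
    (map_mul (Algebra.TensorProduct.map endMap (AlgHom.id k H)) (inl k _ H X) T)).trans
      (ap_inl_mul _ (endMap X) x)

theorem ap_endMap_mul_inl (X : Module.End k M ⊗[k] Module.End k N)
    (T : (Module.End k M ⊗[k] Module.End k N) ⊗[k] H) (x : M ⊗[k] N) :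
    ap (endMap.toLinearMap.rTensor H (T * inl k _ H X)) x =
      ap (endMap.toLinearMap.rTensor H T) (endMap X x) :=
  (congrArg (fun z => ap z x)
    (map_mul (Algebra.TensorProduct.map endMap (AlgHom.id k H)) T (inl k _ H X))).trans
      (ap_mul_inl _ (endMap X) x)

theorem inr_conv_inl (f : H →ₗ[k] E) (g : H →ₗ[k] E') (h : H) :
    conv ((inr k E' E).toLinearMap ∘ₗ f) ((inl k E' E).toLinearMap ∘ₗ g) h =
      TensorProduct.comm k E E' (TensorProduct.map f g (Coalgebra.comul h)) := by
  rw [conv_apply]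
  generalize Coalgebra.comul (R := k) h = t
  induction t with
  | zero => simp
  | add x y hx hy => simp only [map_add, hx, hy]
  | tmul x y => simp

theorem inl_conv_inr (f : H →ₗ[k] E) (g : H →ₗ[k] E') (h : H) :
    conv ((inl k E E').toLinearMap ∘ₗ f) ((inr k E E').toLinearMap ∘ₗ g) h =
      TensorProduct.map f g (Coalgebra.comul h) := by
  rw [← map_comp_comul]; rfl

/-- The coaction on `M ⊗ N` after exchanging the factors. -/
theorem ap_tensor_comm (T : Module.End k M ⊗[k] H) (T' : Module.End k N ⊗[k] H) (x : M ⊗[k] N) :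
    (TensorProduct.comm k M N).toLinearMap.rTensor H (ap (endMap.toLinearMap.rTensor H
      ((inr k (Module.End k M) (Module.End k N)).toLinearMap.rTensor H T' *
        (inl k (Module.End k M) (Module.End k N)).toLinearMap.rTensor H T)) x) =
    ap (endMap.toLinearMap.rTensor H
      ((inl k (Module.End k N) (Module.End k M)).toLinearMap.rTensor H T' *
        (inr k (Module.End k N) (Module.End k M)).toLinearMap.rTensor H T))
          (TensorProduct.comm k M N x) := by
  induction x with
  | zero => simp
  | add x y hx hy => simp only [map_add, hx, hy]
  | tmul m n =>
    induction T with
    | zero => simp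
    | add x y hx hy => simp only [map_add, mul_add, LinearMap.add_apply, hx, hy]
    | tmul x y =>
      induction T' with
      | zero => simp
      | add x y hx hy => simp only [map_add, add_mul, LinearMap.add_apply, hx, hy]
      | tmul x y => simp

/-- Colinearity of the braiding, with the legs reassociated. -/
theorem IsYDElt.braid_coact' {α β b : H →ₗ[k] H} {π : H →ₗ[k] E} {T : E ⊗[k] H}
    {T' : E' ⊗[k] H} (h : IsYDElt α β π T) (hT' : IsCorep T') (hb : IsBialgEnd b)
    (hβ : β ∘ₗ b = LinearMap.id) :
    inl k (E' ⊗[k] E) H ((π ∘ₗ b).lTensor E' T') *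
        ((inl k E' E).toLinearMap.rTensor H T' * (inr k E' E).toLinearMap.rTensor H T) =
      (inr k E' E).toLinearMap.rTensor H T *
        (inl k E' E).toLinearMap.rTensor H ((α ∘ₗ b).lTensor E' T') *
          inl k (E' ⊗[k] E) H ((π ∘ₗ b).lTensor E' T') := by
  have h1 := congrArg (Algebra.TensorProduct.assoc k k k E' E H).symm
    (h.braid_coact hT' hb hβ)
  simp only [_root_.map_mul] at h1
  have e1 : ∀ f : H →ₗ[k] E, (Algebra.TensorProduct.assoc k k k E' E H).symm
      (((inl k E H).toLinearMap ∘ₗ f).lTensor E' T') =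
        inl k (E' ⊗[k] E) H (f.lTensor E' T') := by
    intro f
    generalize T' = t
    induction t with
    | zero => simp
    | add x y hx hy => simp only [map_add, hx, hy]
    | tmul x y => simp
  have e2 : ∀ f : H →ₗ[k] H, (Algebra.TensorProduct.assoc k k k E' E H).symm
      (((inr k E H).toLinearMap ∘ₗ f).lTensor E' T') =
        (inl k E' E).toLinearMap.rTensor H (f.lTensor E' T') := by
    intro f
    generalize T' = t
    induction t with
    | zero => simp
    | add x y hx hy => simp only [map_add, hx, hy]
    | tmul x y => simp
  have e3 : (Algebra.TensorProduct.assoc k k k E' E H).symm (inr k E' (E ⊗[k] H) T) =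
      (inr k E' E).toLinearMap.rTensor H T := by
    generalize T = t
    induction t with
    | zero => simp
    | add x y hx hy => simp only [map_add, hx, hy]
    | tmul x y => simp
  have e4 := e2 LinearMap.id
  rw [LinearMap.comp_id, LinearMap.lTensor_id, LinearMap.id_apply] at e4
  rw [e1, e2, e3, e4, ← mul_assoc ((inr k E' E).toLinearMap.rTensor H T)] at h1
  exact h1

end

end YetterDrinfeld

namespace MonoidalHomHopf

open YetterDrinfeld

variable {k : Type u} {H : Type v} [Field k] [Ring H] [HopfAlgebra k H]
variable {A : MonoidalHomHopf k H}

namespace YDData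

section Braid

variable (M N : YDData A) [FiniteDimensional k M.carrier] [FiniteDimensional k N.carrier]

/-- The element `∑ T⁰ ⊗ π(β⁻¹(T¹))` of `End(N) ⊗ End(M)`. -/
noncomputable def braidElt : Module.End k N.carrier ⊗[k] Module.End k M.carrier :=
  (M.rep ∘ₗ autLin M.deg.snd⁻¹).lTensor _ N.corep

variable {M N}

/-- The `ξ_N` and `ξ_M⁻¹` in the Hom-braiding cancel against the shifts in action and coaction,
leaving the ordinary braiding `n₀ ⊗ β⁻¹(n₁)m`. -/
theorem braidLin_tmul (hM : M.IsUntwistedYD) (hN : N.IsUntwistedYD) (m : M.carrier)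
    (n : N.carrier) : braidLin M N (m ⊗ₜ[k] n) =
      TensorProduct.map LinearMap.id (M.rep.flip m ∘ₗ autLin M.deg.snd⁻¹) (ap N.corep n) := by
  change TensorProduct.map N.ξ.toLinearMap (M.act.flip (M.ξ.symm m) ∘ₗ autLin (M.deg.snd⁻¹))
    (N.coact n) = _
  obtain ⟨n, rfl⟩ := N.ξ.surjective n
  obtain ⟨m, rfl⟩ := M.ξ.surjective m
  rw [← ap_corep_apply, hN.ξ_corep]
  generalize ap N.corep n = t
  induction t with
  | zero => simp
  | add x y hx hy => simp only [map_add, hx, hy]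
  | tmul x y => simp [act_eq, hM.ξ_rep]

theorem braidLin_eq (hM : M.IsUntwistedYD) (hN : N.IsUntwistedYD)
    (x : M.carrier ⊗[k] N.carrier) :
    braidLin M N x = endMap (braidElt M N) (TensorProduct.comm k _ _ x) := by
  induction x with
  | zero => simp
  | add x y hx hy => simp only [map_add, hx, hy]
  | tmul m n =>
    rw [braidLin_tmul hM hN, braidElt]
    generalize N.corep = T
    induction T with
    | zero => simp
    | add x y hx hy => simp only [map_add, LinearMap.add_apply, hx, hy]
    | tmul x y => simp

theorem braidLin_ξ (hM : M.IsUntwistedYD) (hN : N.IsUntwistedYD) (x : M.carrier ⊗[k] N.carrier) :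
    braidLin M N (TensorProduct.congr M.ξ N.ξ x) =
      TensorProduct.congr N.ξ M.ξ (braidLin M N x) := by
  induction x with
  | zero => simp
  | add x y hx hy => simp only [map_add, hx, hy]
  | tmul m n =>
    rw [TensorProduct.congr_tmul, braidLin_tmul hM hN, braidLin_tmul hM hN, hN.ξ_corep]
    generalize ap N.corep n = t
    induction t with
    | zero => simp
    | add x y hx hy => simp only [map_add, hx, hy]
    | tmul x y => simp [hM.ξ_rep]

/-- The compatibility of `N` is used with `b = β⁻¹` and `ψ = γ⁻¹βγ`: then `bγψ = γ`, as needed on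
the source, and `bδψ` is the automorphism through which the target acts on `M`. -/
theorem braidLin_rep (hA : A.IsTwistOf) (hM : M.IsUntwistedYD) (hN : N.IsUntwistedYD) (h : H)
    (x : M.carrier ⊗[k] N.carrier) :
    braidLin M N ((M.tensor N).rep h x) =
      ((N.conj M.deg).tensor M).rep h (braidLin M N x) := by
  obtain ⟨h, rfl⟩ := A.ξ.surjective h
  refine (congrArg _ (rep_tensor_apply M N hA h x)).trans ?_
  refine Eq.trans ?_ (rep_tensor_apply (N.conj M.deg) M hA h (braidLin M N x)).symm
  rw [braidLin_eq hM hN, braidLin_eq hM hN, endMap_comm]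
  rw [endMap_endMap]
  refine Eq.trans (congrArg (fun z => endMap z _) ?_) (endMap_endMap _ _ _).symm
  have h1 := LinearMap.congr_fun (hN.isYDElt.braid_act hM.isYDElt.map_one hM.isYDElt.map_mul
    (hA.isBialgEnd_aut M.deg.snd⁻¹)
    (hA.isBialgEnd_aut (N.deg.fst⁻¹ * M.deg.snd * N.deg.fst)) (γ' := autLin N.deg.fst)
    (δ' := autLin (M.deg.fst⁻¹ * (N.conj M.deg).deg.snd * M.deg.fst)) ?_ ?_) h
  · rw [const_conv, conv_const, LinearMap.comp_apply, LinearMap.comp_apply,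
      inr_conv_inl, inl_conv_inr] at h1
    refine h1.trans ?_
    rw [rep_conj, LinearMap.comp_assoc, ← autLin_mul, inv_mul_cancel_right]
    rfl
  · rw [← autLin_mul, ← autLin_mul]; congr 1; group
  · rw [← autLin_mul, ← autLin_mul]; congr 1
    simp only [G.mul_snd, G.inv_snd, G.inv_fst]; group

/-- The compatibility of `M`, evaluated along the coaction of `N` after `β⁻¹`, produces the factor
`αβ⁻¹` on that coaction, which is the coaction of the conjugate of `N`. -/
theorem braidLin_corep (hA : A.IsTwistOf) (hM : M.IsUntwistedYD) (hN : N.IsUntwistedYD)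
    (x : M.carrier ⊗[k] N.carrier) :
    ap ((N.conj M.deg).tensor M).corep (braidLin M N x) =
      (braidLin M N).rTensor H (ap (M.tensor N).corep x) := by
  rw [corep_tensor M N hA, corep_tensor (N.conj M.deg) M hA]
  refine (ap_lTensor _ _ _).trans (Eq.trans ?_ (congrArg _ (ap_lTensor _ _ _).symm))
  refine Eq.trans (congrArg _ ?_) (lTensor_rTensor _ _ _)
  rw [corep_conj, braidLin_eq hM hN]
  have h1 := hM.isYDElt.braid_coact' hN.isYDElt.corep (hA.isBialgEnd_aut M.deg.snd⁻¹) (by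
    rw [← autLin_mul, mul_inv_cancel, autLin_one])
  have h2 := congrArg (fun z => ap (endMap.toLinearMap.rTensor H z)
    (TensorProduct.comm k _ _ x)) h1
  simp only [ap_endMap_inl_mul, ap_endMap_mul_inl] at h2
  rw [← ap_tensor_comm, ← autLin_mul] at h2
  refine h2.symm.trans ?_
  rw [← LinearMap.comp_apply, ← LinearMap.rTensor_comp]
  congr 2
  exact (LinearMap.ext (braidLin_eq hM hN)).symm

theorem IsHom.of_untwisted {M N : YDData A} [FiniteDimensional k M.carrier]
    [FiniteDimensional k N.carrier] {f : M.carrier →ₗ[k] N.carrier} (h1 : M.deg = N.deg)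
    (h2 : ∀ m, f (M.ξ m) = N.ξ (f m)) (h3 : ∀ h m, f (M.rep h m) = N.rep h (f m))
    (h4 : ∀ m, ap N.corep (f m) = f.rTensor H (ap M.corep m)) : IsHom M N f where
  deg_eq := h1
  map_ξ := h2
  map_act h m := by rw [act_eq, h2, h3, act_eq]
  map_coact m := by
    obtain ⟨m, rfl⟩ := M.ξ.surjective m
    rw [h2, ← ap_corep_apply, ← ap_corep_apply, h4]

theorem isHom_braid (hA : A.IsTwistOf) (hM : M.IsUntwistedYD) (hN : N.IsUntwistedYD) :
    IsHom (M.tensor N) ((N.conj M.deg).tensor M) (braid M N) :=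
  IsHom.of_untwisted (by
    change M.deg * N.deg = M.deg * N.deg * M.deg⁻¹ * M.deg
    group) (braidLin_ξ hM hN) (braidLin_rep hA hM hN) (braidLin_corep hA hM hN)

end Braid

end YDData

end MonoidalHomHopf

/-! ### Evaluation and coevaluation against representations and corepresentations. -/

namespace YetterDrinfeld

section Duality

variable {k H M : Type*} [Field k] [Ring H] [HopfAlgebra k H] [AddCommGroup M] [Module k M]

theorem dualTensorHom_coevaluation [FiniteDimensional k M] (x : k) :
    dualTensorHom k M M (TensorProduct.comm k _ _ (coevaluation k M x)) = x • LinearMap.id := by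
  have h1 : coevaluation k M x = x • coevaluation k M 1 := by
    rw [← map_smul, smul_eq_mul, mul_one]
  rw [h1, map_smul, map_smul, coevaluation_apply_one]
  congr 1
  ext m
  simp only [map_sum, TensorProduct.comm_tmul, LinearMap.sum_apply, dualTensorHom_apply]
  exact (Module.Basis.ofVectorSpace k M).sum_repr m

/-- Under `M ⊗ M* ≅ End(M)` the operator `f ⊗ gᵗ` is `z ↦ f z g` and the coevaluation is a multiple
of the identity; so a transpose slides over to the first factor. -/
theorem endMap_tmul_transp_coevaluation [FiniteDimensional k M] (f g : Module.End k M) (x : k) :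
    endMap (f ⊗ₜ[k] transp g) (coevaluation k M x) =
      endMap ((f * g) ⊗ₜ[k] (1 : Module.End k (Module.Dual k M))) (coevaluation k M x) := by
  apply (TensorProduct.comm k _ _).injective
  apply (dualTensorHomEquiv k M M).injective
  change dualTensorHom k M M _ = dualTensorHom k M M _
  have h1 : ∀ (f g : Module.End k M) (z : M ⊗[k] Module.Dual k M), dualTensorHom k M M
      (TensorProduct.comm k _ _ (endMap (f ⊗ₜ[k] transp g) z)) =
        f ∘ₗ dualTensorHom k M M (TensorProduct.comm k _ _ z) ∘ₗ g := by
    intro f g z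
    induction z with
    | zero => simp
    | add x y hx hy => simp only [map_add, LinearMap.add_comp, LinearMap.comp_add, hx, hy]
    | tmul m p => ext; simp
  refine (h1 _ _ _).trans (Eq.trans ?_ (h1 _ 1 _).symm)
  rw [dualTensorHom_coevaluation]
  ext; simp

theorem contractLeft_endMap (f g : H →ₗ[k] Module.End k M) (t : H ⊗[k] H)
    (p : Module.Dual k M) (m : M) :
    contractLeft k M (endMap (TensorProduct.map (transp ∘ₗ f) g t) (p ⊗ₜ[k] m)) =
      p (LinearMap.mul' k _ (TensorProduct.map f g t) m) := by
  induction t with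
  | zero => simp
  | add x y hx hy => simp only [map_add, LinearMap.add_apply, hx, hy]
  | tmul x y => simp

theorem contractRight_endMap (f g : H →ₗ[k] Module.End k M) (t : H ⊗[k] H)
    (p : Module.Dual k M) (m : M) :
    contractRight k M (endMap (TensorProduct.map f (transp ∘ₗ g) t) (m ⊗ₜ[k] p)) =
      p (LinearMap.mul' k _ (TensorProduct.map g f (TensorProduct.comm k H H t)) m) := by
  induction t with
  | zero => simp
  | add x y hx hy => simp only [map_add, LinearMap.add_apply, hx, hy]
  | tmul x y => simp

theorem endMap_coevaluation [FiniteDimensional k M] (f g : H →ₗ[k] Module.End k M)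
    (t : H ⊗[k] H) (x : k) :
    endMap (TensorProduct.map f (transp ∘ₗ g) t) (coevaluation k M x) =
      endMap (LinearMap.mul' k _ (TensorProduct.map f g t) ⊗ₜ[k]
        (1 : Module.End k (Module.Dual k M))) (coevaluation k M x) := by
  induction t with
  | zero => simp
  | add x y hx hy => simp only [map_add, TensorProduct.add_tmul, LinearMap.add_apply, hx, hy]
  | tmul x y => exact endMap_tmul_transp_coevaluation _ _ _

theorem endMap_comm_coevaluation [FiniteDimensional k M] (f g : H →ₗ[k] Module.End k M)
    (t : H ⊗[k] H) (x : k) :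
    endMap (TensorProduct.map (transp ∘ₗ f) g t)
        (TensorProduct.comm k _ _ (coevaluation k M x)) =
      TensorProduct.comm k _ _ (endMap (LinearMap.mul' k _ (TensorProduct.map g f
        (TensorProduct.comm k H H t)) ⊗ₜ[k] (1 : Module.End k (Module.Dual k M)))
          (coevaluation k M x)) := by
  rw [← endMap_coevaluation, endMap_comm]
  congr 1
  induction t with
  | zero => simp
  | add x y hx hy => simp only [map_add, hx, hy]
  | tmul x y => simp

/-- The corepresentation on `V ⊗ W` given by corepresentations `T` and `T'` on `V` and `W`. -/
noncomputable abbrev corepTensor {V W : Type*} [AddCommGroup V] [Module k V] [AddCommGroup W]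
    [Module k W] (T : Module.End k V ⊗[k] H) (T' : Module.End k W ⊗[k] H) :
    Module.End k (V ⊗[k] W) ⊗[k] H :=
  endMap.toLinearMap.rTensor H
    ((inr k (Module.End k V) (Module.End k W)).toLinearMap.rTensor H T' *
      (inl k (Module.End k V) (Module.End k W)).toLinearMap.rTensor H T)

/-- Contraction composes the `End` legs of `T` and `T'`, so everything depends only on `T₁₂T'₁₃`;
for `T = T'` this is `(id ⊗ Δ)T`, and the `H`-legs can be cancelled by an antipode identity. The
three lemmas after it play the same role for the other evaluation and for the coevaluations. -/
theorem contractLeft_corep (f : H →ₗ[k] H) (T T' : Module.End k M ⊗[k] H)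
    (p : Module.Dual k M) (m : M) :
    (contractLeft k M).rTensor H
        (ap (corepTensor (TensorProduct.map transp f T) T') (p ⊗ₜ[k] m)) =
      p.rTensor H (ap ((LinearMap.mul' k H ∘ₗ TensorProduct.map LinearMap.id f ∘ₗ
        (TensorProduct.comm k H H).toLinearMap).lTensor _
          ((inl k H H).toLinearMap.lTensor _ T * (inr k H H).toLinearMap.lTensor _ T')) m) := by
  unfold corepTensor
  induction T with
  | zero => simp
  | add x y hx hy => simp only [map_add, mul_add, add_mul, LinearMap.add_apply, hx, hy]
  | tmul x y =>
    induction T' with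
    | zero => simp
    | add x y hx hy => simp only [map_add, mul_add, add_mul, LinearMap.add_apply, hx, hy]
    | tmul x y => simp

theorem contractRight_corep (f : H →ₗ[k] H) (T T' : Module.End k M ⊗[k] H)
    (p : Module.Dual k M) (m : M) :
    (contractRight k M).rTensor H
        (ap (corepTensor T' (TensorProduct.map transp f T)) (m ⊗ₜ[k] p)) =
      p.rTensor H (ap ((LinearMap.mul' k H ∘ₗ TensorProduct.map f LinearMap.id).lTensor _
          ((inl k H H).toLinearMap.lTensor _ T * (inr k H H).toLinearMap.lTensor _ T')) m) := by
  unfold corepTensor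
  induction T with
  | zero => simp
  | add x y hx hy => simp only [map_add, add_mul, LinearMap.add_apply, hx, hy]
  | tmul x y =>
    induction T' with
    | zero => simp
    | add x y hx hy => simp only [map_add, mul_add, LinearMap.add_apply, hx, hy]
    | tmul x y => simp

theorem coevaluation_corep [FiniteDimensional k M] (f : H →ₗ[k] H)
    (T T' : Module.End k M ⊗[k] H) (x : k) :
    ap (corepTensor T (TensorProduct.map transp f T')) (coevaluation k M x) =
      ap ((endMap.toLinearMap ∘ₗ (inl k _ (Module.End k (Module.Dual k M))).toLinearMap).rTensor H
        ((LinearMap.mul' k H ∘ₗ TensorProduct.map f LinearMap.id ∘ₗ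
          (TensorProduct.comm k H H).toLinearMap).lTensor _
          ((inl k H H).toLinearMap.lTensor _ T * (inr k H H).toLinearMap.lTensor _ T')))
            (coevaluation k M x) := by
  unfold corepTensor
  induction T with
  | zero => simp
  | add x y hx hy => simp only [map_add, mul_add, add_mul, LinearMap.add_apply, hx, hy]
  | tmul x y =>
    induction T' with
    | zero => simp
    | add x y hx hy => simp only [map_add, mul_add, add_mul, LinearMap.add_apply, hx, hy]
    | tmul x y => simp [endMap_tmul_transp_coevaluation]

theorem comm_coevaluation_corep [FiniteDimensional k M] (f : H →ₗ[k] H)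
    (T T' : Module.End k M ⊗[k] H) (c : k) :
    ap (corepTensor (TensorProduct.map transp f T') T)
        (TensorProduct.comm k _ _ (coevaluation k M c)) =
      (TensorProduct.comm k _ _).toLinearMap.rTensor H
      (ap ((endMap.toLinearMap ∘ₗ (inl k _ (Module.End k (Module.Dual k M))).toLinearMap).rTensor H
        ((LinearMap.mul' k H ∘ₗ TensorProduct.map LinearMap.id f).lTensor _
          ((inl k H H).toLinearMap.lTensor _ T * (inr k H H).toLinearMap.lTensor _ T')))
            (coevaluation k M c)) := by
  unfold corepTensor
  induction T with
  | zero => simp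
  | add x y hx hy => simp only [map_add, add_mul, LinearMap.add_apply, hx, hy]
  | tmul z w =>
    induction T' with
    | zero => simp
    | add x y hx hy => simp only [map_add, mul_add, LinearMap.add_apply, hx, hy]
    | tmul a b =>
      have h1 := endMap_comm (z ⊗ₜ[k] transp a) (coevaluation k M c)
      simp only [TensorProduct.comm_tmul] at h1
      simp [← h1, endMap_tmul_transp_coevaluation]

section

variable {f g : H →ₗ[k] Module.End k M}

theorem contractLeft_endMap_comul (hfg : conv f g = const 1) (h : H)
    (x : Module.Dual k M ⊗[k] M) :
    contractLeft k M (endMap (TensorProduct.map (transp ∘ₗ f) g (Coalgebra.comul h)) x) =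
      Coalgebra.counit (R := k) h • contractLeft k M x := by
  induction x with
  | zero => simp
  | add x y hx hy => simp only [map_add, smul_add, hx, hy]
  | tmul p m => rw [contractLeft_endMap, ← conv_apply, hfg]; simp

theorem contractRight_endMap_comul (hfg : coconv g f = const 1) (h : H)
    (x : M ⊗[k] Module.Dual k M) :
    contractRight k M (endMap (TensorProduct.map f (transp ∘ₗ g) (Coalgebra.comul h)) x) =
      Coalgebra.counit (R := k) h • contractRight k M x := by
  induction x with
  | zero => simp
  | add x y hx hy => simp only [map_add, smul_add, hx, hy]
  | tmul p m => rw [contractRight_endMap, ← coconv_apply, hfg]; simp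

theorem endMap_comul_coevaluation [FiniteDimensional k M] (hfg : conv f g = const 1) (h : H)
    (x : k) :
    endMap (TensorProduct.map f (transp ∘ₗ g) (Coalgebra.comul h)) (coevaluation k M x) =
      coevaluation k M (Coalgebra.counit (R := k) h • x) := by
  rw [endMap_coevaluation, ← conv_apply, hfg, const_apply, ← TensorProduct.smul_tmul',
    ← Algebra.TensorProduct.one_def, map_smul, _root_.map_one, map_smul]
  rfl

theorem endMap_comul_comm_coevaluation [FiniteDimensional k M] (hfg : coconv g f = const 1)
    (h : H) (x : k) :
    endMap (TensorProduct.map (transp ∘ₗ f) g (Coalgebra.comul h))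
        (TensorProduct.comm k _ _ (coevaluation k M x)) =
      TensorProduct.comm k _ _ (coevaluation k M (Coalgebra.counit (R := k) h • x)) := by
  rw [endMap_comm_coevaluation, ← coconv_apply, hfg, const_apply, ← TensorProduct.smul_tmul',
    ← Algebra.TensorProduct.one_def, map_smul, _root_.map_one, map_smul]
  rfl

end

end Duality

end YetterDrinfeld

/-! ### Invertibility of the braiding, and coefficients on the unit object. -/

namespace MonoidalHomHopf

open YetterDrinfeld

variable {k : Type u} {H : Type v} [Field k] [Ring H] [HopfAlgebra k H]
variable {A : MonoidalHomHopf k H}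

namespace YDData

section Braid

variable {M N : YDData A} [FiniteDimensional k M.carrier] [FiniteDimensional k N.carrier]

/-- The flip is followed by `(id ⊗ f)T` for the algebra map `f = π ∘ β⁻¹`, whose two-sided inverse
is `(id ⊗ fS)T`. -/
theorem braidLin_bijective (hA : A.IsTwistOf) (hM : M.IsUntwistedYD) (hN : N.IsUntwistedYD) :
    Function.Bijective (braidLin M N) := by
  let f : H →ₐ[k] Module.End k M.carrier :=
    hM.isYDElt.algHom.comp (hA.isBialgEnd_aut M.deg.snd⁻¹).algHom
  have h1 := hN.isYDElt.corep.lTensor_mul_antipode f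
  have h2 := hN.isYDElt.corep.lTensor_antipode_mul f
  have h3 : ∀ x, endMap (braidElt M N) (endMap
      ((f.toLinearMap ∘ₗ HopfAlgebra.antipode k).lTensor _ N.corep) x) = x := by
    intro x
    rw [endMap_endMap]
    exact (congrArg (fun z => endMap z x) h1).trans (by rw [_root_.map_one]; rfl)
  have h4 : ∀ x, endMap ((f.toLinearMap ∘ₗ HopfAlgebra.antipode k).lTensor _ N.corep)
      (endMap (braidElt M N) x) = x := by
    intro x
    rw [endMap_endMap]
    exact (congrArg (fun z => endMap z x) h2).trans (by rw [_root_.map_one]; rfl)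
  have h5 : ⇑(braidLin M N) = ⇑(endMap (braidElt M N)) ∘ ⇑(TensorProduct.comm k _ _) :=
    funext (braidLin_eq hM hN)
  rw [h5]
  exact (Function.bijective_iff_has_inverse.2 ⟨_, h4, h3⟩).comp (TensorProduct.comm k _ _).bijective

end Braid

section Duality

variable {M : YDData A} [FiniteDimensional k M.carrier]

theorem lTensor_comul_legs (hM : M.IsUntwistedYD) {B : Type*} [Ring B] [Algebra k B]
    {F : H ⊗[k] H →ₗ[k] B} (hF : F ∘ₗ Coalgebra.comul = const 1) :
    F.lTensor _ ((inl k H H).toLinearMap.lTensor _ M.corep *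
      (inr k H H).toLinearMap.lTensor _ M.corep) = 1 := by
  rw [← hM.isYDElt.corep.comul, lTensor_lTensor, hF, hM.isYDElt.corep.lTensor_const_one]

theorem ap_unit_corep [FiniteDimensional k (unit A).carrier] (hA : A.IsTwistOf) (x : k) :
    ap (unit A).corep x = x ⊗ₜ[k] (1 : H) := by rw [corep_unit hA]; rfl

theorem unit_rep_ξ (hA : A.IsTwistOf) (h : H) (x : k) :
    (unit A).rep (A.ξ h) x = Coalgebra.counit (R := k) h • x := by
  have := LinearMap.congr_fun hA.isBialgEnd_ξ.counit_comp h
  simp only [LinearMap.comp_apply, LinearEquiv.coe_coe] at this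
  rw [rep_unit hA, ← this]
  rfl

end Duality

end YDData

end MonoidalHomHopf

/-! ### Evaluations and coevaluations as morphisms. -/

namespace MonoidalHomHopf

open YetterDrinfeld

variable {k : Type u} {H : Type v} [Field k] [Ring H] [HopfAlgebra k H]
variable {A : MonoidalHomHopf k H}

namespace YDData

section Duality

variable {M : YDData A} [FiniteDimensional k M.carrier] {σ : H ≃ₗ[k] H}

theorem rep_dualOf_comp (hM : M.IsUntwistedYD) (hσ : ∀ h, σ (A.ξ h) = A.ξ (σ h))
    (hσ' : ∀ (f : A.Aut) h, autLin f (σ h) = σ (autLin f h)) {f g : A.Aut}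
    (hfg : M.deg.snd⁻¹ * M.deg.fst⁻¹ * f = g) :
    (M.dualOf σ).rep ∘ₗ autLin f = transp ∘ₗ (M.rep ∘ₗ autLin g) ∘ₗ σ.toLinearMap := by
  have h1 : σ.toLinearMap ∘ₗ autLin f = autLin f ∘ₗ σ.toLinearMap :=
    LinearMap.ext fun h => (hσ' f h).symm
  rw [rep_dualOf hM hσ, ← hfg, autLin_mul, LinearMap.comp_assoc, LinearMap.comp_assoc,
    LinearMap.comp_assoc, h1]
  rfl

/-- In this order of the factors both legs act through the same automorphism `β⁻¹`, and in the
opposite order both through `α⁻¹`; only then can the antipode cancel them. -/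
theorem rep_dualOf_tensor (hA : A.IsTwistOf) (hM : M.IsUntwistedYD)
    (hσ : ∀ h, σ (A.ξ h) = A.ξ (σ h)) (hσ' : ∀ (f : A.Aut) h, autLin f (σ h) = σ (autLin f h))
    (h : H) (x : Module.Dual k M.carrier ⊗[k] M.carrier) :
    ((M.dualOf σ).tensor M).rep (A.ξ h) x = endMap (TensorProduct.map
      (transp ∘ₗ (M.rep ∘ₗ autLin M.deg.snd⁻¹) ∘ₗ σ.toLinearMap) (M.rep ∘ₗ autLin M.deg.snd⁻¹)
        (Coalgebra.comul h)) x := by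
  have e1 := rep_dualOf_comp hM hσ hσ' (f := M.deg.fst) (g := M.deg.snd⁻¹) (by group)
  have e2 : M.deg.fst⁻¹ * (M.deg.fst * M.deg.snd⁻¹ * M.deg.fst⁻¹) * M.deg.fst =
    M.deg.snd⁻¹ := by group
  rw [← e1, ← e2]
  exact rep_tensor_apply (M.dualOf σ) M hA h x

theorem rep_tensor_dualOf (hA : A.IsTwistOf) (hM : M.IsUntwistedYD)
    (hσ : ∀ h, σ (A.ξ h) = A.ξ (σ h)) (hσ' : ∀ (f : A.Aut) h, autLin f (σ h) = σ (autLin f h))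
    (h : H) (x : M.carrier ⊗[k] Module.Dual k M.carrier) :
    (M.tensor (M.dualOf σ)).rep (A.ξ h) x = endMap (TensorProduct.map
      (M.rep ∘ₗ autLin M.deg.fst⁻¹) (transp ∘ₗ (M.rep ∘ₗ autLin M.deg.fst⁻¹) ∘ₗ σ.toLinearMap)
        (Coalgebra.comul h)) x := by
  have e1 := rep_dualOf_comp hM hσ hσ' (f := M.deg.fst⁻¹⁻¹ * M.deg.snd * M.deg.fst⁻¹)
    (g := M.deg.fst⁻¹) (by group)
  rw [← e1]
  exact rep_tensor_apply M (M.dualOf σ) hA h x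

theorem ap_corep_dualOf_tensor (hA : A.IsTwistOf) (hM : M.IsUntwistedYD)
    (x : Module.Dual k M.carrier ⊗[k] M.carrier) :
    ap ((M.dualOf σ).tensor M).corep x = A.ξ.toLinearMap.lTensor _
      (ap (corepTensor (TensorProduct.map transp σ.symm.toLinearMap M.corep) M.corep) x) := by
  rw [corep_tensor _ _ hA, corep_dualOf hM]
  exact ap_lTensor _ _ _

theorem ap_corep_tensor_dualOf (hA : A.IsTwistOf) (hM : M.IsUntwistedYD)
    (x : M.carrier ⊗[k] Module.Dual k M.carrier) :
    ap (M.tensor (M.dualOf σ)).corep x = A.ξ.toLinearMap.lTensor _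
      (ap (corepTensor M.corep (TensorProduct.map transp σ.symm.toLinearMap M.corep)) x) := by
  rw [corep_tensor _ _ hA, corep_dualOf hM]
  exact ap_lTensor _ _ _

section

variable {f : H →ₗ[k] H}

theorem contractLeft_ap_corep (hM : M.IsUntwistedYD) (hf : coconv LinearMap.id f = const 1)
    (x : Module.Dual k M.carrier ⊗[k] M.carrier) :
    (contractLeft k M.carrier).rTensor H
        (ap (corepTensor (TensorProduct.map transp f M.corep) M.corep) x) =
      contractLeft k M.carrier x ⊗ₜ[k] (1 : H) := by
  induction x with
  | zero => simp
  | add x y hx hy => simp only [map_add, TensorProduct.add_tmul, hx, hy]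
  | tmul p m =>
    rw [contractLeft_corep, lTensor_comul_legs hM, ap_one]
    · simp
    · rw [← hf]; ext h; exact (coconv_apply _ _ h).symm

theorem contractRight_ap_corep (hM : M.IsUntwistedYD) (hf : conv f LinearMap.id = const 1)
    (x : M.carrier ⊗[k] Module.Dual k M.carrier) :
    (contractRight k M.carrier).rTensor H
        (ap (corepTensor M.corep (TensorProduct.map transp f M.corep)) x) =
      contractRight k M.carrier x ⊗ₜ[k] (1 : H) := by
  induction x with
  | zero => simp
  | add x y hx hy => simp only [map_add, TensorProduct.add_tmul, hx, hy]
  | tmul m p =>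
    rw [contractRight_corep, lTensor_comul_legs hM, ap_one]
    · simp
    · rw [← hf]; rfl

theorem ap_corep_coevaluation (hM : M.IsUntwistedYD) (hf : coconv f LinearMap.id = const 1)
    (x : k) : ap (corepTensor M.corep (TensorProduct.map transp f M.corep))
      (coevaluation k M.carrier x) = coevaluation k M.carrier x ⊗ₜ[k] (1 : H) := by
  rw [coevaluation_corep, lTensor_comul_legs hM]
  · simp only [Algebra.TensorProduct.one_def, LinearMap.rTensor_tmul, LinearMap.comp_apply,
      AlgHom.toLinearMap_apply, ap_tmul]
    rw [_root_.map_one, _root_.map_one]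
    simp
  · rw [← hf]; ext h; exact (coconv_apply _ _ h).symm

theorem ap_corep_comm_coevaluation (hM : M.IsUntwistedYD) (hf : conv LinearMap.id f = const 1)
    (x : k) : ap (corepTensor (TensorProduct.map transp f M.corep) M.corep)
        (TensorProduct.comm k _ _ (coevaluation k M.carrier x)) =
      TensorProduct.comm k _ _ (coevaluation k M.carrier x) ⊗ₜ[k] (1 : H) := by
  rw [comm_coevaluation_corep, lTensor_comul_legs hM]
  · simp only [Algebra.TensorProduct.one_def, LinearMap.rTensor_tmul, LinearMap.comp_apply,
      AlgHom.toLinearMap_apply, ap_tmul]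
    rw [_root_.map_one, _root_.map_one]
    simp
  · rw [← hf]; rfl

end

theorem congr_coevaluation (e : M.carrier ≃ₗ[k] M.carrier) (x : k) :
    TensorProduct.congr e e.symm.dualMap (coevaluation k M.carrier x) =
      coevaluation k M.carrier x := by
  refine (endMap_tmul_transp_coevaluation e.toLinearMap e.symm.toLinearMap x).trans ?_
  have h1 : e.toLinearMap * e.symm.toLinearMap = 1 := LinearMap.ext e.apply_symm_apply
  rw [h1, ← Algebra.TensorProduct.one_def, _root_.map_one]
  rfl

variable [FiniteDimensional k (unit A).carrier]

/-- Linearity is `S(h₁)h₂ = ε(h)1`, and colinearity is `h₂S⁻¹(h₁) = ε(h)1`. -/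
theorem isHom_leftEv (hA : A.IsTwistOf) (hM : M.IsUntwistedYD) :
    IsHom (M.leftDual.tensor M) (unit A) M.leftEv := by
  refine IsHom.of_untwisted (inv_mul_cancel M.deg) ?_ ?_ ?_
  · intro (x : Module.Dual k M.carrier ⊗[k] M.carrier)
    change contractLeft k _ (TensorProduct.congr M.ξ.symm.dualMap M.ξ x) = contractLeft k _ x
    induction x with
    | zero => simp
    | add x y hx hy => simp only [map_add, hx, hy]
    | tmul p m => simp
  · intro h (x : Module.Dual k M.carrier ⊗[k] M.carrier)
    obtain ⟨h, rfl⟩ := A.ξ.surjective h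
    refine (congrArg (contractLeft k _)
      (rep_dualOf_tensor hA hM A.S_ξ autLin_S h x)).trans ?_
    refine Eq.trans ?_ (unit_rep_ξ hA h (contractLeft k _ x)).symm
    refine contractLeft_endMap_comul ?_ h x
    rw [hA.S_eq]
    exact antipode_conv (f := hM.isYDElt.algHom.comp (hA.isBialgEnd_aut M.deg.snd⁻¹).algHom)
  · intro (x : Module.Dual k M.carrier ⊗[k] M.carrier)
    refine (ap_unit_corep hA (contractLeft k _ x)).trans ?_
    refine Eq.trans ?_ (congrArg ((contractLeft k M.carrier).rTensor H)
      (ap_corep_dualOf_tensor (σ := A.S) hA hM x)).symm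
    refine Eq.trans ?_ (lTensor_rTensor _ _ _)
    rw [contractLeft_ap_corep hM]
    · rw [LinearMap.lTensor_tmul]
      exact congrArg (contractLeft k M.carrier x ⊗ₜ[k] ·) hA.isBialgEnd_ξ.map_one.symm
    · exact coconv_antipode_symm hA.S_eq (AlgHom.id k H)

/-- Linearity is `S⁻¹(h₂)h₁ = ε(h)1`, and colinearity is `S(h₁)h₂ = ε(h)1`. -/
theorem isHom_rightEv (hA : A.IsTwistOf) (hM : M.IsUntwistedYD) :
    IsHom (M.tensor M.rightDual) (unit A) M.rightEv := by
  refine IsHom.of_untwisted (mul_inv_cancel M.deg) ?_ ?_ ?_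
  · intro (x : M.carrier ⊗[k] Module.Dual k M.carrier)
    change contractRight k _ (TensorProduct.congr M.ξ M.ξ.symm.dualMap x) = contractRight k _ x
    induction x with
    | zero => simp
    | add x y hx hy => simp only [map_add, hx, hy]
    | tmul p m => simp
  · intro h (x : M.carrier ⊗[k] Module.Dual k M.carrier)
    obtain ⟨h, rfl⟩ := A.ξ.surjective h
    refine (congrArg (contractRight k _)
      (rep_tensor_dualOf hA hM S_symm_ξ autLin_S_symm h x)).trans ?_
    refine Eq.trans ?_ (unit_rep_ξ hA h (contractRight k _ x)).symm
    refine contractRight_endMap_comul ?_ h x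
    exact antipode_symm_coconv hA.S_eq
      (hM.isYDElt.algHom.comp (hA.isBialgEnd_aut M.deg.fst⁻¹).algHom)
  · intro (x : M.carrier ⊗[k] Module.Dual k M.carrier)
    refine (ap_unit_corep hA (contractRight k _ x)).trans ?_
    refine Eq.trans ?_ (congrArg ((contractRight k M.carrier).rTensor H)
      (ap_corep_tensor_dualOf (σ := A.S.symm) hA hM x)).symm
    refine Eq.trans ?_ (lTensor_rTensor _ _ _)
    rw [contractRight_ap_corep hM]
    · rw [LinearMap.lTensor_tmul]
      exact congrArg (contractRight k M.carrier x ⊗ₜ[k] ·) hA.isBialgEnd_ξ.map_one.symm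
    · rw [LinearEquiv.symm_symm, hA.S_eq]
      exact antipode_conv (f := AlgHom.id k H)

/-- Linearity is `h₁S(h₂) = ε(h)1`, and colinearity is `S⁻¹(h₂)h₁ = ε(h)1`. -/
theorem isHom_leftCoev (hA : A.IsTwistOf) (hM : M.IsUntwistedYD) :
    IsHom (unit A) (M.tensor M.leftDual) M.leftCoev := by
  refine IsHom.of_untwisted (mul_inv_cancel M.deg).symm ?_ ?_ ?_
  · intro (x : k)
    exact (congr_coevaluation M.ξ x).symm
  · intro h (x : k)
    obtain ⟨h, rfl⟩ := A.ξ.surjective h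
    refine (congrArg (coevaluation k _) (unit_rep_ξ hA h x)).trans ?_
    refine Eq.trans ?_
      (rep_tensor_dualOf hA hM A.S_ξ autLin_S h (coevaluation k M.carrier x)).symm
    refine (endMap_comul_coevaluation ?_ h x).symm
    rw [hA.S_eq]
    exact conv_antipode (f := hM.isYDElt.algHom.comp (hA.isBialgEnd_aut M.deg.fst⁻¹).algHom)
  · intro (x : k)
    refine (ap_corep_tensor_dualOf (σ := A.S) hA hM (coevaluation k M.carrier x)).trans ?_
    refine Eq.trans ?_ (congrArg ((coevaluation k M.carrier).rTensor H)
      (ap_unit_corep hA x)).symm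
    rw [ap_corep_coevaluation hM]
    · rw [LinearMap.lTensor_tmul]
      exact congrArg (coevaluation k M.carrier x ⊗ₜ[k] ·) hA.isBialgEnd_ξ.map_one
    · exact antipode_symm_coconv hA.S_eq (AlgHom.id k H)

/-- Linearity is `h₂S⁻¹(h₁) = ε(h)1`, and colinearity is `h₁S(h₂) = ε(h)1`. -/
theorem isHom_rightCoev (hA : A.IsTwistOf) (hM : M.IsUntwistedYD) :
    IsHom (unit A) (M.rightDual.tensor M) M.rightCoev := by
  refine IsHom.of_untwisted (inv_mul_cancel M.deg).symm ?_ ?_ ?_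
  · intro (x : k)
    refine Eq.trans ?_ (TensorProduct.map_comm (R := k) _ _ _).symm
    exact congrArg (TensorProduct.comm k _ _) (congr_coevaluation M.ξ x).symm
  · intro h (x : k)
    obtain ⟨h, rfl⟩ := A.ξ.surjective h
    refine (congrArg (fun z => TensorProduct.comm k _ _ (coevaluation k _ z))
      (unit_rep_ξ hA h x)).trans ?_
    refine Eq.trans ?_ (rep_dualOf_tensor hA hM S_symm_ξ autLin_S_symm h
      (TensorProduct.comm k _ _ (coevaluation k M.carrier x))).symm
    refine (endMap_comul_comm_coevaluation ?_ h x).symm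
    exact coconv_antipode_symm hA.S_eq
      (hM.isYDElt.algHom.comp (hA.isBialgEnd_aut M.deg.snd⁻¹).algHom)
  · intro (x : k)
    refine (ap_corep_dualOf_tensor (σ := A.S.symm) hA hM
      (TensorProduct.comm k _ _ (coevaluation k M.carrier x))).trans ?_
    refine Eq.trans ?_ (congrArg (((TensorProduct.comm k M.carrier
      (Module.Dual k M.carrier)).toLinearMap ∘ₗ coevaluation k M.carrier).rTensor H)
        (ap_unit_corep hA x)).symm
    rw [ap_corep_comm_coevaluation hM]
    · rw [LinearMap.lTensor_tmul]
      exact congrArg (TensorProduct.comm k _ _ (coevaluation k M.carrier x) ⊗ₜ[k] ·)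
        hA.isBialgEnd_ξ.map_one
    · rw [LinearEquiv.symm_symm, hA.S_eq]
      exact conv_antipode (f := AlgHom.id k H)

end Duality

end YDData

end MonoidalHomHopf

/-! ### The formulas are well defined; construction of the untwisted Hopf algebra. -/

namespace MonoidalHomHopf

section WellDefined

variable {k : Type u} {H : Type v} [Field k] [Ring H] [HopfAlgebra k H]
variable {A : MonoidalHomHopf k H}

theorem IsTwistOf.wellDefined (hA : A.IsTwistOf) : A.WellDefined := by
  have i1 : FiniteDimensional k (YDData.unit A).carrier :=
    inferInstanceAs (FiniteDimensional k k)
  have hu : ∀ M : A.MHYDfd, M.dat.IsUntwistedYD := fun M => M.obj.isYD.untwist hA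
  have i2 : ∀ M N : A.MHYDfd, FiniteDimensional k (M.dat.tensor N.dat).carrier := fun M N =>
    inferInstanceAs (FiniteDimensional k (M.dat.carrier ⊗[k] N.dat.carrier))
  have i3 : ∀ (g : A.G) (M : A.MHYDfd), FiniteDimensional k (M.dat.conj g).carrier :=
    fun g M => inferInstanceAs (FiniteDimensional k M.dat.carrier)
  have i4 : ∀ (σ : H ≃ₗ[k] H) (M : A.MHYDfd), FiniteDimensional k (M.dat.dualOf σ).carrier :=
    fun σ M => inferInstanceAs (FiniteDimensional k (Module.Dual k M.dat.carrier))
  exact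
    { unit_isYD := (YDData.isUntwistedYD_unit hA).isYD hA
      tensor_isYD := fun M N => ((hu M).tensor hA (hu N)).isYD hA
      conj_isYD := fun g M => ((hu M).conj g hA).isYD hA
      leftDual_isYD := fun M =>
        ((hu M).dualOf hA (σ := A.S) A.S_ξ autLin_S
          (hA.S_eq ▸ YetterDrinfeld.antipode_isAntiBialgEnd)).isYD hA
      rightDual_isYD := fun M =>
        ((hu M).dualOf hA (σ := A.S.symm) S_symm_ξ autLin_S_symm
          (YetterDrinfeld.antipode_symm_isAntiBialgEnd hA.S_eq)).isYD hA
      map_isHom := fun f g => f.isHom.tensor g.isHom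
      conj_isHom := fun g M N f => f.isHom.conj g
      assoc_isHom := fun M N P => YDData.isHom_assoc M.obj.isYD P.obj.isYD
      leftUnitor_isHom := fun M => M.obj.isYD.leftUnitor
      rightUnitor_isHom := fun M => M.obj.isYD.rightUnitor
      braid_isHom := fun M N => YDData.isHom_braid hA (hu M) (hu N)
      leftCoev_isHom := fun M => YDData.isHom_leftCoev hA (hu M)
      leftEv_isHom := fun M => YDData.isHom_leftEv hA (hu M)
      rightCoev_isHom := fun M => YDData.isHom_rightCoev hA (hu M)
      rightEv_isHom := fun M => YDData.isHom_rightEv hA (hu M) }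

end WellDefined

section Untwist

variable {k : Type u} {H : Type v} [Field k] [G0 : AddCommGroup H] [M0 : Module k H]
variable (A : MonoidalHomHopf k H)

theorem ξ_symm_mul (a b : H) : A.ξ.symm (A.mul a b) = A.mul (A.ξ.symm a) (A.ξ.symm b) :=
  A.ξ.injective (by rw [A.ξ_mul]; simp)

/-- The ring with the multiplication `ξ⁻¹(ab)`. -/
@[reducible]
noncomputable def untwistedRing : Ring H where
  __ := G0
  mul a b := A.ξ.symm (A.mul a b)
  one := A.one
  left_distrib a b c := by
    change A.ξ.symm (A.mul a (b + c)) = A.ξ.symm _ + A.ξ.symm _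
    simp
  right_distrib a b c := by
    change A.ξ.symm (A.mul (a + b) c) = A.ξ.symm _ + A.ξ.symm _
    simp
  zero_mul a := by
    change A.ξ.symm (A.mul 0 a) = 0
    simp
  mul_zero a := by
    change A.ξ.symm (A.mul a 0) = 0
    simp
  mul_assoc a b c := by
    change A.ξ.symm (A.mul (A.ξ.symm (A.mul a b)) c) = A.ξ.symm (A.mul a (A.ξ.symm (A.mul b c)))
    -- Two applications of `ξ` turn the claim into Hom-associativity `(ab)ξ(c) = ξ(a)(bc)`.
    apply A.ξ.injective
    apply A.ξ.injective
    simp [A.ξ_mul, A.mul_assoc]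
  one_mul a := by
    change A.ξ.symm (A.mul A.one a) = a
    simp [A.one_mul]
  mul_one a := by
    change A.ξ.symm (A.mul a A.one) = a
    simp [A.mul_one]
  -- The additive structure is kept as given, integer multiples included, so that `A` remains a
  -- structure on the same underlying group.
  zsmul := G0.zsmul
  zsmul_zero' := G0.zsmul_zero'
  zsmul_succ' := G0.zsmul_succ'
  zsmul_neg' := G0.zsmul_neg'
  neg_add_cancel := G0.neg_add_cancel

/-- The algebra structure of the untwisted ring. -/
@[reducible]
noncomputable def untwistedAlgebra : letI := A.untwistedRing; Algebra k H :=
  letI := A.untwistedRing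
  letI : Module k H := M0
  Algebra.ofModule (fun c a b => by
      change A.ξ.symm (A.mul (c • a) b) = c • A.ξ.symm (A.mul a b)
      simp)
    (fun c a b => by
      change A.ξ.symm (A.mul a (c • b)) = c • A.ξ.symm (A.mul a b)
      simp)

/-- The coalgebra with the comultiplication `Δ(ξ(c))`. -/
@[reducible]
noncomputable def untwistedCoalgebra : Coalgebra k H where
  comul := A.comul ∘ₗ A.ξ.toLinearMap
  counit := A.counit
  coassoc := by
    have h1 : ∀ c, TensorProduct.map A.ξ.symm.toLinearMap A.comul (A.comul c) =
      TensorProduct.assoc k H H H (TensorProduct.map A.comul A.ξ.symm.toLinearMap (A.comul c)) :=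
        A.comul_coassoc
    -- Inserting `ξ ⊗ ξ` turns both iterated coproducts into those of the Hom-axiom, which is then
    -- used at `ξ²(c)`.
    have h2 : ∀ t : H ⊗[k] H, (A.comul ∘ₗ A.ξ.toLinearMap).rTensor H t =
        TensorProduct.map A.comul A.ξ.symm.toLinearMap
          (TensorProduct.map A.ξ.toLinearMap A.ξ.toLinearMap t) := by
      intro t
      induction t with
      | zero => simp
      | add x y hx hy => simp only [map_add, hx, hy]
      | tmul x y => simp
    have h3 : ∀ t : H ⊗[k] H, (A.comul ∘ₗ A.ξ.toLinearMap).lTensor H t =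
        TensorProduct.map A.ξ.symm.toLinearMap A.comul
          (TensorProduct.map A.ξ.toLinearMap A.ξ.toLinearMap t) := by
      intro t
      induction t with
      | zero => simp
      | add x y hx hy => simp only [map_add, hx, hy]
      | tmul x y => simp
    ext c : 1
    simp only [LinearMap.comp_apply, h2, h3, LinearEquiv.coe_coe]
    rw [← A.comul_ξ, h1]
  rTensor_counit_comp_comul := by
    ext c : 1
    apply (TensorProduct.lid k H).injective
    simp only [LinearMap.comp_apply, LinearEquiv.coe_coe]
    rw [A.counit_comul]
    simp
  lTensor_counit_comp_comul := by
    ext c : 1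
    apply (TensorProduct.rid k H).injective
    simp only [LinearMap.comp_apply, LinearEquiv.coe_coe]
    rw [A.comul_counit]
    simp

/-- The Hopf algebra from which `A` is obtained by twisting. -/
@[reducible]
noncomputable def untwistedHopfAlgebra : letI := A.untwistedRing; HopfAlgebra k H :=
  letI := A.untwistedRing
  letI := A.untwistedAlgebra
  letI : Coalgebra k H := A.untwistedCoalgebra
  letI : Bialgebra k H := Bialgebra.mk' k H A.counit_one
    (by
      intro a b
      change A.counit (A.ξ.symm (A.mul a b)) = A.counit a * A.counit b
      rw [← A.counit_ξ, A.ξ.apply_symm_apply, A.counit_mul])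
    (by
      change A.comul (A.ξ A.one) = A.one ⊗ₜ[k] A.one
      rw [A.ξ_one, A.comul_one])
    (by
      intro a b
      change A.comul (A.ξ (A.ξ.symm (A.mul a b))) = A.comul (A.ξ a) * A.comul (A.ξ b)
      -- The `ξ⁻¹` of the new product cancels the `ξ`'s on the factors, leaving the product of `A`
      -- on both legs.
      have h1 : ∀ s t : H ⊗[k] H, TensorProduct.map A.ξ.toLinearMap A.ξ.toLinearMap s *
          TensorProduct.map A.ξ.toLinearMap A.ξ.toLinearMap t =
            TensorProduct.map₂ A.mul A.mul s t := by
        intro s t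
        induction s with
        | zero => simp
        | add x y hx hy => simp only [map_add, LinearMap.add_apply, add_mul, hx, hy]
        | tmul x y =>
          induction t with
          | zero => simp
          | add x y hx hy => simp only [map_add, mul_add, hx, hy]
          | tmul z w =>
            simp only [TensorProduct.map_tmul, TensorProduct.map₂_apply_tmul,
              Algebra.TensorProduct.tmul_mul_tmul, LinearEquiv.coe_coe]
            change A.ξ.symm (A.mul _ _) ⊗ₜ[k] A.ξ.symm (A.mul _ _) = _
            simp [ξ_symm_mul]
      rw [A.ξ.apply_symm_apply, A.comul_mul, A.comul_ξ, A.comul_ξ, h1])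
  have h2 : ∀ t : H ⊗[k] H, LinearMap.mul' k H t = A.ξ.symm (TensorProduct.lift A.mul t) := by
    intro t
    induction t with
    | zero => simp
    | add x y hx hy => simp only [map_add, hx, hy]
    | tmul x y => rfl
  have h3 : ∀ c : k, algebraMap k H c = c • A.one := fun c => Algebra.algebraMap_eq_smul_one c
  have h4 : A.ξ.symm A.one = A.one := A.ξ.injective (by rw [A.ξ_one, A.ξ.apply_symm_apply])
  { antipode := A.S.toLinearMap
    mul_antipode_rTensor_comul := by
      ext c
      change LinearMap.mul' k H (A.S.toLinearMap.rTensor H (A.comul (A.ξ c))) =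
        algebraMap k H (A.counit c)
      rw [h2, h3, A.S_mul_id, A.counit_ξ, map_smul, h4]
    mul_antipode_lTensor_comul := by
      ext c
      change LinearMap.mul' k H (A.S.toLinearMap.lTensor H (A.comul (A.ξ c))) =
        algebraMap k H (A.counit c)
      rw [h2, h3, A.id_mul_S, A.counit_ξ, map_smul, h4] }

theorem isTwistOf_untwisted :
    letI := A.untwistedRing
    letI := A.untwistedHopfAlgebra
    A.IsTwistOf :=
  letI := A.untwistedRing
  letI := A.untwistedHopfAlgebra
  { mul_eq := fun _ _ => (A.ξ.apply_symm_apply _).symm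
    one_eq := rfl
    comul_ξ_eq := fun _ => rfl
    counit_eq := rfl
    S_eq := rfl }

/-- The assertion mentions only `A`, so the untwisted Hopf algebra structure can be installed
locally and forgotten again. -/
theorem wellDefined : A.WellDefined :=
  letI := A.untwistedRing
  letI := A.untwistedHopfAlgebra
  A.isTwistOf_untwisted.wellDefined

theorem braidLin_bijective (M N : A.MHYDfd) :
    Function.Bijective (YDData.braidLin M.dat N.dat) :=
  letI := A.untwistedRing
  letI := A.untwistedHopfAlgebra
  YDData.braidLin_bijective A.isTwistOf_untwisted (M.obj.isYD.untwist A.isTwistOf_untwisted)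
    (N.obj.isYD.untwist A.isTwistOf_untwisted)

end Untwist

end MonoidalHomHopf

/-! ### Monoidal laws and strictness of conjugation. -/

namespace MonoidalHomHopf

variable {k : Type u} {H : Type v} [Field k] [AddCommGroup H] [Module k H]
variable {A : MonoidalHomHopf k H}

theorem MHYDfd.hom_ext {M N : A.MHYDfd} {f g : M ⟶ N} (h : f.lin = g.lin) : f = g :=
  MHYD.Hom.ext h

theorem MHYDfd.ext_dat {M N : A.MHYDfd} (h : M.dat = N.dat) : M = N := by
  obtain ⟨⟨M, hM⟩⟩ := M
  obtain ⟨⟨N, hN⟩⟩ := N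
  dsimp only [MHYDfd.dat] at h
  subst h
  rfl

/-- Equal objects that occur below have definitionally equal carriers, so heterogeneous equality of
the underlying maps is really ordinary equality; this disposes of every `eqToHom`. -/
theorem MHYDfd.eq_eqToHom_comp {M M₂ N N₂ : A.MHYDfd} {f : M ⟶ N} {g : M₂ ⟶ N₂} (hM : M = M₂)
    (hN : N₂ = N) (h : HEq f.lin g.lin) : f = eqToHom hM ≫ g ≫ eqToHom hN := by
  subst hM hN
  rw [eqToHom_refl, eqToHom_refl, Category.id_comp, Category.comp_id]
  exact MHYDfd.hom_ext (eq_of_heq h)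

theorem MHYDfd.eq_comp_eqToHom {M N N₂ : A.MHYDfd} {f : M ⟶ N} {g : M ⟶ N₂} (hN : N₂ = N)
    (h : HEq f.lin g.lin) : f = g ≫ eqToHom hN := by
  subst hN
  rw [eqToHom_refl, Category.comp_id]
  exact MHYDfd.hom_ext (eq_of_heq h)

theorem MHYDfd.eq_eqToHom_comp_left {M M₂ N : A.MHYDfd} {f : M ⟶ N} {g : M₂ ⟶ N} (hM : M = M₂)
    (h : HEq f.lin g.lin) : f = eqToHom hM ≫ g := by
  subst hM
  rw [eqToHom_refl, Category.id_comp]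
  exact MHYDfd.hom_ext (eq_of_heq h)

theorem YDData.mk_congr {C : Type u} [AddCommGroup C] [Module k C] {d d₂ : A.G}
    {ξ ξ₂ : C ≃ₗ[k] C} {a a₂ : H →ₗ[k] C →ₗ[k] C} {c c₂ : C →ₗ[k] C ⊗[k] H} (h1 : d = d₂)
    (h2 : ξ = ξ₂) (h3 : a = a₂) (h4 : c = c₂) :
    YDData.mk C d ξ a c = YDData.mk C d₂ ξ₂ a₂ c₂ := by
  subst h1 h2 h3 h4; rfl

theorem YDData.assoc_conj (g : A.G) (M N P : YDData A) :
    (YDData.assoc (M.conj g) (N.conj g) (P.conj g)).toLinearMap =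
      (YDData.assoc M N P).toLinearMap := rfl

theorem YDData.leftUnitor_conj (g : A.G) (M : YDData A) :
    (YDData.leftUnitor (M.conj g)).toLinearMap = (YDData.leftUnitor M).toLinearMap := rfl

theorem YDData.rightUnitor_conj (g : A.G) (M : YDData A) :
    (YDData.rightUnitor (M.conj g)).toLinearMap = (YDData.rightUnitor M).toLinearMap := rfl

namespace WellDefined

variable (W : A.WellDefined)

theorem isMonoidalStruct : IsMonoidalStruct W.monoidalStruct := by
  refine ⟨{ W.monoidalStruct with
    tensorHom_def := ?_
    id_tensorHom_id := ?_
    tensorHom_comp_tensorHom := ?_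
    whiskerLeft_id := ?_
    id_whiskerRight := ?_
    associator_naturality := ?_
    leftUnitor_naturality := ?_
    rightUnitor_naturality := ?_
    pentagon := ?_
    triangle := ?_ }, rfl⟩
  · intro X₁ Y₁ X₂ Y₂ f g
    refine MHYDfd.hom_ext (TensorProduct.ext' fun x y => ?_)
    rfl
  · intro X Y
    refine MHYDfd.hom_ext (TensorProduct.ext' fun x y => ?_)
    rfl
  · intro X₁ Y₁ Z₁ X₂ Y₂ Z₂ f₁ f₂ g₁ g₂
    refine MHYDfd.hom_ext (TensorProduct.ext' fun x y => ?_)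
    rfl
  · intro X Y
    refine MHYDfd.hom_ext (TensorProduct.ext' fun x y => ?_)
    rfl
  · intro X Y
    refine MHYDfd.hom_ext (TensorProduct.ext' fun x y => ?_)
    rfl
  · intro X₁ X₂ X₃ Y₁ Y₂ Y₃ f₁ f₂ f₃
    refine MHYDfd.hom_ext (TensorProduct.ext_threefold fun x y z => ?_)
    -- Only the outer morphisms meet a `ξ`, with which they commute.
    have h1 := f₁.isHom.map_ξ x
    have h2 : Y₃.dat.ξ.symm (f₃.lin z) = f₃.lin (X₃.dat.ξ.symm z) :=
      Y₃.dat.ξ.injective (by rw [← f₃.isHom.map_ξ]; simp)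
    change Y₁.dat.ξ (f₁.lin x) ⊗ₜ[k] (f₂.lin y ⊗ₜ[k] Y₃.dat.ξ.symm (f₃.lin z)) =
      f₁.lin (X₁.dat.ξ x) ⊗ₜ[k] (f₂.lin y ⊗ₜ[k] f₃.lin (X₃.dat.ξ.symm z))
    rw [h1, h2]
  · intro X Y f
    refine MHYDfd.hom_ext (TensorProduct.ext' fun (x : k) y => ?_)
    change Y.dat.ξ (x • f.lin y) = f.lin (X.dat.ξ (x • y))
    rw [f.isHom.map_ξ, map_smul f.lin]
  · intro X Y f
    refine MHYDfd.hom_ext (TensorProduct.ext' fun y (x : k) => ?_)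
    change Y.dat.ξ (x • f.lin y) = f.lin (X.dat.ξ (x • y))
    rw [f.isHom.map_ξ, map_smul f.lin]
  · intro X Y Z V
    refine MHYDfd.hom_ext (TensorProduct.ext_fourfold fun x y z w => ?_)
    rfl
  · intro X Y
    refine MHYDfd.hom_ext (TensorProduct.ext_threefold fun x (c : k) y => ?_)
    change X.dat.ξ x ⊗ₜ[k] Y.dat.ξ (c • Y.dat.ξ.symm y) = X.dat.ξ (c • x) ⊗ₜ[k] y
    rw [map_smul, map_smul, Y.dat.ξ.apply_symm_apply, TensorProduct.smul_tmul]


theorem conjObj_one (M : A.MHYDfd) : W.conjObj 1 M = M := by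
  refine MHYDfd.ext_dat (YDData.mk_congr ?_ rfl ?_ ?_)
  · simp
  · ext h m
    change M.dat.act (autLin (M.dat.deg.fst⁻¹ * (1 : A.G).snd * M.dat.deg.fst * (1 : A.G).fst⁻¹) h)
      m = M.dat.act h m
    simp
  · ext m
    change (autLin ((1 : A.G).fst * (1 : A.G).snd⁻¹)).lTensor _ (M.dat.coact m) = M.dat.coact m
    simp

/-- The space and `ξ` do not change, so equality on the nose is a matter of degrees and of the
automorphisms that twist action and coaction, that is, of identities in groups. -/
theorem conjObj_mul (g h : A.G) (M : A.MHYDfd) :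
    W.conjObj (g * h) M = W.conjObj g (W.conjObj h M) := by
  refine MHYDfd.ext_dat (YDData.mk_congr ?_ rfl ?_ ?_)
  · change g * h * M.dat.deg * (g * h)⁻¹ = g * (h * M.dat.deg * h⁻¹) * g⁻¹
    group
  · change M.dat.act ∘ₗ autLin _ = (M.dat.act ∘ₗ autLin _) ∘ₗ autLin _
    rw [LinearMap.comp_assoc, ← autLin_mul]
    congr 2
    simp only [G.mul_fst, G.mul_snd, G.inv_fst]
    group
  · change (autLin _).lTensor _ ∘ₗ M.dat.coact =
      (autLin _).lTensor _ ∘ₗ (autLin _).lTensor _ ∘ₗ M.dat.coact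
    rw [← LinearMap.comp_assoc, ← LinearMap.lTensor_comp, ← autLin_mul]
    congr 3
    simp only [G.mul_fst, G.mul_snd]
    group

theorem conjObj_unitObj (g : A.G) : W.conjObj g W.unitObj = W.unitObj := by
  refine MHYDfd.ext_dat (YDData.mk_congr ?_ rfl ?_ ?_)
  · change g * 1 * g⁻¹ = 1
    group
  · refine LinearMap.ext fun h => LinearMap.ext fun (x : k) => ?_
    change A.counit (autLin _ h) • x = A.counit h • x
    rw [YDData.counit_autLin]
  · refine LinearMap.ext fun (x : k) => ?_
    change x ⊗ₜ[k] autLin _ A.one = x ⊗ₜ[k] A.one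
    congr 1
    exact Subtype.prop (p := (· ∈ A.Aut)) _ |>.2.2.1

theorem conjObj_tensorObj (g : A.G) (M N : A.MHYDfd) :
    W.conjObj g (W.tensorObj M N) = W.tensorObj (W.conjObj g M) (W.conjObj g N) := by
  refine MHYDfd.ext_dat (YDData.mk_congr ?_ rfl ?_ ?_)
  · change g * (M.dat.deg * N.dat.deg) * g⁻¹ = g * M.dat.deg * g⁻¹ * (g * N.dat.deg * g⁻¹)
    group
  · refine LinearMap.ext fun h => TensorProduct.ext' fun m n => ?_
    change M.dat.tensorAct N.dat _ _ = (M.dat.conj g).tensorAct (N.dat.conj g) h (m ⊗ₜ[k] n)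
    rw [YDData.tensorAct_tmul]
    refine Eq.trans ?_ (YDData.tensorAct_tmul (M.dat.conj g) (N.dat.conj g) h m n).symm
    rw [YDData.comul_autLin, ← LinearMap.comp_apply, ← TensorProduct.map_comp]
    have e1 : (M.dat.act.flip m ∘ₗ autLin N.dat.deg.fst) ∘ₗ autLin ((M.dat.deg * N.dat.deg).fst⁻¹ *
        g.snd * (M.dat.deg * N.dat.deg).fst * g.fst⁻¹) =
        (M.dat.act.flip m ∘ₗ autLin (M.dat.deg.fst⁻¹ * g.snd * M.dat.deg.fst * g.fst⁻¹)) ∘ₗ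
          autLin (g * N.dat.deg * g⁻¹).fst := by
      rw [LinearMap.comp_assoc, LinearMap.comp_assoc, ← autLin_mul, ← autLin_mul]
      congr 2
      simp only [G.mul_fst, G.inv_fst]
      group
    have e2 : (N.dat.act.flip n ∘ₗ autLin (N.dat.deg.fst⁻¹ * M.dat.deg.snd * N.dat.deg.fst)) ∘ₗ
        autLin ((M.dat.deg * N.dat.deg).fst⁻¹ *
          g.snd * (M.dat.deg * N.dat.deg).fst * g.fst⁻¹) =
        (N.dat.act.flip n ∘ₗ autLin (N.dat.deg.fst⁻¹ * g.snd * N.dat.deg.fst * g.fst⁻¹)) ∘ₗ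
          autLin ((g * N.dat.deg * g⁻¹).fst⁻¹ * (g * M.dat.deg * g⁻¹).snd *
            (g * N.dat.deg * g⁻¹).fst) := by
      rw [LinearMap.comp_assoc, LinearMap.comp_assoc, ← autLin_mul, ← autLin_mul]
      congr 2
      simp only [G.mul_fst, G.mul_snd, G.inv_fst, G.inv_snd]
      group
    exact congrArg₂ (fun f f₂ => TensorProduct.map f f₂ (A.comul h)) e1 e2
  · refine TensorProduct.ext' fun m n => ?_
    change (autLin _).lTensor _ (YDData.mulComm A _ _ (M.dat.coact m ⊗ₜ[k] N.dat.coact n)) =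
      YDData.mulComm A _ _ ((autLin _).lTensor _ (M.dat.coact m) ⊗ₜ[k]
        (autLin _).lTensor _ (N.dat.coact n))
    generalize g.fst * g.snd⁻¹ = f
    generalize M.dat.coact m = s
    generalize N.dat.coact n = t
    induction s with
    | zero => simp
    | add x y hx hy => simp only [map_add, TensorProduct.add_tmul, hx, hy]
    | tmul x y =>
      induction t with
      | zero => simp
      | add x y hx hy => simp only [map_add, TensorProduct.tmul_add, hx, hy]
      | tmul z w => simp [show autLin f (A.mul w y) = A.mul (autLin f w) (autLin f y) from
          f.2.2.1 w y]

theorem conjFunctor_map_tensor (g : A.G) {M M₂ N N₂ : A.MHYDfd} (f : M ⟶ M₂) (f₂ : N ⟶ N₂)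
    (h : W.conjObj g (W.tensorObj M N) = W.tensorObj (W.conjObj g M) (W.conjObj g N))
    (h₂ : W.tensorObj (W.conjObj g M₂) (W.conjObj g N₂) = W.conjObj g (W.tensorObj M₂ N₂)) :
    (W.conjFunctor g).map (W.monoidalStruct.tensorHom f f₂) = eqToHom h ≫
      W.monoidalStruct.tensorHom ((W.conjFunctor g).map f) ((W.conjFunctor g).map f₂) ≫
        eqToHom h₂ := by
  have h3 : MHYD.Hom.lin ((W.conjFunctor g).map (W.monoidalStruct.tensorHom f f₂)) =
    TensorProduct.map f.lin f₂.lin := rfl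
  have h4 : MHYD.Hom.lin
    (W.monoidalStruct.tensorHom ((W.conjFunctor g).map f) ((W.conjFunctor g).map f₂)) =
      TensorProduct.map f.lin f₂.lin := rfl
  refine MHYDfd.eq_eqToHom_comp h h₂ ?_
  exact (heq_of_eq h3).trans (heq_of_eq h4.symm)

theorem conjFunctor_map_associator (g : A.G) (M N P : A.MHYDfd)
    (h : W.conjObj g (W.tensorObj (W.tensorObj M N) P) =
      W.tensorObj (W.tensorObj (W.conjObj g M) (W.conjObj g N)) (W.conjObj g P))
    (h₂ : W.tensorObj (W.conjObj g M) (W.tensorObj (W.conjObj g N) (W.conjObj g P)) =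
      W.conjObj g (W.tensorObj M (W.tensorObj N P))) :
    (W.conjFunctor g).map (W.monoidalStruct.associator M N P).hom = eqToHom h ≫
      (W.monoidalStruct.associator (W.conjObj g M) (W.conjObj g N) (W.conjObj g P)).hom ≫
        eqToHom h₂ := by
  have h3 : MHYD.Hom.lin ((W.conjFunctor g).map (W.monoidalStruct.associator M N P).hom) =
    (YDData.assoc M.dat N.dat P.dat).toLinearMap := rfl
  have h4 : MHYD.Hom.lin
    (W.monoidalStruct.associator (W.conjObj g M) (W.conjObj g N) (W.conjObj g P)).hom =
      (YDData.assoc (M.dat.conj g) (N.dat.conj g) (P.dat.conj g)).toLinearMap := rfl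
  refine MHYDfd.eq_eqToHom_comp h h₂ ?_
  exact (heq_of_eq h3).trans ((heq_of_eq (YDData.assoc_conj g M.dat N.dat P.dat).symm).trans
    (heq_of_eq h4.symm))

theorem conjFunctor_map_leftUnitor (g : A.G) (M : A.MHYDfd)
    (h : W.conjObj g (W.tensorObj W.unitObj M) = W.tensorObj W.unitObj (W.conjObj g M)) :
    (W.conjFunctor g).map (W.monoidalStruct.leftUnitor M).hom =
      eqToHom h ≫ (W.monoidalStruct.leftUnitor (W.conjObj g M)).hom := by
  have h1 : MHYD.Hom.lin ((W.conjFunctor g).map (W.monoidalStruct.leftUnitor M).hom) =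
    (YDData.leftUnitor M.dat).toLinearMap := rfl
  have h2 : MHYD.Hom.lin (W.monoidalStruct.leftUnitor (W.conjObj g M)).hom =
    (YDData.leftUnitor (M.dat.conj g)).toLinearMap := rfl
  refine MHYDfd.eq_eqToHom_comp_left h ?_
  exact (heq_of_eq h1).trans ((heq_of_eq (YDData.leftUnitor_conj g M.dat).symm).trans
    (heq_of_eq h2.symm))

theorem conjFunctor_map_rightUnitor (g : A.G) (M : A.MHYDfd)
    (h : W.conjObj g (W.tensorObj M W.unitObj) = W.tensorObj (W.conjObj g M) W.unitObj) :
    (W.conjFunctor g).map (W.monoidalStruct.rightUnitor M).hom =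
      eqToHom h ≫ (W.monoidalStruct.rightUnitor (W.conjObj g M)).hom := by
  have h1 : MHYD.Hom.lin ((W.conjFunctor g).map (W.monoidalStruct.rightUnitor M).hom) =
    (YDData.rightUnitor M.dat).toLinearMap := rfl
  have h2 : MHYD.Hom.lin (W.monoidalStruct.rightUnitor (W.conjObj g M)).hom =
    (YDData.rightUnitor (M.dat.conj g)).toLinearMap := rfl
  refine MHYDfd.eq_eqToHom_comp_left h ?_
  exact (heq_of_eq h1).trans ((heq_of_eq (YDData.rightUnitor_conj g M.dat).symm).trans
    (heq_of_eq h2.symm))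

theorem isCrossed : letI := monoidalOfStruct W.monoidalStruct W.isMonoidalStruct
    (W.tCategoryData W.isMonoidalStruct).IsCrossed := by
  let _ := monoidalOfStruct W.monoidalStruct W.isMonoidalStruct
  exact
  { deg_eq_of_hom := fun f => f.isHom.deg_eq
    deg_tensor := fun _ _ => rfl
    -- Conjugation does not touch the linear map of a morphism, hence `HEq.rfl`.
    conj_one := CategoryTheory.Functor.ext W.conjObj_one fun _ _ _ =>
      MHYDfd.eq_eqToHom_comp _ _ HEq.rfl
    conj_mul := fun g h => CategoryTheory.Functor.ext (W.conjObj_mul g h) fun _ _ _ =>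
      MHYDfd.eq_eqToHom_comp _ _ HEq.rfl
    deg_conj := fun _ _ => rfl
    conj_tensorUnit := W.conjObj_unitObj
    conj_tensorObj := W.conjObj_tensorObj
    conj_tensorHom := fun g _ _ _ _ f f₂ => W.conjFunctor_map_tensor g f f₂ _ _
    conj_associator := fun g M N P => W.conjFunctor_map_associator g M N P _ _
    conj_leftUnitor := fun g M => W.conjFunctor_map_leftUnitor g M _
    conj_rightUnitor := fun g M => W.conjFunctor_map_rightUnitor g M _ }

end WellDefined

end MonoidalHomHopf

/-! ### Naturality, conjugation invariance and hexagons for the braiding. -/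

namespace MonoidalHomHopf

variable {k : Type u} {H : Type v} [Field k] [AddCommGroup H] [Module k H]
variable {A : MonoidalHomHopf k H}

namespace YDData

theorem braidLin_tmul_eq (M N : YDData A) (m : M.carrier) (n : N.carrier) :
    braidLin M N (m ⊗ₜ[k] n) = TensorProduct.map N.ξ.toLinearMap
      (M.act.flip (M.ξ.symm m) ∘ₗ autLin M.deg.snd⁻¹) (N.coact n) := rfl

theorem braidLin_conj (g : A.G) (M N : YDData A) :
    braidLin (M.conj g) (N.conj g) = braidLin M N := by
  refine TensorProduct.ext' fun m n => ?_
  rw [braidLin_tmul_eq]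
  refine (braidLin_tmul_eq (M.conj g) (N.conj g) m n).trans ?_
  -- The twist of the action of `M`, the new `β⁻¹` and the twist of the coaction of `N` multiply to
  -- the old `β⁻¹`.
  have e1 : ((M.act.flip (M.ξ.symm m) ∘ₗ autLin (M.deg.fst⁻¹ * g.snd * M.deg.fst * g.fst⁻¹)) ∘ₗ
      autLin (g * M.deg * g⁻¹).snd⁻¹) ∘ₗ autLin (g.fst * g.snd⁻¹) =
        M.act.flip (M.ξ.symm m) ∘ₗ autLin M.deg.snd⁻¹ := by
    rw [LinearMap.comp_assoc, LinearMap.comp_assoc, ← autLin_mul, ← autLin_mul]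
    congr 2
    simp only [G.mul_snd, G.inv_fst, G.inv_snd]
    group
  refine Eq.trans ?_ (congrArg (fun f => TensorProduct.map N.ξ.toLinearMap f (N.coact n)) e1)
  change TensorProduct.map N.ξ.toLinearMap _ ((autLin (g.fst * g.snd⁻¹)).lTensor _ (N.coact n)) = _
  rw [← LinearMap.comp_apply, LinearMap.map_comp_lTensor]
  rfl

theorem braidLin_natural {M M₂ N N₂ : YDData A} {f : M.carrier →ₗ[k] M₂.carrier}
    {g : N.carrier →ₗ[k] N₂.carrier} (hf : IsHom M M₂ f) (hg : IsHom N N₂ g) :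
    braidLin M₂ N₂ ∘ₗ TensorProduct.map f g = TensorProduct.map g f ∘ₗ braidLin M N := by
  refine TensorProduct.ext' fun m n => ?_
  rw [LinearMap.comp_apply, LinearMap.comp_apply, TensorProduct.map_tmul, braidLin_tmul_eq,
    braidLin_tmul_eq, hg.map_coact, ← hf.deg_eq]
  have h1 : M₂.ξ.symm (f m) = f (M.ξ.symm m) := M₂.ξ.injective (by rw [← hf.map_ξ]; simp)
  rw [h1]
  generalize N.coact n = t
  induction t with
  | zero => simp
  | add x y hx hy => simp only [map_add, hx, hy]
  | tmul x y => simp [hf.map_act, hg.map_ξ]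

/-- The hexagon identity for `c_{U ⊗ V, W}`. -/
theorem braidLin_tensor_left (U V : YDData A) {W : YDData A} (hW : W.IsYD)
    (u : U.carrier) (v : V.carrier) (w : W.carrier) :
    braidLin (U.tensor V) W ((u ⊗ₜ[k] v) ⊗ₜ[k] w) = assoc W U V
      ((braidLin U (W.conj V.deg)).rTensor V.carrier ((assoc U W V).symm
        ((braidLin V W).lTensor U.carrier (assoc U V W ((u ⊗ₜ[k] v) ⊗ₜ[k] w))))) := by
  -- Both sides are `Φ` of an iterated coaction of `w`: the left one comultiplies `w₁` in order to
  -- act on `U ⊗ V`, the right one coacts twice. The extra factor on the `U`-leg is the twist of the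
  -- coaction on the `V`-conjugate of `W`.
  let Φ : W.carrier ⊗[k] (H ⊗[k] H) →ₗ[k] W.carrier ⊗[k] (U.carrier ⊗[k] V.carrier) :=
    TensorProduct.map (W.ξ.toLinearMap ∘ₗ W.ξ.toLinearMap)
      (TensorProduct.map
        (U.act.flip (U.ξ.symm u) ∘ₗ autLin (U.deg.snd⁻¹ * (V.deg.fst * V.deg.snd⁻¹)))
        (V.act.flip (V.ξ.symm v) ∘ₗ autLin V.deg.snd⁻¹))
  have h1 : ∀ t : W.carrier ⊗[k] H, TensorProduct.map W.ξ.toLinearMap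
      ((U.tensorAct V).flip (U.ξ.symm u ⊗ₜ[k] V.ξ.symm v) ∘ₗ autLin (U.deg * V.deg).snd⁻¹) t =
        Φ (TensorProduct.map W.ξ.symm.toLinearMap A.comul t) := by
    intro t
    induction t with
    | zero => simp
    | add x y hx hy => simp only [map_add, hx, hy]
    | tmul x a =>
      simp only [Φ, TensorProduct.map_tmul, LinearMap.comp_apply, LinearMap.flip_apply,
        LinearEquiv.coe_coe, LinearEquiv.apply_symm_apply]
      rw [tensorAct_tmul, comul_autLin, ← LinearMap.comp_apply (TensorProduct.map _ _),
        ← TensorProduct.map_comp, LinearMap.comp_assoc, LinearMap.comp_assoc, ← autLin_mul,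
        ← autLin_mul]
      congr 5
      · simp only [G.mul_snd]; group
      · simp only [G.mul_snd]; group
  have h2 : ∀ s : W.carrier ⊗[k] H, ∀ a : H, assoc W U V ((TensorProduct.map W.ξ.toLinearMap
      ((U.act.flip (U.ξ.symm u)) ∘ₗ autLin U.deg.snd⁻¹)
        ((autLin (V.deg.fst * V.deg.snd⁻¹)).lTensor _ s)) ⊗ₜ[k]
          V.ξ (V.act (autLin V.deg.snd⁻¹ (A.ξ.symm a)) (V.ξ.symm v))) =
      Φ (TensorProduct.assoc k _ _ _ (s ⊗ₜ[k] A.ξ.symm a)) := by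
    intro s a
    induction s with
    | zero => simp
    | add x y hx hy => simp only [map_add, TensorProduct.add_tmul, hx, hy]
    | tmul x b =>
      simp only [assoc, LinearEquiv.trans_apply, TensorProduct.congr_tmul, LinearMap.lTensor_tmul,
        TensorProduct.map_tmul, TensorProduct.assoc_tmul, Φ, LinearMap.comp_apply,
        LinearMap.flip_apply, LinearEquiv.coe_coe, LinearEquiv.refl_apply,
        LinearEquiv.symm_apply_apply, autLin_mul]
  have h3 : ∀ t : W.carrier ⊗[k] H, assoc W U V
      ((braidLin U (W.conj V.deg)).rTensor V.carrier ((assoc U W V).symm (U.ξ u ⊗ₜ[k]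
        (TensorProduct.map W.ξ.toLinearMap (V.act.flip (V.ξ.symm v) ∘ₗ autLin V.deg.snd⁻¹)
          (TensorProduct.map W.ξ.symm.toLinearMap A.ξ.symm.toLinearMap t))))) =
      Φ (TensorProduct.assoc k _ _ _ (TensorProduct.map W.coact A.ξ.symm.toLinearMap t)) := by
    intro t
    induction t with
    | zero => simp
    | add x y hx hy => simp only [map_add, TensorProduct.tmul_add, hx, hy]
    | tmul x a =>
      rw [TensorProduct.map_tmul, TensorProduct.map_tmul, TensorProduct.map_tmul]
      refine Eq.trans ?_ (h2 (W.coact x) a)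
      simp only [LinearEquiv.coe_coe, LinearEquiv.apply_symm_apply]
      change assoc W U V ((braidLin U (W.conj V.deg)).rTensor V.carrier
        ((U.ξ.symm (U.ξ u) ⊗ₜ[k] x) ⊗ₜ[k] _)) = _
      rw [U.ξ.symm_apply_apply]
      rfl
  refine (h1 (W.coact w)).trans ?_
  rw [hW.coact_coassoc, ← h3, ← hW.coact_ξ_symm]
  rfl

/-- The hexagon identity for `c_{U, V ⊗ W}`. -/
theorem braidLin_tensor_right {U : YDData A} (V W : YDData A) (hU : U.IsYD)
    (u : U.carrier) (v : V.carrier) (w : W.carrier) :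
    braidLin U (V.tensor W) (u ⊗ₜ[k] (v ⊗ₜ[k] w)) = (assoc V W U).symm
      ((braidLin U W).lTensor V.carrier (assoc V U W
        ((braidLin U V).rTensor W.carrier ((assoc U V W).symm (u ⊗ₜ[k] (v ⊗ₜ[k] w)))))) := by
  have h1 : ∀ (x : V.carrier) (a : H) (s : W.carrier ⊗[k] H),
      TensorProduct.map (TensorProduct.congr V.ξ W.ξ).toLinearMap
        (U.act.flip (U.ξ.symm u) ∘ₗ autLin U.deg.snd⁻¹) (mulComm A _ _ ((x ⊗ₜ[k] a) ⊗ₜ[k] s)) =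
      (assoc V W U).symm (V.ξ (V.ξ x) ⊗ₜ[k] (TensorProduct.map W.ξ.toLinearMap
        (U.act.flip (U.ξ.symm (U.act (autLin U.deg.snd⁻¹ a) (U.ξ.symm (U.ξ.symm u)))) ∘ₗ
          autLin U.deg.snd⁻¹) s)) := by
    intro x a s
    induction s with
    | zero => simp
    | add x y hx hy => simp only [map_add, TensorProduct.tmul_add, hx, hy]
    | tmul y b =>
      change (V.ξ x ⊗ₜ[k] W.ξ y) ⊗ₜ[k] U.act (autLin U.deg.snd⁻¹ (A.mul b a)) (U.ξ.symm u) =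
        (V.ξ.symm (V.ξ (V.ξ x)) ⊗ₜ[k] W.ξ y) ⊗ₜ[k] U.ξ (U.act (autLin U.deg.snd⁻¹ b)
          (U.ξ.symm (U.act (autLin U.deg.snd⁻¹ a) (U.ξ.symm (U.ξ.symm u)))))
      -- Acting first with `v₁` and then with `w₁` is acting with `w₁v₁`, the order of the tensor
      -- coaction.
      rw [hU.ξ_act, U.ξ.apply_symm_apply, hU.act_assoc, U.ξ.apply_symm_apply,
        V.ξ.symm_apply_apply]
      congr 3
      exact (U.deg.snd⁻¹).2.2.1 b a
  have h2 : ∀ t : V.carrier ⊗[k] H, TensorProduct.map (TensorProduct.congr V.ξ W.ξ).toLinearMap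
        (U.act.flip (U.ξ.symm u) ∘ₗ autLin U.deg.snd⁻¹) (mulComm A _ _ (t ⊗ₜ[k] W.coact w)) =
      (assoc V W U).symm ((braidLin U W).lTensor V.carrier (assoc V U W
        ((TensorProduct.map V.ξ.toLinearMap (U.act.flip (U.ξ.symm (U.ξ.symm u)) ∘ₗ
          autLin U.deg.snd⁻¹) t) ⊗ₜ[k] W.ξ w))) := by
    intro t
    induction t with
    | zero => simp
    | add x y hx hy => simp only [map_add, TensorProduct.add_tmul, hx, hy]
    | tmul x a =>
      refine (h1 x a _).trans ?_
      change _ = (assoc V W U).symm ((braidLin U W).lTensor V.carrier (V.ξ (V.ξ x) ⊗ₜ[k]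
        (U.act (autLin U.deg.snd⁻¹ a) (U.ξ.symm (U.ξ.symm u)) ⊗ₜ[k] W.ξ.symm (W.ξ w))))
      rw [W.ξ.symm_apply_apply]
      rfl
  exact h2 (V.coact v)

end YDData

namespace WellDefined

variable (W : A.WellDefined)

/-- The braiding as a morphism. -/
noncomputable def braidHom (M N : A.MHYDfd) :
    W.tensorObj M N ⟶ W.tensorObj (W.conjObj M.dat.deg N) M :=
  ⟨YDData.braid M.dat N.dat, W.braid_isHom M N⟩

theorem isIso_braidHom {M N : A.MHYDfd} (h : Function.Bijective
    (YDData.braidLin M.dat N.dat)) : IsIso (W.braidHom M N) :=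
  (MHYDfd.isoOfEquiv (M := W.tensorObj M N) (N := W.tensorObj (W.conjObj M.dat.deg N) M)
    (LinearEquiv.ofBijective (YDData.braidLin M.dat N.dat) h) (W.braid_isHom M N)).isIso_hom

theorem braidHom_natural {M M₂ N N₂ : A.MHYDfd} (f : M ⟶ M₂) (g : N ⟶ N₂)
    (h : W.tensorObj (W.conjObj M.dat.deg N₂) M₂ = W.tensorObj (W.conjObj M₂.dat.deg N₂) M₂) :
    W.braidHom M N ≫ W.monoidalStruct.tensorHom ((W.conjFunctor M.dat.deg).map g) f ≫
        eqToHom h = W.monoidalStruct.tensorHom f g ≫ W.braidHom M₂ N₂ := by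
  have h1 : MHYD.Hom.lin (W.braidHom M N ≫
    W.monoidalStruct.tensorHom ((W.conjFunctor M.dat.deg).map g) f) =
      TensorProduct.map g.lin f.lin ∘ₗ YDData.braidLin M.dat N.dat := rfl
  have h2 : MHYD.Hom.lin (W.monoidalStruct.tensorHom f g ≫ W.braidHom M₂ N₂) =
    YDData.braidLin M₂.dat N₂.dat ∘ₗ TensorProduct.map f.lin g.lin := rfl
  rw [← Category.assoc]
  refine (MHYDfd.eq_comp_eqToHom h ?_).symm
  exact (heq_of_eq h2).trans ((heq_of_eq (YDData.braidLin_natural f.isHom g.isHom)).trans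
    (heq_of_eq h1.symm))

theorem conjFunctor_map_braidHom (g : A.G) (M N : A.MHYDfd)
    (h : W.conjObj g (W.tensorObj M N) = W.tensorObj (W.conjObj g M) (W.conjObj g N))
    (h₂ : W.tensorObj (W.conjObj (W.conjObj g M).dat.deg (W.conjObj g N)) (W.conjObj g M) =
      W.conjObj g (W.tensorObj (W.conjObj M.dat.deg N) M)) :
    (W.conjFunctor g).map (W.braidHom M N) = eqToHom h ≫
      W.braidHom (W.conjObj g M) (W.conjObj g N) ≫ eqToHom h₂ := by
  have h3 : MHYD.Hom.lin ((W.conjFunctor g).map (W.braidHom M N)) =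
    YDData.braidLin M.dat N.dat := rfl
  have h4 : MHYD.Hom.lin (W.braidHom (W.conjObj g M) (W.conjObj g N)) =
    YDData.braidLin (M.dat.conj g) (N.dat.conj g) := rfl
  refine MHYDfd.eq_eqToHom_comp h h₂ ?_
  exact (heq_of_eq h3).trans ((heq_of_eq (YDData.braidLin_conj g M.dat N.dat).symm).trans
    (heq_of_eq h4.symm))

theorem braidHom_tensor_left (U V X : A.MHYDfd)
    (h : W.tensorObj (W.conjObj U.dat.deg (W.conjObj V.dat.deg X)) (W.tensorObj U V) =
      W.tensorObj (W.conjObj (U.dat.deg * V.dat.deg) X) (W.tensorObj U V)) :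
    W.braidHom (W.tensorObj U V) X = (W.monoidalStruct.associator U V X).hom ≫
      W.monoidalStruct.whiskerLeft U (W.braidHom V X) ≫
        (W.monoidalStruct.associator U (W.conjObj V.dat.deg X) V).inv ≫
          W.monoidalStruct.whiskerRight (W.braidHom U (W.conjObj V.dat.deg X)) V ≫
            (W.monoidalStruct.associator (W.conjObj U.dat.deg (W.conjObj V.dat.deg X)) U V).hom ≫
              eqToHom h := by
  simp only [← Category.assoc]
  refine MHYDfd.eq_comp_eqToHom h ?_
  have h1 : MHYD.Hom.lin (W.braidHom (W.tensorObj U V) X) =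
    YDData.braidLin (U.dat.tensor V.dat) X.dat := rfl
  refine (heq_of_eq h1).trans (heq_of_eq ?_)
  exact TensorProduct.ext_threefold
    (YDData.braidLin_tensor_left U.dat V.dat X.obj.isYD)

theorem braidHom_tensor_right (U V X : A.MHYDfd)
    (h : W.tensorObj (W.tensorObj (W.conjObj U.dat.deg V) (W.conjObj U.dat.deg X)) U =
      W.tensorObj (W.conjObj U.dat.deg (W.tensorObj V X)) U) :
    W.braidHom U (W.tensorObj V X) = (W.monoidalStruct.associator U V X).inv ≫
      W.monoidalStruct.whiskerRight (W.braidHom U V) X ≫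
        (W.monoidalStruct.associator (W.conjObj U.dat.deg V) U X).hom ≫
          W.monoidalStruct.whiskerLeft (W.conjObj U.dat.deg V) (W.braidHom U X) ≫
            (W.monoidalStruct.associator (W.conjObj U.dat.deg V) (W.conjObj U.dat.deg X) U).inv ≫
              eqToHom h := by
  simp only [← Category.assoc]
  refine MHYDfd.eq_comp_eqToHom h ?_
  have h1 : MHYD.Hom.lin (W.braidHom U (W.tensorObj V X)) =
    YDData.braidLin U.dat (V.dat.tensor X.dat) := rfl
  refine (heq_of_eq h1).trans (heq_of_eq ?_)
  exact TensorProduct.ext (LinearMap.ext fun u => TensorProduct.ext'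
    (YDData.braidLin_tensor_right V.dat X.dat U.obj.isYD u))

theorem isBraidedTCategory (hb : ∀ M N : A.MHYDfd, Function.Bijective
    (YDData.braidLin M.dat N.dat)) :
    letI := monoidalOfStruct W.monoidalStruct W.isMonoidalStruct
    (W.tCategoryData W.isMonoidalStruct).IsBraidedTCategory := by
  let _ := monoidalOfStruct W.monoidalStruct W.isMonoidalStruct
  exact
  { toIsCrossed := W.isCrossed
    braid_isIso := fun M N => W.isIso_braidHom (hb M N)
    braid_natural := fun f g => W.braidHom_natural f g _
    braid_tensor_left := fun U V X => W.braidHom_tensor_left U V X _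
    braid_tensor_right := fun U V X => W.braidHom_tensor_right U V X _
    conj_braid := fun g M N => W.conjFunctor_map_braidHom g M N _ _ }

end WellDefined

end MonoidalHomHopf

/-! ### Triangle identities for the two duals. -/

namespace MonoidalHomHopf

variable {k : Type u} {H : Type v} [Field k] [AddCommGroup H] [Module k H]
variable {A : MonoidalHomHopf k H}

namespace YDData

variable (M : YDData A) [FiniteDimensional k M.carrier]

theorem leftDual_coevaluation_evaluation (p : Module.Dual k M.carrier) (x : k) :
    (contractLeft k M.carrier).rTensor (Module.Dual k M.carrier)
        ((assoc M.leftDual M M.leftDual).symm (p ⊗ₜ[k] coevaluation k M.carrier x)) =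
      (leftUnitor M.leftDual).symm (rightUnitor M.leftDual (p ⊗ₜ[k] x)) := by
  apply (TensorProduct.lid k (Module.Dual k M.carrier)).injective
  -- For arbitrary `z` in place of the coevaluation, the zigzag applies the endomorphism that
  -- corresponds to `z`, conjugated by `ξ`; for the coevaluation this endomorphism is a scalar.
  have h1 : ∀ (z : M.carrier ⊗[k] Module.Dual k M.carrier) (n : M.carrier),
      TensorProduct.lid k (Module.Dual k M.carrier)
        ((contractLeft k M.carrier).rTensor (Module.Dual k M.carrier)
          ((assoc M.leftDual M M.leftDual).symm (p ⊗ₜ[k] z))) n =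
        p (M.ξ (dualTensorHom k M.carrier M.carrier (TensorProduct.comm k _ _ z)
          (M.ξ.symm n))) := by
    intro z n
    induction z with
    | zero => simp
    | add y z hy hz =>
      simp only [map_add, TensorProduct.tmul_add, LinearMap.add_apply, hy, hz]
    | tmul m q =>
      change p (M.ξ m) * q (M.ξ.symm n) = p (M.ξ (q (M.ξ.symm n) • m))
      simp [_root_.mul_comm]
  ext n
  rw [h1, YetterDrinfeld.dualTensorHom_coevaluation]
  change p (M.ξ (x • M.ξ.symm n)) = (1 : k) * (x * p (M.ξ.symm (M.ξ n)))
  simp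

theorem leftDual_evaluation_coevaluation (m : M.carrier) (x : k) :
    (contractLeft k M.carrier).lTensor M.carrier
        (assoc M M.leftDual M (coevaluation k M.carrier x ⊗ₜ[k] m)) =
      (rightUnitor M).symm (leftUnitor M (x ⊗ₜ[k] m)) := by
  apply (TensorProduct.rid k M.carrier).injective
  have h1 : ∀ z : M.carrier ⊗[k] Module.Dual k M.carrier,
      TensorProduct.rid k M.carrier ((contractLeft k M.carrier).lTensor M.carrier
        (assoc M M.leftDual M (z ⊗ₜ[k] m))) =
        M.ξ (dualTensorHom k M.carrier M.carrier (TensorProduct.comm k _ _ z)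
          (M.ξ.symm m)) := by
    intro z
    induction z with
    | zero => simp
    | add y z hy hz =>
      simp only [map_add, TensorProduct.add_tmul, LinearMap.add_apply, hy, hz]
    | tmul a q =>
      change q (M.ξ.symm m) • M.ξ a = M.ξ (q (M.ξ.symm m) • a)
      simp
  rw [h1, YetterDrinfeld.dualTensorHom_coevaluation]
  change M.ξ (x • M.ξ.symm m) = (1 : k) • M.ξ.symm (M.ξ (x • m))
  simp

theorem rightDual_coevaluation_evaluation (m : M.carrier) (x : k) :
    (contractRight k M.carrier).rTensor M.carrier
        ((assoc M M.rightDual M).symm (m ⊗ₜ[k] TensorProduct.comm k M.carrier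
          (Module.Dual k M.carrier) (coevaluation k M.carrier x))) =
      (leftUnitor M).symm (rightUnitor M (m ⊗ₜ[k] x)) := by
  apply (TensorProduct.lid k M.carrier).injective
  have h1 : ∀ z : M.carrier ⊗[k] Module.Dual k M.carrier,
      TensorProduct.lid k M.carrier ((contractRight k M.carrier).rTensor M.carrier
        ((assoc M M.rightDual M).symm (m ⊗ₜ[k] TensorProduct.comm k M.carrier
          (Module.Dual k M.carrier) z))) =
        M.ξ (dualTensorHom k M.carrier M.carrier (TensorProduct.comm k _ _ z)
          (M.ξ.symm m)) := by
    intro z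
    induction z with
    | zero => simp
    | add y z hy hz =>
      simp only [map_add, TensorProduct.tmul_add, LinearMap.add_apply, hy, hz]
    | tmul a q =>
      change q (M.ξ.symm m) • M.ξ a = M.ξ (q (M.ξ.symm m) • a)
      simp
  rw [h1, YetterDrinfeld.dualTensorHom_coevaluation]
  change M.ξ (x • M.ξ.symm m) = (1 : k) • M.ξ.symm (M.ξ (x • m))
  simp

theorem rightDual_evaluation_coevaluation (p : Module.Dual k M.carrier) (x : k) :
    (contractRight k M.carrier).lTensor (Module.Dual k M.carrier)
        (assoc M.rightDual M M.rightDual (TensorProduct.comm k M.carrier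
          (Module.Dual k M.carrier) (coevaluation k M.carrier x) ⊗ₜ[k] p)) =
      (rightUnitor M.rightDual).symm (leftUnitor M.rightDual (x ⊗ₜ[k] p)) := by
  apply (TensorProduct.rid k (Module.Dual k M.carrier)).injective
  have h1 : ∀ (z : M.carrier ⊗[k] Module.Dual k M.carrier) (n : M.carrier),
      TensorProduct.rid k (Module.Dual k M.carrier)
        ((contractRight k M.carrier).lTensor (Module.Dual k M.carrier)
          (assoc M.rightDual M M.rightDual (TensorProduct.comm k M.carrier
            (Module.Dual k M.carrier) z ⊗ₜ[k] p))) n =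
        p (M.ξ (dualTensorHom k M.carrier M.carrier (TensorProduct.comm k _ _ z)
          (M.ξ.symm n))) := by
    intro z n
    induction z with
    | zero => simp
    | add y z hy hz =>
      simp only [map_add, TensorProduct.add_tmul, LinearMap.add_apply, hy, hz]
    | tmul m q =>
      change p (M.ξ m) * q (M.ξ.symm n) = p (M.ξ (q (M.ξ.symm n) • m))
      simp [_root_.mul_comm]
  ext n
  rw [h1, YetterDrinfeld.dualTensorHom_coevaluation]
  change p (M.ξ (x • M.ξ.symm n)) = (1 : k) * (x * p (M.ξ.symm (M.ξ n)))
  simp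

end YDData

namespace WellDefined

variable (W : A.WellDefined)

/-- `M*` is a left dual of `M`. -/
@[reducible]
noncomputable def leftExactPairing (M : A.MHYDfd) :
    letI := monoidalOfStruct W.monoidalStruct W.isMonoidalStruct
    ExactPairing M (W.leftDual M) :=
  letI := monoidalOfStruct W.monoidalStruct W.isMonoidalStruct
  { coevaluation' := W.coevLeft M
    evaluation' := W.evLeft M
    coevaluation_evaluation' := MHYDfd.hom_ext (TensorProduct.ext'
      (YDData.leftDual_coevaluation_evaluation M.dat))
    evaluation_coevaluation' := MHYDfd.hom_ext (TensorProduct.ext' fun (x : k) m =>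
      YDData.leftDual_evaluation_coevaluation M.dat m x) }

/-- `*M` is a right dual of `M`. -/
@[reducible]
noncomputable def rightExactPairing (M : A.MHYDfd) :
    letI := monoidalOfStruct W.monoidalStruct W.isMonoidalStruct
    ExactPairing (W.rightDual M) M :=
  letI := monoidalOfStruct W.monoidalStruct W.isMonoidalStruct
  { coevaluation' := W.coevRight M
    evaluation' := W.evRight M
    coevaluation_evaluation' := MHYDfd.hom_ext (TensorProduct.ext'
      (YDData.rightDual_coevaluation_evaluation M.dat))
    evaluation_coevaluation' := MHYDfd.hom_ext (TensorProduct.ext' fun (x : k) p =>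
      YDData.rightDual_evaluation_coevaluation M.dat p x) }

end WellDefined

end MonoidalHomHopf

theorem corollary3p3 {k : Type u} {H : Type v} [Field k] [AddCommGroup H] [Module k H]
    (A : MonoidalHomHopf k H) :
    ∃ (W : A.WellDefined) (hW : IsMonoidalStruct W.monoidalStruct),
      letI := monoidalOfStruct W.monoidalStruct hW
      (W.tCategoryData hW).IsBraidedTCategory ∧
      (∀ M : A.MHYDfd,
        (W.tCategoryData hW).deg (W.leftDual M) = ((W.tCategoryData hW).deg M)⁻¹ ∧
        ∃ P : ExactPairing M (W.leftDual M),
          P.coevaluation' = W.coevLeft M ∧ P.evaluation' = W.evLeft M) ∧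
      (∀ M : A.MHYDfd,
        (W.tCategoryData hW).deg (W.rightDual M) = ((W.tCategoryData hW).deg M)⁻¹ ∧
        ∃ P : ExactPairing (W.rightDual M) M,
          P.coevaluation' = W.coevRight M ∧ P.evaluation' = W.evRight M) :=
  have W := A.wellDefined
  ⟨W, W.isMonoidalStruct, W.isBraidedTCategory A.braidLin_bijective,
    fun M => ⟨rfl, W.leftExactPairing M, rfl, rfl⟩,
    fun M => ⟨rfl, W.rightExactPairing M, rfl, rfl⟩⟩
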